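/- **Setting.** Let $n\ge 0$, $m\ge 1$, and let $X_0,X_1\in\mathbb R^{n\times T}$, $U_0\in\mathbb R^{m\times T}$ be data matrices such that $D_0=\begin{bmatrix}U_0\\X_0\end{bmatrix}$ has full row rank $m+n$. Put $\Lambda=\frac1T D_0D_0^\top$, $\overline X_0=\frac1T X_0D_0^\top$, $\overline U_0=\frac1T U_0D_0^\top$, $\overline X_1=\frac1T X_1D_0^\top$, $\overline X_0^\dagger=\overline X_0^\top(\overline X_0\overline X_0^\top)^{-1}$, $\Pi_{\overline X_0}=I-\overline X_0^\dagger\overline X_0$ and $M=\overline U_0\Pi_{\overline X_0}\overline U_0^\top$. Let $[\widehat A~\widehat B]$ be the least-squares estimate, i.e. the minimizer over $(A,B)$ of the sum of squared entries of $X_1-AX_0-BU_0$. Let $Q\succ0$, $R\succ0$, $\delta\in\mathbb R^n$, let $x_0\in\mathbb R^n$ be an initial state, and let $w_0,w_1,\dots$ be i.i.d. $\mathcal N(0,W)$ with $W\succ0$. For a closed loop generating states $x_t$ and inputs $u_t$, the cost is $$\limsup_{N\to\infty}\frac1N\,\mathbb E\Big[\sum_{t=0}^{N-1}(x_t-\delta)^\top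 Q(x_t-\delta)+u_t^\top Ru_t\Big]\in[0,\infty].$$ For $\theta=[K~l]\in\mathbb R^{m\times(n+1)}$, $J(\theta)$ denotes this cost for $x_{t+1}=\widehat Ax_t+\widehat Bu_t+w_t$, $u_t=Kx_t+l$, and $J^*=\inf_\theta J(\theta)$. For $\xi=[V~h]\in\mathbb R^{(m+n)\times(n+1)}$, $J(\xi)$ denotes this cost for $x_{t+1}=\overline X_1Vx_t+\overline X_1h+w_t$, $u_t=\overline U_0Vx_t+\overline U_0h$. Let $$\mathcal S=\{\xi=[V~h]:\ \overline X_0V=I,\ \overline X_0h=0,\ \rho(\overline X_1V)<1\},$$ $$\mathcal S_\theta(a)=\Big\{\theta:\ \exists\,\xi\in\mathcal S,\ J(\xi)\le a,\ \begin{bmatrix}K&l\\I_n&0\end{bmatrix}=\Lambda\xi\Big\}.$$ Gradients are taken with respect to the Frobenius inner product $\langle\cdot,\cdot\rangle$, with norm $\|\cdot\|_F$; $\|M\|$ and $\underline\sigma(M)$ are the spectral norm and the smallest singular value of $M$. Call $\ell>0$ a *smoothness constant at level $a$* if $$J(\theta')\le J(\theta)+\langle\nabla J(\theta),\theta'-\theta\rangle+\tfrac{\ell}{2}\|\theta'-\theta\|_F^2$$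 for all $\theta,\theta'\in\mathcal S_\theta(a)$ such that $\theta+\phi(\theta'-\theta)\in\mathcal S_\theta(a)$ for all $\phi\in(0,1)$, and call $\lambda>0$ a *gradient domination constant at level $a$* if $J(\theta)-J^*\le\lambda\|\nabla J(\theta)\|_F^2$ for all $\theta\in\mathcal S_\theta(a)$. **Theorem.** Let $\xi^0\in\mathcal S$. Then $J(\xi)$ is finite and differentiable at every $\xi\in\mathcal S$, $J(\theta)$ is differentiable at every $\theta\in\mathcal S_\theta(a)$ for every $a$, and for every $a\ge J^*$ a smoothness constant and a gradient domination constant at level $a$ exist. Moreover: 1. Let $\ell^0$ and $\lambda^0$ be any smoothness and gradient domination constants at level $J(\xi^0)$, let $\eta\in\big(0,\,1/(\ell^0\|M\|)\big]$ and $\nu=\eta\,(1-\ell^0\|M\|\eta/2)\,\underline\sigma(M)/\lambda^0$. Then $\nu>0$, and $\nu\le1$ if $J(\xi^0)>J^*$. The projected-gradient (DeePO) iteration $\xi^{t+1}=\xi^t-\eta\,\Pi_{\overline X_0}\nabla J(\xi^t)$ stays in $\mathcal S$ and converges linearly: $$J(\xi^{t+1})-J^*\le(1-\nu)\,\big(J(\xi^t)-J^*\big),\qquad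 t=0,1,2,\dots$$ 2. The Riccati equation $P=\widehat A^\top P\widehat A+Q-\widehat A^\top P\widehat B(\widehat B^\top P\widehat B+R)^{-1}\widehat B^\top P\widehat A$ has a unique positive semidefinite solution $P$. With $\hat K=-(\widehat B^\top P\widehat B+R)^{-1}\widehat B^\top P\widehat A$ and $\hat l=(\widehat B^\top P\widehat B+R)^{-1}\widehat B^\top(I-\widehat A-\widehat B\hat K)^{-\top}Q\delta$, the certainty-equivalence (indirect) policy $[\hat K~\hat l]$ is the unique minimizer of $J(\theta)$ over all $\theta$. The matrix $$\xi^*=\Lambda^{-1}\begin{bmatrix}\hat K&\hat l\\I_n&0\end{bmatrix}$$ lies in $\mathcal S$, satisfies $J(\xi^*)=J^*$, and is the unique minimizer of $J$ over $\mathcal S$. -/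

import Mathlib

open MeasureTheory ProbabilityTheory Filter Matrix
open scoped ENNReal

-- Parameter matrices `ξ`, `θ` carry the Frobenius norm.
attribute [local instance] Matrix.frobeniusNormedAddCommGroup Matrix.frobeniusNormedSpace

noncomputable section

namespace DeePO

/-! ### Matrix notions -/

/-- The right inverse `Xᵀ (X Xᵀ)⁻¹` of a matrix of full row rank. -/
def rightInv {p q : Type*} [Fintype p] [DecidableEq p] [Fintype q]
    (X : Matrix p q ℝ) : Matrix q p ℝ := Xᵀ * (X * Xᵀ)⁻¹

/-- The spectral radius of a real square matrix (over its complex eigenvalues). -/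
def specRad {p : Type*} [Fintype p] [DecidableEq p] (F : Matrix p p ℝ) : ℝ≥0∞ :=
  spectralRadius ℂ (F.map (algebraMap ℝ ℂ))

/-- The spectral norm (operator 2-norm) of a square matrix. -/
def opNorm {p : Type*} [Fintype p] [DecidableEq p] (M : Matrix p p ℝ) : ℝ :=
  ‖Matrix.toEuclideanCLM (𝕜 := ℝ) M‖

/-- The smallest singular value of an `m × m` matrix, `0 < m`
(Mathlib lists singular values in descending order, starting with index `0`). -/
def minSingularValue {m : ℕ} (M : Matrix (Fin m) (Fin m) ℝ) : ℝ :=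
  (Matrix.toEuclideanLin M).singularValues (m - 1)

/-- The gradient of a function of a matrix, for the Frobenius inner product:
the matrix of all its partial derivatives. -/
def matGrad {p q : Type*} [Fintype p] [Fintype q] [DecidableEq p] [DecidableEq q]
    (f : Matrix p q ℝ → ℝ) (Z : Matrix p q ℝ) : Matrix p q ℝ :=
  Matrix.of fun i j => fderiv ℝ f Z (Matrix.single i j 1)

/-- The linear part `K` of `[K l]` (or `V` of `[V h]`). -/
def gain {p q : Type*} (Z : Matrix p (q ⊕ Unit) ℝ) : Matrix p q ℝ := Z.toCols₁

/-- The constant part `l` of `[K l]` (or `h` of `[V h]`). -/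
def offset {p q : Type*} (Z : Matrix p (q ⊕ Unit) ℝ) : p → ℝ := fun i => Z i (Sum.inr ())

/-- The parameter `[K l]`. -/
def mkPolicy {p q : Type*} (K : Matrix p q ℝ) (l : p → ℝ) : Matrix p (q ⊕ Unit) ℝ :=
  Matrix.fromCols K (Matrix.replicateCol Unit l)

/-! ### Data and tracking problem -/

/-- The raw ingredients: offline data matrices `X₀ U₀ X₁`, cost weights `Q R`, setpoint `δ`,
initial state, and the noise process `w` on a probability space. -/
structure Setting (n m T : ℕ) (Ω : Type*) [MeasurableSpace Ω] where
  X₀ : Matrix (Fin n) (Fin T) ℝ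
  U₀ : Matrix (Fin m) (Fin T) ℝ
  X₁ : Matrix (Fin n) (Fin T) ℝ
  Q : Matrix (Fin n) (Fin n) ℝ
  R : Matrix (Fin m) (Fin m) ℝ
  δ : Fin n → ℝ
  xInit : Fin n → ℝ
  P : Measure Ω
  w : ℕ → Ω → EuclideanSpace ℝ (Fin n)

namespace Setting

variable {n m T : ℕ} {Ω : Type*} [MeasurableSpace Ω] (S : Setting n m T Ω)

/-- `D₀ = [U₀; X₀]`. -/
def D₀ : Matrix (Fin m ⊕ Fin n) (Fin T) ℝ := Matrix.fromRows S.U₀ S.X₀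

/-- The sample covariance `Λ = D₀ D₀ᵀ / T`. -/
def Λ : Matrix (Fin m ⊕ Fin n) (Fin m ⊕ Fin n) ℝ := (1 / (T : ℝ)) • (S.D₀ * S.D₀ᵀ)

/-- `X̄₀ = X₀ D₀ᵀ / T`. -/
def barX₀ : Matrix (Fin n) (Fin m ⊕ Fin n) ℝ := (1 / (T : ℝ)) • (S.X₀ * S.D₀ᵀ)

/-- `Ū₀ = U₀ D₀ᵀ / T`. -/
def barU₀ : Matrix (Fin m) (Fin m ⊕ Fin n) ℝ := (1 / (T : ℝ)) • (S.U₀ * S.D₀ᵀ)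

/-- `X̄₁ = X₁ D₀ᵀ / T`. -/
def barX₁ : Matrix (Fin n) (Fin m ⊕ Fin n) ℝ := (1 / (T : ℝ)) • (S.X₁ * S.D₀ᵀ)

/-- The projection `I - X̄₀† X̄₀` onto the null space of `X̄₀`. -/
def proj : Matrix (Fin m ⊕ Fin n) (Fin m ⊕ Fin n) ℝ := 1 - rightInv S.barX₀ * S.barX₀

/-- `M = Ū₀ (I - X̄₀† X̄₀) Ū₀ᵀ`. -/
def M : Matrix (Fin m) (Fin m) ℝ := S.barU₀ * S.proj * S.barU₀ᵀ

/-- The residual sum of squares of the model `X₁ ≈ A X₀ + B U₀`. -/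
def residual (A : Matrix (Fin n) (Fin n) ℝ) (B : Matrix (Fin n) (Fin m) ℝ) : ℝ :=
  ∑ i, ∑ t, ((S.X₁ - A * S.X₀ - B * S.U₀) i t) ^ 2

/-- `(A, B)` is a least-squares estimate of the system from the data. -/
def IsLeastSquares (A : Matrix (Fin n) (Fin n) ℝ) (B : Matrix (Fin n) (Fin m) ℝ) : Prop :=
  ∀ A' B', S.residual A B ≤ S.residual A' B'

/-! ### The average cost -/

/-- The process `x_{t+1} = step x_t + w_t` started at the initial state. -/
def state (step : (Fin n → ℝ) → (Fin n → ℝ)) : ℕ → Ω → (Fin n → ℝ)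
  | 0, _ => S.xInit
  | t + 1, ω => step (state step t ω) + (S.w t ω).ofLp

/-- The one-step cost `(x - δ)ᵀ Q (x - δ) + uᵀ R u`. -/
def stageCost (x : Fin n → ℝ) (u : Fin m → ℝ) : ℝ :=
  (x - S.δ) ⬝ᵥ (S.Q *ᵥ (x - S.δ)) + u ⬝ᵥ (S.R *ᵥ u)

/-- `limsup_N (1/N) E[∑_{t<N} stage cost]` for the closed loop `x ↦ step x` with inputs
`u = input x`. The stage costs are nonnegative (for the weights considered), so the expectation
and the limsup are taken in `[0, ∞]`. -/
def avgCost (step : (Fin n → ℝ) → (Fin n → ℝ)) (input : (Fin n → ℝ) → (Fin m → ℝ)) : ℝ≥0∞ :=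
  limsup (fun N : ℕ =>
    (∫⁻ ω, ENNReal.ofReal (∑ t ∈ Finset.range N,
      S.stageCost (S.state step t ω) (input (S.state step t ω))) ∂S.P) / (N : ℝ≥0∞)) atTop

/-- The affine feedback `u = K x + l` of `θ = [K l]`. -/
def feedback (θ : Matrix (Fin m) (Fin n ⊕ Unit) ℝ) (x : Fin n → ℝ) : Fin m → ℝ :=
  gain θ *ᵥ x + offset θ

/-- The cost of `θ = [K l]` for the model `x⁺ = A x + B u + w`, `u = K x + l`, in `[0, ∞]`. -/
def modelCostE (A : Matrix (Fin n) (Fin n) ℝ) (B : Matrix (Fin n) (Fin m) ℝ)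
    (θ : Matrix (Fin m) (Fin n ⊕ Unit) ℝ) : ℝ≥0∞ :=
  S.avgCost (fun x => A *ᵥ x + B *ᵥ feedback θ x) (feedback θ)

/-- The cost of `θ` as a real number. -/
def modelCost (A : Matrix (Fin n) (Fin n) ℝ) (B : Matrix (Fin n) (Fin m) ℝ)
    (θ : Matrix (Fin m) (Fin n ⊕ Unit) ℝ) : ℝ := (S.modelCostE A B θ).toReal

/-- The optimal cost `J*` over all affine policies for the model `(A, B)`. -/
def optCost (A : Matrix (Fin n) (Fin n) ℝ) (B : Matrix (Fin n) (Fin m) ℝ) : ℝ :=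
  (⨅ θ, S.modelCostE A B θ).toReal

/-- The data-driven cost of `ξ = [V h]`: the closed loop is
`x⁺ = X̄₁ V x + X̄₁ h + w`, `u = Ū₀ V x + Ū₀ h`; value in `[0, ∞]`. -/
def JE (ξ : Matrix (Fin m ⊕ Fin n) (Fin n ⊕ Unit) ℝ) : ℝ≥0∞ :=
  S.avgCost (fun x => (S.barX₁ * gain ξ) *ᵥ x + S.barX₁ *ᵥ offset ξ)
    (fun x => (S.barU₀ * gain ξ) *ᵥ x + S.barU₀ *ᵥ offset ξ)

/-- The data-driven cost `J(ξ)` as a real number. -/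
def J (ξ : Matrix (Fin m ⊕ Fin n) (Fin n ⊕ Unit) ℝ) : ℝ := (S.JE ξ).toReal

/-! ### Feasible policies and the iteration -/

/-- The feasible set: `X̄₀ V = I`, `X̄₀ h = 0`, `ρ(X̄₁ V) < 1`. -/
def feasible : Set (Matrix (Fin m ⊕ Fin n) (Fin n ⊕ Unit) ℝ) :=
  {ξ | S.barX₀ * gain ξ = 1 ∧ S.barX₀ *ᵥ offset ξ = 0 ∧ specRad (S.barX₁ * gain ξ) < 1}

/-- The stacked matrix `[K l; I 0]` of `θ = [K l]`. -/
def stack (θ : Matrix (Fin m) (Fin n ⊕ Unit) ℝ) : Matrix (Fin m ⊕ Fin n) (Fin n ⊕ Unit) ℝ :=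
  Matrix.fromRows θ (mkPolicy 1 0)

/-- The sublevel set of `θ = [K l]` with `[K l; I 0] = Λ ξ` for a feasible `ξ` with `J(ξ) ≤ a`. -/
def sublevel (a : ℝ) : Set (Matrix (Fin m) (Fin n ⊕ Unit) ℝ) :=
  {θ | ∃ ξ ∈ S.feasible, S.J ξ ≤ a ∧ stack θ = S.Λ * ξ}

/-- `ℓ` is a smoothness constant of the model-based cost on the sublevel set at height `a`. -/
def IsSmoothnessConst (A : Matrix (Fin n) (Fin n) ℝ) (B : Matrix (Fin n) (Fin m) ℝ)
    (a ℓ : ℝ) : Prop :=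
  ∀ θ ∈ S.sublevel a, ∀ θ' ∈ S.sublevel a,
    (∀ φ ∈ Set.Ioo (0 : ℝ) 1, θ + φ • (θ' - θ) ∈ S.sublevel a) →
    S.modelCost A B θ' ≤ S.modelCost A B θ +
      ((matGrad (S.modelCost A B) θ)ᵀ * (θ' - θ)).trace + ℓ * ‖θ' - θ‖ ^ 2 / 2

/-- `lam` is a gradient-domination constant of the model-based cost on the sublevel set at
height `a`. -/
def IsGradDomConst (A : Matrix (Fin n) (Fin n) ℝ) (B : Matrix (Fin n) (Fin m) ℝ)
    (a lam : ℝ) : Prop :=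
  ∀ θ ∈ S.sublevel a,
    S.modelCost A B θ - S.optCost A B ≤ lam * ‖matGrad (S.modelCost A B) θ‖ ^ 2

/-- The projected gradient iteration `ξ⁺ = ξ - η Π ∇J(ξ)` started at `ξ₀`. -/
def iterate (η : ℝ) (ξ₀ : Matrix (Fin m ⊕ Fin n) (Fin n ⊕ Unit) ℝ) :
    ℕ → Matrix (Fin m ⊕ Fin n) (Fin n ⊕ Unit) ℝ
  | 0 => ξ₀
  | t + 1 => iterate η ξ₀ t - η • (S.proj * matGrad S.J (iterate η ξ₀ t))

/-- The rate `ν = η (1 - ℓ ‖M‖ η / 2) σ_min(M) / lam`. -/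
def rate (η ℓ lam : ℝ) : ℝ :=
  η * (1 - ℓ * opNorm S.M * η / 2) * minSingularValue S.M / lam

/-! ### The certainty-equivalence policy -/

/-- `P` is a positive semidefinite solution of the discrete-time algebraic Riccati equation
of the model `(A, B)`. -/
def IsRiccatiSolution (A : Matrix (Fin n) (Fin n) ℝ) (B : Matrix (Fin n) (Fin m) ℝ)
    (P : Matrix (Fin n) (Fin n) ℝ) : Prop :=
  P.PosSemidef ∧
    P = Aᵀ * P * A + S.Q - Aᵀ * P * B * (Bᵀ * P * B + S.R)⁻¹ * Bᵀ * P * A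

/-- `K = -(Bᵀ P B + R)⁻¹ Bᵀ P A`. -/
def lqtGain (A : Matrix (Fin n) (Fin n) ℝ) (B : Matrix (Fin n) (Fin m) ℝ)
    (P : Matrix (Fin n) (Fin n) ℝ) : Matrix (Fin m) (Fin n) ℝ :=
  -((Bᵀ * P * B + S.R)⁻¹ * Bᵀ * P * A)

/-- `l = (Bᵀ P B + R)⁻¹ Bᵀ (I - A - B K)⁻ᵀ Q δ`. -/
def lqtOffset (A : Matrix (Fin n) (Fin n) ℝ) (B : Matrix (Fin n) (Fin m) ℝ)
    (P : Matrix (Fin n) (Fin n) ℝ) : Fin m → ℝ :=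
  ((Bᵀ * P * B + S.R)⁻¹ * Bᵀ * ((1 - A - B * S.lqtGain A B P)⁻¹)ᵀ * S.Q) *ᵥ S.δ

/-- The LQT policy `[K l]` of the model `(A, B)` built from the Riccati solution `P`. -/
def lqtPolicy (A : Matrix (Fin n) (Fin n) ℝ) (B : Matrix (Fin n) (Fin m) ℝ)
    (P : Matrix (Fin n) (Fin n) ℝ) : Matrix (Fin m) (Fin n ⊕ Unit) ℝ :=
  mkPolicy (S.lqtGain A B P) (S.lqtOffset A B P)

end Setting

end DeePO

end

/-! In the homogeneous coordinate `[x; 1]` an affine closed loop is linear, so second moments follow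
a linear recursion in which the noise enters only through its mean, its covariance and its being
uncorrelated in time. For a stabilizing policy the average cost is `tr (stage θ * moment θ)`, where
`moment θ` is the stationary second moment. Solving the Poisson equation for a relative value matrix
yields the identity that carries the proof, `cost_eq_add`: with `H = θ' - θ`, J(θ') = J(θ) + 2 tr(Hᵀ
E Φ') + tr(G H Φ' Hᵀ), where `E = adv θ` and `G = hess θ` belong to `θ`, and `Φ'` is the moment of
`θ'`. Both `G` and `Φ'` are positive definite, and the identity is exact for any two stabilizing
policies.

Its consequences are: the gradient is `2 E Φ`; Lipschitz dependence of `Φ` on the policy gives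
smoothness; completing the square in `H` gives gradient domination; and `E = 0` forces a strict
global minimum. The constants are uniform because sublevel sets of the cost are compact
(`isCompact_costSublevel`). Compactness also gives a minimizer. There `E = 0`, which turns the
Lyapunov equation of the value matrix into the Riccati equation; conversely every Riccati solution
yields a stabilizing policy with `E = 0`, and strictness makes it unique. Policies that do not
stabilize are compared with the optimum by summing the one-step form of the identity along their
actual moments (`lt_average_of_adv_eq_zero`).

The data-driven problem is a change of variables. The normal equations of least squares say `X̄₁ = Â
X̄₀ + B̂ Ū₀`, so under `X̄₀ ξ = [I 0]` the data-driven loop is the model loop with `θ = Ū₀ ξ`;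
invertibility of `Λ` makes `ξ ↔ θ` a bijection. The projected gradient step becomes `θ - η M ∇J(θ)`
with `M ≻ 0`. A continuation argument in the step length keeps it in the sublevel set
(`cost_descent`); smoothness, `M ⪰ σ_min(M) I` and gradient domination then give the rate. -/

noncomputable section

namespace DeePO

open scoped Topology

/-! ### Positive semidefinite real matrices -/

section PosSemidef

variable {p q : Type*} [Fintype p] [Fintype q]

theorem PosSemidef.mul_mul_transpose {A : Matrix q q ℝ} (hA : A.PosSemidef) (B : Matrix p q ℝ) :
    (B * A * Bᵀ).PosSemidef := by
  simpa using hA.mul_mul_conjTranspose_same B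

theorem PosSemidef.transpose_mul_mul {A : Matrix q q ℝ} (hA : A.PosSemidef) (B : Matrix q p ℝ) :
    (Bᵀ * A * B).PosSemidef := by
  simpa using hA.conjTranspose_mul_mul_same B

theorem PosSemidef.transpose_eq {A : Matrix q q ℝ} (hA : A.PosSemidef) : Aᵀ = A := by
  simpa using hA.1.eq

theorem PosSemidef.quad_nonneg {A : Matrix q q ℝ} (hA : A.PosSemidef) (x : q → ℝ) :
    0 ≤ x ⬝ᵥ (A *ᵥ x) := by
  simpa using hA.dotProduct_mulVec_nonneg x

theorem PosDef.quad_pos {A : Matrix q q ℝ} (hA : A.PosDef) {x : q → ℝ} (hx : x ≠ 0) :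
    0 < x ⬝ᵥ (A *ᵥ x) := by
  simpa using hA.dotProduct_mulVec_pos hx

theorem posSemidef_of_quad {A : Matrix q q ℝ} (h : Aᵀ = A) (hx : ∀ x, 0 ≤ x ⬝ᵥ (A *ᵥ x)) :
    A.PosSemidef :=
  Matrix.PosSemidef.of_dotProduct_mulVec_nonneg (by simpa [IsHermitian] using h)
    (by simpa using hx)

theorem posDef_of_quad {A : Matrix q q ℝ} (h : Aᵀ = A) (hx : ∀ x ≠ 0, 0 < x ⬝ᵥ (A *ᵥ x)) :
    A.PosDef :=
  Matrix.PosDef.of_dotProduct_mulVec_pos (by simpa [IsHermitian] using h)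
    (by intro x hx0; simpa using hx x hx0)

open scoped MatrixOrder in
theorem PosSemidef.exists_transpose_mul_self [DecidableEq q] {A : Matrix q q ℝ}
    (hA : A.PosSemidef) : ∃ Y : Matrix q q ℝ, A = Yᵀ * Y := by
  obtain ⟨Y, rfl⟩ := CStarAlgebra.nonneg_iff_eq_star_mul_self.mp hA.nonneg
  exact ⟨Y, by simp [star_eq_conjTranspose]⟩

theorem PosSemidef.trace_mul_nonneg {A B : Matrix q q ℝ} (hA : A.PosSemidef)
    (hB : B.PosSemidef) : 0 ≤ (A * B).trace := by
  classical
  obtain ⟨Y, rfl⟩ := PosSemidef.exists_transpose_mul_self hA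
  rw [Matrix.mul_assoc, Matrix.trace_mul_comm]
  exact (PosSemidef.mul_mul_transpose hB Y).trace_nonneg

open scoped MatrixOrder in
theorem PosDef.exists_sub_smul_one_posSemidef [DecidableEq q] {A : Matrix q q ℝ}
    (hA : A.PosDef) : ∃ c : ℝ, 0 < c ∧ (A - c • 1).PosSemidef := by
  rcases isEmpty_or_nonempty q with hq | hq
  · exact ⟨1, one_pos, by rw [Subsingleton.elim (A - (1 : ℝ) • 1) 0]; exact .zero⟩
  have : Nontrivial (Matrix q q ℝ) := Function.nontrivial
  obtain ⟨c, hc, h⟩ := (CFC.exists_pos_algebraMap_le_iff (A := Matrix q q ℝ) (a := A)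
    hA.1).2 (fun x hx => (isStrictlyPositive_iff_posDef.2 hA).spectrum_pos hx)
  refine ⟨c, hc, ?_⟩
  rwa [Matrix.le_iff, Algebra.algebraMap_eq_smul_one] at h

theorem PosDef.exists_mul_trace_le {A : Matrix q q ℝ} (hA : A.PosDef) :
    ∃ c : ℝ, 0 < c ∧ ∀ B : Matrix q q ℝ, B.PosSemidef → c * B.trace ≤ (A * B).trace := by
  classical
  obtain ⟨c, hc, h⟩ := PosDef.exists_sub_smul_one_posSemidef hA
  refine ⟨c, hc, fun B hB => ?_⟩
  have := PosSemidef.trace_mul_nonneg h hB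
  rw [Matrix.sub_mul, Matrix.trace_sub, Matrix.smul_mul, Matrix.one_mul, Matrix.trace_smul,
    smul_eq_mul] at this
  linarith

theorem PosSemidef.mul_norm_sq_le_trace {A : Matrix q q ℝ} {c : ℝ} [DecidableEq q]
    (h : (A - c • 1).PosSemidef) (B : Matrix p q ℝ) :
    c * (B * Bᵀ).trace ≤ (B * A * Bᵀ).trace := by
  have := (PosSemidef.mul_mul_transpose h B).trace_nonneg
  simp only [Matrix.mul_sub, Matrix.sub_mul, Matrix.mul_smul, Matrix.smul_mul, Matrix.mul_one,
    Matrix.trace_sub, Matrix.trace_smul, smul_eq_mul] at this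
  linarith

theorem quad_mul_mul_transpose (F X : Matrix q q ℝ) (x : q → ℝ) :
    x ⬝ᵥ ((F * X * Fᵀ) *ᵥ x) = (x ᵥ* F) ⬝ᵥ (X *ᵥ (x ᵥ* F)) := by
  rw [← Matrix.mulVec_mulVec, Matrix.mulVec_transpose, ← Matrix.mulVec_mulVec,
    Matrix.dotProduct_mulVec]

theorem isClosed_posSemidef : IsClosed {A : Matrix q q ℝ | A.PosSemidef} := by
  have : {A : Matrix q q ℝ | A.PosSemidef} =
      {A | Aᵀ = A} ∩ ⋂ x : q → ℝ, {A | 0 ≤ x ⬝ᵥ (A *ᵥ x)} := by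
    ext A
    simp only [Set.mem_ofPred_eq, Set.mem_inter_iff, Set.mem_iInter]
    exact ⟨fun h => ⟨PosSemidef.transpose_eq h, PosSemidef.quad_nonneg h⟩,
      fun h => posSemidef_of_quad h.1 h.2⟩
  rw [this]
  refine (isClosed_eq (by fun_prop) (by fun_prop)).inter (isClosed_iInter fun x => ?_)
  exact isClosed_le continuous_const (by fun_prop)

end PosSemidef

/-! ### Spectral radius and Lyapunov equations -/

section Lyapunov

variable {q : Type*} [Fintype q] [DecidableEq q]

/-- Gelfand's formula bounds `‖F ^ t‖` by `r ^ t` eventually, for some `r < 1`. It is applied over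
`ℂ`, and real parts are taken at the end. -/
theorem tendsto_pow_of_specRad_lt_one {F : Matrix q q ℝ} (hF : specRad F < 1) :
    Tendsto (fun t : ℕ => F ^ t) atTop (𝓝 0) := by
  let _ : NormedRing (Matrix q q ℂ) := Matrix.frobeniusNormedRing
  let _ : NormedAlgebra ℂ (Matrix q q ℂ) := Matrix.frobeniusNormedAlgebra
  have : CompleteSpace (Matrix q q ℂ) := FiniteDimensional.complete ℂ _
  set G : Matrix q q ℂ := F.map (algebraMap ℝ ℂ) with hG
  obtain ⟨r, hr1, hr2⟩ := ENNReal.lt_iff_exists_nnreal_btwn.1 hF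
  have h := spectrum.pow_nnnorm_pow_one_div_tendsto_nhds_spectralRadius G
  have hev : ∀ᶠ t : ℕ in atTop, ‖G ^ t‖₊ ≤ r ^ t := by
    filter_upwards [h.eventually (gt_mem_nhds hr1), eventually_gt_atTop 0] with t ht ht0
    have h2 : ((‖G ^ t‖₊ : ℝ≥0∞) ^ (1 / t : ℝ)) ^ (t : ℝ) ≤ (r : ℝ≥0∞) ^ (t : ℝ) :=
      ENNReal.rpow_le_rpow ht.le (by positivity)
    rw [← ENNReal.rpow_mul, one_div, inv_mul_cancel₀ (by positivity), ENNReal.rpow_one,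
      ENNReal.rpow_natCast] at h2
    exact_mod_cast h2
  have hr3 : r < 1 := by exact_mod_cast hr2
  have hG0 : Tendsto (fun t : ℕ => G ^ t) atTop (𝓝 0) := by
    refine squeeze_zero_norm' (a := fun t => (r : ℝ) ^ t) ?_
      (tendsto_pow_atTop_nhds_zero_of_lt_one r.2 (by exact_mod_cast hr3))
    filter_upwards [hev] with t ht
    exact_mod_cast ht
  have hmap : ∀ t : ℕ, F ^ t = (G ^ t).map Complex.re := fun t => by
    have : G ^ t = (F ^ t).map (algebraMap ℝ ℂ) := by
      rw [hG]; exact (map_pow (algebraMap ℝ ℂ).mapMatrix F t).symm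
    rw [this]
    ext i j
    simp
  have hc : Continuous fun A : Matrix q q ℂ => A.map Complex.re :=
    continuous_id.matrix_map Complex.continuous_re
  have := (hc.tendsto 0).comp hG0
  simp only [Function.comp_def] at this
  simp_rw [hmap]
  convert this using 2
  ext i j
  simp

/-- A left eigenvector `a + i b` with eigenvalue `α + i β`, split into real and imaginary parts, so
that stability can be tested with real quadratic forms. -/
theorem specRad_lt_one_of_forall {F : Matrix q q ℝ}
    (h : ∀ (α β : ℝ) (a b : q → ℝ), (a ≠ 0 ∨ b ≠ 0) → a ᵥ* F = α • a - β • b →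
      b ᵥ* F = β • a + α • b → α ^ 2 + β ^ 2 < 1) : specRad F < 1 := by
  let _ : NormedRing (Matrix q q ℂ) := Matrix.frobeniusNormedRing
  let _ : NormedAlgebra ℂ (Matrix q q ℂ) := Matrix.frobeniusNormedAlgebra
  have : CompleteSpace (Matrix q q ℂ) := FiniteDimensional.complete ℂ _
  rcases isEmpty_or_nonempty q with hq | hq
  · rw [specRad, spectrum.SpectralRadius.of_subsingleton]
    exact zero_lt_one
  have : Nontrivial (Matrix q q ℂ) := Function.nontrivial
  have : spectralRadius ℂ (F.map (algebraMap ℝ ℂ)) < ((1 : NNReal) : ℝ≥0∞) := by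
    refine spectrum.spectralRadius_lt_of_forall_lt (F.map (algebraMap ℝ ℂ)) fun z hz => ?_
    have hdet : (algebraMap ℂ (Matrix q q ℂ) z - F.map (algebraMap ℝ ℂ)).det = 0 := by
      by_contra hne
      exact hz ((Matrix.isUnit_iff_isUnit_det _).2 (isUnit_iff_ne_zero.2 hne))
    obtain ⟨v, hv0, hv⟩ := Matrix.exists_vecMul_eq_zero_iff.2 hdet
    have hv' : v ᵥ* F.map (algebraMap ℝ ℂ) = z • v := by
      rw [Matrix.vecMul_sub, sub_eq_zero, Algebra.algebraMap_eq_smul_one, Matrix.vecMul_smul,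
        Matrix.vecMul_one] at hv
      exact hv.symm
    have hre : ∀ j, ∑ i, v i * (F i j : ℂ) = z * v j := fun j => by
      have := congrFun hv' j
      simpa [Matrix.vecMul, dotProduct] using this
    have hlt := h z.re z.im (fun i => (v i).re) (fun i => (v i).im) ?_ ?_ ?_
    · have : ‖z‖ < 1 := by
        have h2 : ‖z‖ ^ 2 < 1 := by
          rw [Complex.sq_norm, Complex.normSq_apply]; linarith [hlt]
        nlinarith [norm_nonneg z]
      exact_mod_cast this
    · by_contra hcon
      push Not at hcon
      exact hv0 (funext fun i => Complex.ext (congrFun hcon.1 i) (congrFun hcon.2 i))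
    · ext j
      have := congrArg Complex.re (hre j)
      simpa [Matrix.vecMul, dotProduct] using this
    · ext j
      have := congrArg Complex.im (hre j)
      simp [Matrix.vecMul, dotProduct] at this ⊢
      linarith
  simpa [specRad] using this

/-- Lyapunov's criterion: summing the form over the real and imaginary parts of an eigenvector
cancels the cross terms and leaves the factor `|z|²`, which strict decrease forces below one. -/
theorem specRad_lt_one_of_quad_lt {F X : Matrix q q ℝ} (hX : X.PosSemidef)
    (h : ∀ x ≠ 0, (x ᵥ* F) ⬝ᵥ (X *ᵥ (x ᵥ* F)) < x ⬝ᵥ (X *ᵥ x)) : specRad F < 1 := by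
  refine specRad_lt_one_of_forall fun α β a b hab ha hb => ?_
  have hle : ∀ x, (x ᵥ* F) ⬝ᵥ (X *ᵥ (x ᵥ* F)) ≤ x ⬝ᵥ (X *ᵥ x) := fun x => by
    by_cases hx : x = 0
    · simp [hx]
    · exact (h x hx).le
  have hlt : (a ᵥ* F) ⬝ᵥ (X *ᵥ (a ᵥ* F)) + (b ᵥ* F) ⬝ᵥ (X *ᵥ (b ᵥ* F)) <
      a ⬝ᵥ (X *ᵥ a) + b ⬝ᵥ (X *ᵥ b) := by
    rcases hab with h0 | h0
    · linarith [h a h0, hle b]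
    · linarith [h b h0, hle a]
  have hid : (a ᵥ* F) ⬝ᵥ (X *ᵥ (a ᵥ* F)) + (b ᵥ* F) ⬝ᵥ (X *ᵥ (b ᵥ* F)) =
      (α ^ 2 + β ^ 2) * (a ⬝ᵥ (X *ᵥ a) + b ⬝ᵥ (X *ᵥ b)) := by
    rw [ha, hb]
    simp only [Matrix.mulVec_sub, Matrix.mulVec_add, Matrix.mulVec_smul, sub_dotProduct,
      add_dotProduct, dotProduct_sub, dotProduct_add, smul_dotProduct, dotProduct_smul,
      smul_eq_mul]
    ring
  have ha0 := PosSemidef.quad_nonneg hX a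
  have hb0 := PosSemidef.quad_nonneg hX b
  nlinarith

theorem specRad_lt_one_of_posDef {F X : Matrix q q ℝ} (hX : X.PosSemidef)
    (h : (X - F * X * Fᵀ).PosDef) : specRad F < 1 := by
  refine specRad_lt_one_of_quad_lt hX fun x hx => ?_
  have := PosDef.quad_pos h hx
  rw [Matrix.sub_mulVec, dotProduct_sub, quad_mul_mul_transpose] at this
  linarith

theorem specRad_transpose (F : Matrix q q ℝ) : specRad Fᵀ = specRad F := by
  have : spectrum ℂ (Fᵀ.map (algebraMap ℝ ℂ)) = spectrum ℂ (F.map (algebraMap ℝ ℂ)) := by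
    ext z
    rw [show Fᵀ.map (algebraMap ℝ ℂ) = (F.map (algebraMap ℝ ℂ))ᵀ from rfl,
      Matrix.mem_spectrum_iff_isRoot_charpoly, Matrix.mem_spectrum_iff_isRoot_charpoly, Matrix.charpoly_transpose]
  simp only [specRad, spectralRadius, this]

/-- A nonzero fixed vector of `F` would be fixed by all powers of `F`, which tend to zero. -/
theorem isUnit_det_one_sub {F : Matrix q q ℝ} (hF : specRad F < 1) : IsUnit (1 - F).det := by
  rw [isUnit_iff_ne_zero]
  intro hdet
  obtain ⟨v, hv0, hv⟩ := Matrix.exists_mulVec_eq_zero_iff.2 hdet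
  rw [Matrix.sub_mulVec, Matrix.one_mulVec, sub_eq_zero] at hv
  have hpow : ∀ t : ℕ, F ^ t *ᵥ v = v := fun t => by
    induction t with
    | zero => simp
    | succ t ih => rw [pow_succ, ← Matrix.mulVec_mulVec, ← hv, ih]
  have h1 : Tendsto (fun t : ℕ => F ^ t *ᵥ v) atTop (𝓝 (0 *ᵥ v)) :=
    ((by fun_prop : Continuous fun A : Matrix q q ℝ => A *ᵥ v).tendsto 0).comp
      (tendsto_pow_of_specRad_lt_one hF)
  simp only [hpow, Matrix.zero_mulVec] at h1
  exact hv0 (tendsto_nhds_unique tendsto_const_nhds h1)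

theorem tendsto_pow_mul_mul_pow_transpose {F : Matrix q q ℝ} (hF : specRad F < 1)
    (X : Matrix q q ℝ) : Tendsto (fun t : ℕ => F ^ t * X * (F ^ t)ᵀ) atTop (𝓝 0) := by
  have hc : Continuous fun A : Matrix q q ℝ => A * X * Aᵀ := by fun_prop
  have := (hc.tendsto 0).comp (tendsto_pow_of_specRad_lt_one hF)
  rwa [Matrix.zero_mul, Matrix.zero_mul] at this

/-- `X - F ^ t X (F ^ t)ᵀ` telescopes into a sum of conjugates of `X - F X Fᵀ`, and its limit is
`X`. -/
theorem posSemidef_of_sub_posSemidef {F X : Matrix q q ℝ} (hF : specRad F < 1)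
    (h : (X - F * X * Fᵀ).PosSemidef) : X.PosSemidef := by
  have hstep : ∀ t : ℕ, (X - F ^ t * X * (F ^ t)ᵀ).PosSemidef := fun t => by
    induction t with
    | zero => simpa using Matrix.PosSemidef.zero
    | succ t ih =>
      have := ih.add (PosSemidef.mul_mul_transpose h (F ^ t))
      convert this using 1
      rw [pow_succ, Matrix.transpose_mul]
      noncomm_ring
  have hlim : Tendsto (fun t : ℕ => X - F ^ t * X * (F ^ t)ᵀ) atTop (𝓝 (X - 0)) :=
    tendsto_const_nhds.sub (tendsto_pow_mul_mul_pow_transpose hF X)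
  rw [sub_zero] at hlim
  exact isClosed_posSemidef.mem_of_tendsto hlim (Eventually.of_forall hstep)

open scoped Kronecker

/-- The solution `X` of `X = F X Fᵀ + Y`. -/
def lyap (F Y : Matrix q q ℝ) : Matrix q q ℝ :=
  Matrix.of fun i j => ((1 - F ⊗ₖ F)⁻¹ *ᵥ vec Y) (j, i)

theorem vec_lyap (F Y : Matrix q q ℝ) : vec (lyap F Y) = (1 - F ⊗ₖ F)⁻¹ *ᵥ vec Y := rfl

/-- A kernel vector is `vec X` with `X = F X Fᵀ`; then `X = F ^ t X (F ^ t)ᵀ → 0`. -/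
theorem isUnit_det_one_sub_kronecker {F : Matrix q q ℝ} (hF : specRad F < 1) :
    IsUnit (1 - F ⊗ₖ F).det := by
  rw [isUnit_iff_ne_zero]
  intro hdet
  obtain ⟨v, hv0, hv⟩ := Matrix.exists_mulVec_eq_zero_iff.2 hdet
  obtain ⟨X, rfl⟩ := vec_bijective.2 v
  rw [Matrix.sub_mulVec, Matrix.one_mulVec, sub_eq_zero, kronecker_mulVec_vec, vec_inj] at hv
  have hpow : ∀ t : ℕ, F ^ t * X * (F ^ t)ᵀ = X := fun t => by
    induction t with
    | zero => simp
    | succ t ih =>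
      have : F ^ (t + 1) * X * (F ^ (t + 1))ᵀ = F ^ t * (F * X * Fᵀ) * (F ^ t)ᵀ := by
        rw [pow_succ, Matrix.transpose_mul]
        noncomm_ring
      rw [this, ← hv, ih]
  have h1 := tendsto_pow_mul_mul_pow_transpose hF X
  simp only [hpow] at h1
  exact hv0 (by rw [tendsto_nhds_unique tendsto_const_nhds h1, vec_zero])

/-- The uniqueness half is the working tool below: a matrix is identified with `lyap F Y` by
checking the fixed-point equation. -/
theorem eq_lyap_iff {F : Matrix q q ℝ} (hF : specRad F < 1) {X Y : Matrix q q ℝ} :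
    X = lyap F Y ↔ X = F * X * Fᵀ + Y := by
  have hu := isUnit_det_one_sub_kronecker hF
  rw [← vec_inj, vec_lyap]
  have h1 : vec X = (1 - F ⊗ₖ F)⁻¹ *ᵥ vec Y ↔ (1 - F ⊗ₖ F) *ᵥ vec X = vec Y := by
    constructor
    · intro h
      rw [h, Matrix.mulVec_mulVec, Matrix.mul_nonsing_inv _ hu, Matrix.one_mulVec]
    · intro h
      rw [← h, Matrix.mulVec_mulVec, Matrix.nonsing_inv_mul _ hu, Matrix.one_mulVec]
  rw [h1, Matrix.sub_mulVec, Matrix.one_mulVec, kronecker_mulVec_vec, ← vec_sub, vec_inj,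
    sub_eq_iff_eq_add']

theorem lyap_eq {F : Matrix q q ℝ} (hF : specRad F < 1) (Y : Matrix q q ℝ) :
    lyap F Y = F * lyap F Y * Fᵀ + Y := (eq_lyap_iff hF).1 rfl

theorem lyap_posSemidef {F Y : Matrix q q ℝ} (hF : specRad F < 1) (hY : Y.PosSemidef) :
    (lyap F Y).PosSemidef := by
  refine posSemidef_of_sub_posSemidef hF ?_
  rwa [sub_eq_iff_eq_add'.2 (lyap_eq hF Y)]

theorem continuousAt_lyap {F : Matrix q q ℝ} (hF : specRad F < 1) (Y : Matrix q q ℝ) :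
    ContinuousAt (fun z : Matrix q q ℝ × Matrix q q ℝ => lyap z.1 z.2) (F, Y) := by
  have hinv : ContinuousAt (fun G : Matrix (q × q) (q × q) ℝ => G⁻¹) (1 - F ⊗ₖ F) := by
    have hd := (isUnit_det_one_sub_kronecker hF).ne_zero
    have : (fun G : Matrix (q × q) (q × q) ℝ => G⁻¹) = fun G => G.det⁻¹ • G.adjugate := by
      funext G; rw [Matrix.inv_def, Ring.inverse_eq_inv']
    rw [this]
    exact ((continuous_id.matrix_det).continuousAt.inv₀ hd).smul
      (continuous_id.matrix_adjugate).continuousAt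
  have hk : Continuous fun z : Matrix q q ℝ × Matrix q q ℝ => 1 - z.1 ⊗ₖ z.1 := by
    refine continuous_const.sub (continuous_matrix fun i j => ?_)
    simp only [Matrix.kroneckerMap_apply]
    fun_prop
  have h1 : ContinuousAt (fun z : Matrix q q ℝ × Matrix q q ℝ => (1 - z.1 ⊗ₖ z.1)⁻¹) (F, Y) :=
    ContinuousAt.comp (f := fun z : Matrix q q ℝ × Matrix q q ℝ => 1 - z.1 ⊗ₖ z.1) hinv
      hk.continuousAt
  have hv : Continuous fun z : Matrix q q ℝ × Matrix q q ℝ => vec z.2 := by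
    refine continuous_pi fun i => ?_
    simp only [vec]
    fun_prop
  have h2 : ContinuousAt (fun z : Matrix q q ℝ × Matrix q q ℝ =>
      (1 - z.1 ⊗ₖ z.1)⁻¹ *ᵥ vec z.2) (F, Y) :=
    ((by fun_prop : Continuous fun w : Matrix (q × q) (q × q) ℝ × (q × q → ℝ) =>
      w.1 *ᵥ w.2).continuousAt).comp₂ h1 hv.continuousAt
  refine continuousAt_pi.2 fun i => continuousAt_pi.2 fun j => ?_
  exact (continuous_apply (j, i)).continuousAt.comp h2

/-- The Lyapunov certificate `X = lyap F 1` of `F` still certifies nearby `G`: the defect `X - G X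
Gᵀ` stays within Frobenius distance less than one of the identity. -/
theorem isOpen_specRad_lt_one : IsOpen {F : Matrix q q ℝ | specRad F < 1} := by
  rw [isOpen_iff_mem_nhds]
  intro F hF
  set X := lyap F 1 with hX
  have hpsd : X.PosSemidef := lyap_posSemidef hF Matrix.PosSemidef.one
  have hlim : Tendsto (fun G : Matrix q q ℝ => ‖(X - G * X * Gᵀ) - 1‖) (𝓝 F) (𝓝 0) := by
    have hc : Continuous fun G : Matrix q q ℝ => ‖(X - G * X * Gᵀ) - 1‖ := by fun_prop
    have := hc.tendsto F
    rwa [sub_eq_iff_eq_add'.2 (lyap_eq hF 1), sub_self, norm_zero] at this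
  filter_upwards [hlim.eventually (gt_mem_nhds one_pos)] with G hG
  refine specRad_lt_one_of_quad_lt hpsd fun x hx => ?_
  set E := (X - G * X * Gᵀ) - 1 with hE
  have hq : x ⬝ᵥ (X *ᵥ x) - (x ᵥ* G) ⬝ᵥ (X *ᵥ (x ᵥ* G)) = x ⬝ᵥ x + x ⬝ᵥ (E *ᵥ x) := by
    rw [hE, Matrix.sub_mulVec, Matrix.sub_mulVec, dotProduct_sub, dotProduct_sub,
      quad_mul_mul_transpose, Matrix.one_mulVec]
    ring
  have hxx : 0 < x ⬝ᵥ x := by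
    simpa using dotProduct_star_self_pos_iff.2 hx
  -- Viewing `x` as a one-row matrix turns this into submultiplicativity of the Frobenius norm.
  have hb : |x ⬝ᵥ (E *ᵥ x)| ≤ ‖E‖ * (x ⬝ᵥ x) := by
    have h1 : x ⬝ᵥ (E *ᵥ x) =
        (replicateRow Unit x * E * (replicateRow Unit x)ᵀ) () () := by
      simp [Matrix.mul_apply, dotProduct, Matrix.mulVec, Finset.mul_sum, Finset.sum_mul]
      rw [Finset.sum_comm]
      exact Finset.sum_congr rfl fun i _ => Finset.sum_congr rfl fun j _ => by ring
    have h2 : |(replicateRow Unit x * E * (replicateRow Unit x)ᵀ) () ()| ≤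
        ‖replicateRow Unit x * E * (replicateRow Unit x)ᵀ‖ := by
      generalize replicateRow Unit x * E * (replicateRow Unit x)ᵀ = Z
      rw [frobenius_norm_def, ← Real.sqrt_eq_rpow]
      simp [Real.sqrt_sq_eq_abs]
    have h3 : ‖replicateRow Unit x‖ ^ 2 = x ⬝ᵥ x := by
      rw [frobenius_norm_replicateRow, EuclideanSpace.norm_sq_eq]
      simp [dotProduct, sq]
    calc _ ≤ ‖replicateRow Unit x * E * (replicateRow Unit x)ᵀ‖ := h1 ▸ h2
      _ ≤ ‖replicateRow Unit x‖ * ‖E‖ * ‖replicateRow Unit x‖ := by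
        refine (frobenius_norm_mul _ _).trans ?_
        rw [frobenius_norm_transpose]
        gcongr
        exact frobenius_norm_mul _ _
      _ = _ := by rw [← h3]; ring
  have := (abs_le.1 hb).1
  nlinarith

end Lyapunov

/-! ### Stationary second moments and value matrices of affine recursions -/

section Affine

variable {p q : Type*} [Fintype p] [Fintype q] [DecidableEq p] [DecidableEq q]

/-- The affine map `x ↦ F x + b` in homogeneous coordinates. -/
def augLoop (F : Matrix q q ℝ) (b : Matrix q Unit ℝ) : Matrix (q ⊕ Unit) (q ⊕ Unit) ℝ :=
  fromBlocks F b 0 1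

/-- The noise covariance in homogeneous coordinates. -/
def augNoise (W : Matrix q q ℝ) : Matrix (q ⊕ Unit) (q ⊕ Unit) ℝ := fromBlocks W 0 0 0

/-- The fixed point of `x ↦ F x + b`. -/
def statMean (F : Matrix q q ℝ) (b : Matrix q Unit ℝ) : Matrix q Unit ℝ := (1 - F)⁻¹ * b

/-- The stationary second moment of `[x; 1]` for `x⁺ = F x + b + w`, `w` of covariance `W`. -/
def statMoment (F : Matrix q q ℝ) (b : Matrix q Unit ℝ) (W : Matrix q q ℝ) :
    Matrix (q ⊕ Unit) (q ⊕ Unit) ℝ :=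
  fromBlocks (lyap F W + statMean F b * (statMean F b)ᵀ) (statMean F b) (statMean F b)ᵀ 1

theorem statMean_eq {F : Matrix q q ℝ} (hF : specRad F < 1) (b : Matrix q Unit ℝ) :
    statMean F b = F * statMean F b + b := by
  have : (1 - F) * statMean F b = b := by
    rw [statMean, ← Matrix.mul_assoc, Matrix.mul_nonsing_inv _ (isUnit_det_one_sub hF),
      Matrix.one_mul]
  rw [Matrix.sub_mul, Matrix.one_mul] at this
  exact sub_eq_iff_eq_add'.1 this

theorem eq_statMean_iff {F : Matrix q q ℝ} (hF : specRad F < 1) {b x : Matrix q Unit ℝ} :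
    x = statMean F b ↔ x = F * x + b := by
  refine ⟨fun h => h ▸ statMean_eq hF b, fun h => ?_⟩
  have : (1 - F) * x = b := by
    rw [Matrix.sub_mul, Matrix.one_mul]
    exact sub_eq_iff_eq_add'.2 h
  rw [statMean, ← this, ← Matrix.mul_assoc, Matrix.nonsing_inv_mul _ (isUnit_det_one_sub hF),
    Matrix.one_mul]

theorem lyap_transpose {F W : Matrix q q ℝ} (hF : specRad F < 1) (hW : Wᵀ = W) :
    (lyap F W)ᵀ = lyap F W := by
  refine (eq_lyap_iff hF).2 ?_
  conv_lhs => rw [lyap_eq hF W]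
  simp [Matrix.transpose_mul, hW, Matrix.mul_assoc]

theorem statMoment_transpose {F W : Matrix q q ℝ} (hF : specRad F < 1) (hW : Wᵀ = W)
    (b : Matrix q Unit ℝ) : (statMoment F b W)ᵀ = statMoment F b W := by
  simp [statMoment, fromBlocks_transpose, lyap_transpose hF hW]

theorem statMoment_eq {F : Matrix q q ℝ} (hF : specRad F < 1) (b : Matrix q Unit ℝ)
    (W : Matrix q q ℝ) :
    statMoment F b W = augLoop F b * statMoment F b W * (augLoop F b)ᵀ + augNoise W := by
  have hx := statMean_eq hF b
  have hX := lyap_eq hF W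
  rw [statMoment]
  set x := statMean F b
  set X := lyap F W
  have hxt : xᵀ = xᵀ * Fᵀ + bᵀ := by
    conv_lhs => rw [hx]
    simp
  rw [augLoop, augNoise, fromBlocks_transpose, fromBlocks_multiply,
    fromBlocks_multiply, fromBlocks_add]
  congr 1
  · conv_lhs => rw [hX, hx, Matrix.transpose_add, Matrix.transpose_mul]
    simp only [Matrix.transpose_zero, Matrix.mul_add, Matrix.add_mul, Matrix.mul_assoc,
      Matrix.one_mul, Matrix.mul_one]
    abel
  · simpa using hx
  · simpa using hxt
  · simp

/-- The eigenvalue `1` of the homogeneous coordinate keeps the powers from vanishing; their limit is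
read off from this form. -/
theorem augLoop_pow {F : Matrix q q ℝ} (hF : specRad F < 1) (b : Matrix q Unit ℝ) (t : ℕ) :
    augLoop F b ^ t = fromBlocks (F ^ t) (statMean F b - F ^ t * statMean F b) 0 1 := by
  induction t with
  | zero => simp [fromBlocks_one]
  | succ t ih =>
    rw [pow_succ', ih, augLoop, fromBlocks_multiply]
    congr 1
    · simp [pow_succ']
    · rw [Matrix.mul_sub, ← Matrix.mul_assoc, ← pow_succ', Matrix.mul_one]
      have hx := statMean_eq hF b
      generalize statMean F b = x at hx
      conv_rhs => enter [1]; rw [hx]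
      abel
    · simp
    · simp

/-- Every second moment of `[x; 1]` has corner `1`, so a Bellman residual supported in the corner
contributes a constant. -/
theorem trace_mul_of_corner {D Ψ : Matrix (q ⊕ Unit) (q ⊕ Unit) ℝ} {j : Matrix Unit Unit ℝ}
    (hD : D = fromBlocks 0 0 0 j) (hΨ : Ψ (Sum.inr ()) (Sum.inr ()) = 1) :
    (D * Ψ).trace = j () () := by
  subst hD
  simp [Matrix.trace, Matrix.mul_apply, hΨ]

/-- The iterated second moments of `[x; 1]` for `x⁺ = F x + b + w`. -/
def momentSeq (F : Matrix q q ℝ) (b : Matrix q Unit ℝ) (W : Matrix q q ℝ)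
    (Φ : Matrix (q ⊕ Unit) (q ⊕ Unit) ℝ) : ℕ → Matrix (q ⊕ Unit) (q ⊕ Unit) ℝ
  | 0 => Φ
  | t + 1 => augLoop F b * momentSeq F b W Φ t * (augLoop F b)ᵀ + augNoise W

theorem augLoop_mul_mul_corner (F : Matrix q q ℝ) (b : Matrix q Unit ℝ)
    (Ψ : Matrix (q ⊕ Unit) (q ⊕ Unit) ℝ) :
    (augLoop F b * Ψ * (augLoop F b)ᵀ) (Sum.inr ()) (Sum.inr ()) =
      Ψ (Sum.inr ()) (Sum.inr ()) := by
  simp [augLoop, Matrix.mul_apply]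

theorem momentSeq_corner {F : Matrix q q ℝ} {b : Matrix q Unit ℝ} {W : Matrix q q ℝ}
    {Φ : Matrix (q ⊕ Unit) (q ⊕ Unit) ℝ} (hΦ : Φ (Sum.inr ()) (Sum.inr ()) = 1) (t : ℕ) :
    momentSeq F b W Φ t (Sum.inr ()) (Sum.inr ()) = 1 := by
  induction t with
  | zero => exact hΦ
  | succ t ih =>
    rw [momentSeq, Matrix.add_apply, augLoop_mul_mul_corner, ih]
    simp [augNoise]

theorem augNoise_posSemidef {W : Matrix q q ℝ} (hW : W.PosSemidef) : (augNoise W).PosSemidef := by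
  have := PosSemidef.mul_mul_transpose hW (fromRows 1 0 : Matrix (q ⊕ Unit) q ℝ)
  convert this using 1
  ext (i | i) (j | j) <;> simp [augNoise, Matrix.mul_apply, Matrix.one_apply]

theorem momentSeq_posSemidef {F : Matrix q q ℝ} {b : Matrix q Unit ℝ} {W : Matrix q q ℝ}
    {Φ : Matrix (q ⊕ Unit) (q ⊕ Unit) ℝ} (hW : W.PosSemidef) (hΦ : Φ.PosSemidef) (t : ℕ) :
    (momentSeq F b W Φ t).PosSemidef := by
  induction t with
  | zero => exact hΦ
  | succ t ih => exact (PosSemidef.mul_mul_transpose ih _).add (augNoise_posSemidef hW)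

/-- The deviation from stationarity evolves as `L ^ t (Φ - Ψ) (L ^ t)ᵀ`. The limit of `L ^ t` sees
only the corner of `Φ - Ψ`, and that corner is zero. -/
theorem tendsto_momentSeq {F : Matrix q q ℝ} (hF : specRad F < 1) (b : Matrix q Unit ℝ)
    (W : Matrix q q ℝ) {Φ : Matrix (q ⊕ Unit) (q ⊕ Unit) ℝ}
    (hΦ : Φ (Sum.inr ()) (Sum.inr ()) = 1) :
    Tendsto (momentSeq F b W Φ) atTop (𝓝 (statMoment F b W)) := by
  set L := augLoop F b
  set Ψ := statMoment F b W with hΨ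
  have hsub : ∀ t, momentSeq F b W Φ t = Ψ + L ^ t * (Φ - Ψ) * (L ^ t)ᵀ := fun t => by
    induction t with
    | zero => simp [momentSeq]
    | succ t ih =>
      rw [momentSeq, ih]
      have hs : Ψ = L * Ψ * Lᵀ + augNoise W := statMoment_eq hF b W
      conv_rhs => enter [1]; rw [hs]
      rw [pow_succ', Matrix.transpose_mul]
      change L * _ * Lᵀ + _ = _
      noncomm_ring
  have hlim : Tendsto (fun t => L ^ t) atTop (𝓝 (fromBlocks 0 (statMean F b) 0 1)) := by
    have hc : Continuous fun G : Matrix q q ℝ =>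
        (fromBlocks G (statMean F b - G * statMean F b) 0 1 :
          Matrix (q ⊕ Unit) (q ⊕ Unit) ℝ) := by
      refine Continuous.matrix_fromBlocks ?_ ?_ ?_ ?_ <;> fun_prop
    have := (hc.tendsto 0).comp (tendsto_pow_of_specRad_lt_one hF)
    simp only [Matrix.zero_mul, sub_zero] at this
    refine this.congr fun t => ?_
    exact (augLoop_pow hF b t).symm
  have hc : Continuous fun G : Matrix (q ⊕ Unit) (q ⊕ Unit) ℝ => Ψ + G * (Φ - Ψ) * Gᵀ := by
    fun_prop
  have h := (hc.tendsto _).comp hlim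
  have hzero : (fromBlocks 0 (statMean F b) 0 1 : Matrix (q ⊕ Unit) (q ⊕ Unit) ℝ) * (Φ - Ψ) *
      (fromBlocks 0 (statMean F b) 0 1 : Matrix (q ⊕ Unit) (q ⊕ Unit) ℝ)ᵀ = 0 := by
    have h0 : (Φ - Ψ) (Sum.inr ()) (Sum.inr ()) = 0 := by
      simp [hΦ, hΨ, statMoment]
    ext i j
    rcases i with i | i <;> rcases j with j | j <;>
      simp [Matrix.mul_apply, Matrix.sub_apply] at h0 ⊢ <;> simp [h0]
  rw [hzero, add_zero] at h
  exact h.congr fun t => (hsub t).symm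

/-- The relative value matrix of `x⁺ = F x + b + w` with stage cost `[x; 1]ᵀ C [x; 1]`. -/
def valueMatrix (F : Matrix q q ℝ) (b : Matrix q Unit ℝ) (C : Matrix (q ⊕ Unit) (q ⊕ Unit) ℝ) :
    Matrix (q ⊕ Unit) (q ⊕ Unit) ℝ :=
  fromBlocks (lyap Fᵀ C.toBlocks₁₁)
    ((1 - Fᵀ)⁻¹ * (C.toBlocks₁₂ + Fᵀ * lyap Fᵀ C.toBlocks₁₁ * b))
    ((1 - Fᵀ)⁻¹ * (C.toBlocks₁₂ + Fᵀ * lyap Fᵀ C.toBlocks₁₁ * b))ᵀ 0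

theorem toBlocks₁₁_transpose_eq {C : Matrix (q ⊕ Unit) (q ⊕ Unit) ℝ} (hC : Cᵀ = C) :
    C.toBlocks₁₁ᵀ = C.toBlocks₁₁ := by
  ext i j
  exact congrFun (congrFun hC (Sum.inl i)) (Sum.inl j)

theorem valueMatrix_transpose {F : Matrix q q ℝ} (hF : specRad F < 1) (b : Matrix q Unit ℝ)
    {C : Matrix (q ⊕ Unit) (q ⊕ Unit) ℝ} (hC : Cᵀ = C) :
    (valueMatrix F b C)ᵀ = valueMatrix F b C := by
  have h := lyap_transpose (F := Fᵀ) ((specRad_transpose F).symm ▸ hF)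
    (toBlocks₁₁_transpose_eq hC)
  simp only [valueMatrix, fromBlocks_transpose, h, Matrix.transpose_transpose,
    Matrix.transpose_zero]

/-- The Poisson equation of the average-cost problem. The state block is an adjoint Lyapunov
equation and the mixed block a linear equation with matrix `1 - Fᵀ`; the corner cannot be solved
for, since the loop preserves it, and the leftover `j` is the average cost minus the contribution of
the noise. -/
theorem exists_valueMatrix_bellman {F : Matrix q q ℝ} (hF : specRad F < 1) (b : Matrix q Unit ℝ)
    {C : Matrix (q ⊕ Unit) (q ⊕ Unit) ℝ} (hC : Cᵀ = C) :
    ∃ j : Matrix Unit Unit ℝ, C + (augLoop F b)ᵀ * valueMatrix F b C * augLoop F b -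
      valueMatrix F b C = fromBlocks 0 0 0 j := by
  have hF' : specRad Fᵀ < 1 := (specRad_transpose F).symm ▸ hF
  have hP := lyap_eq hF' C.toBlocks₁₁
  have hr := statMean_eq hF' (C.toBlocks₁₂ + Fᵀ * lyap Fᵀ C.toBlocks₁₁ * b)
  rw [statMean] at hr
  have hV : valueMatrix F b C = fromBlocks (lyap Fᵀ C.toBlocks₁₁)
    ((1 - Fᵀ)⁻¹ * (C.toBlocks₁₂ + Fᵀ * lyap Fᵀ C.toBlocks₁₁ * b))
    ((1 - Fᵀ)⁻¹ * (C.toBlocks₁₂ + Fᵀ * lyap Fᵀ C.toBlocks₁₁ * b))ᵀ 0 := rfl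
  have hPt := lyap_transpose hF' (toBlocks₁₁_transpose_eq hC)
  set P := lyap Fᵀ C.toBlocks₁₁
  set r := (1 - Fᵀ)⁻¹ * (C.toBlocks₁₂ + Fᵀ * P * b)
  have hCb : C = fromBlocks C.toBlocks₁₁ C.toBlocks₁₂ C.toBlocks₁₂ᵀ C.toBlocks₂₂ := by
    conv_lhs => rw [← fromBlocks_toBlocks C]
    congr 1
    ext i j
    exact congrFun (congrFun hC.symm (Sum.inr i)) (Sum.inl j)
  have hrt : rᵀ = rᵀ * F + (C.toBlocks₁₂ᵀ + bᵀ * P * F) := by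
    conv_lhs => rw [hr]
    simp [Matrix.transpose_mul, hPt, Matrix.mul_assoc]
  rw [Matrix.transpose_transpose] at hP
  refine ⟨C.toBlocks₂₂ + (bᵀ * (P * b + r) + rᵀ * b), ?_⟩
  rw [hV, augLoop, fromBlocks_transpose, fromBlocks_multiply, fromBlocks_multiply]
  conv_lhs => rw [hCb]
  rw [fromBlocks_add, sub_eq_iff_eq_add, fromBlocks_add]
  congr 1
  · conv_rhs => rw [hP]
    simp
    abel
  · conv_rhs => rw [hr]
    simp [Matrix.mul_add, Matrix.mul_assoc]
    abel
  · conv_rhs => rw [hrt]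
    simp [Matrix.add_mul, Matrix.mul_assoc]
    abel
  · simp [Matrix.mul_add, Matrix.add_mul, Matrix.mul_assoc]
    abel

/-- The solution `D`, with vanishing corner, of `D = L D Lᵀ + Y`, `L = [F b; 0 1]`. -/
def momentSolve (F : Matrix q q ℝ) (b : Matrix q Unit ℝ) (Y : Matrix (q ⊕ Unit) (q ⊕ Unit) ℝ) :
    Matrix (q ⊕ Unit) (q ⊕ Unit) ℝ :=
  fromBlocks (lyap F (F * statMean F Y.toBlocks₁₂ * bᵀ + b * (statMean F Y.toBlocks₁₂)ᵀ * Fᵀ +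
    Y.toBlocks₁₁)) (statMean F Y.toBlocks₁₂) (statMean F Y.toBlocks₁₂)ᵀ 0

/-- A vanishing corner makes the system triangular: the mixed block is found first, and then the
state block solves a Lyapunov equation with known forcing. It applies to differences of two moments,
whose corners cancel. -/
theorem eq_momentSolve {F : Matrix q q ℝ} (hF : specRad F < 1) {b : Matrix q Unit ℝ}
    {D Y : Matrix (q ⊕ Unit) (q ⊕ Unit) ℝ} (hD : Dᵀ = D)
    (h0 : D (Sum.inr ()) (Sum.inr ()) = 0) (h : D = augLoop F b * D * (augLoop F b)ᵀ + Y) :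
    D = momentSolve F b Y := by
  have hDb : D = fromBlocks D.toBlocks₁₁ D.toBlocks₁₂ D.toBlocks₁₂ᵀ 0 := by
    conv_lhs => rw [← fromBlocks_toBlocks D]
    congr 1
    · ext i j
      exact congrFun (congrFun hD.symm (Sum.inr i)) (Sum.inl j)
    · ext i j
      exact h0
  have hYb := fromBlocks_toBlocks Y
  rw [hDb, augLoop, fromBlocks_transpose, fromBlocks_multiply, fromBlocks_multiply, ← hYb,
    fromBlocks_add, fromBlocks_inj] at h
  obtain ⟨h11, h12, -, -⟩ := h
  have e12 : D.toBlocks₁₂ = statMean F Y.toBlocks₁₂ := by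
    refine (eq_statMean_iff hF).2 ?_
    simpa using h12
  rw [hDb, momentSolve, ← e12]
  congr 1
  refine (eq_lyap_iff hF).2 ?_
  rw [add_assoc] at *
  conv_lhs => rw [h11]
  simp [Matrix.add_mul]
  abel

theorem momentSolve_smul (F : Matrix q q ℝ) (b : Matrix q Unit ℝ) (c : ℝ)
    (Y : Matrix (q ⊕ Unit) (q ⊕ Unit) ℝ) :
    momentSolve F b (c • Y) = c • momentSolve F b Y := by
  have hl : ∀ X : Matrix q q ℝ, lyap F (c • X) = c • lyap F X := fun X => by
    rw [← vec_inj, vec_smul, vec_lyap, vec_lyap, vec_smul, Matrix.mulVec_smul]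
  have h12 : (c • Y).toBlocks₁₂ = c • Y.toBlocks₁₂ := rfl
  have h11 : (c • Y).toBlocks₁₁ = c • Y.toBlocks₁₁ := rfl
  have hm : statMean F (c • Y.toBlocks₁₂) = c • statMean F Y.toBlocks₁₂ := by
    rw [statMean, Matrix.mul_smul, statMean]
  rw [momentSolve, h12, h11, hm, momentSolve, fromBlocks_smul, ← hl]
  simp [Matrix.mul_smul, smul_add]

/-! Continuous dependence on the data. -/

variable {X : Type*} [TopologicalSpace X]

theorem continuous_lyap {F Y : X → Matrix q q ℝ} (hF : Continuous F) (hY : Continuous Y)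
    (h : ∀ x, specRad (F x) < 1) : Continuous fun x => lyap (F x) (Y x) :=
  continuous_iff_continuousAt.2 fun x =>
    ContinuousAt.comp (f := fun x => (F x, Y x)) (continuousAt_lyap (h x) (Y x))
      (hF.prodMk hY).continuousAt

theorem continuousAt_matrix_inv {r : Type*} [Fintype r] [DecidableEq r] {A : Matrix r r ℝ}
    (hA : IsUnit A.det) : ContinuousAt (fun G : Matrix r r ℝ => G⁻¹) A := by
  have : (fun G : Matrix r r ℝ => G⁻¹) = fun G => G.det⁻¹ • G.adjugate := by
    funext G; rw [Matrix.inv_def, Ring.inverse_eq_inv']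
  rw [this]
  exact ((continuous_id.matrix_det).continuousAt.inv₀ hA.ne_zero).smul
    (continuous_id.matrix_adjugate).continuousAt

theorem continuous_matrix_inv {r : Type*} [Fintype r] [DecidableEq r] {A : X → Matrix r r ℝ}
    (hA : Continuous A) (h : ∀ x, IsUnit (A x).det) : Continuous fun x => (A x)⁻¹ :=
  continuous_iff_continuousAt.2 fun x =>
    ContinuousAt.comp (f := A) (continuousAt_matrix_inv (h x)) hA.continuousAt

theorem continuous_statMean {F : X → Matrix q q ℝ} {b : X → Matrix q Unit ℝ} (hF : Continuous F)
    (hb : Continuous b) (h : ∀ x, specRad (F x) < 1) :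
    Continuous fun x => statMean (F x) (b x) :=
  (continuous_matrix_inv (continuous_const.sub hF) fun x => isUnit_det_one_sub (h x)).matrix_mul hb

theorem continuous_statMoment {F : X → Matrix q q ℝ} {b : X → Matrix q Unit ℝ}
    (hF : Continuous F) (hb : Continuous b) (h : ∀ x, specRad (F x) < 1) (W : Matrix q q ℝ) :
    Continuous fun x => statMoment (F x) (b x) W := by
  have h1 := continuous_statMean hF hb h
  have h2 := continuous_lyap hF (continuous_const (y := W)) h
  refine Continuous.matrix_fromBlocks ?_ h1 h1.matrix_transpose continuous_const
  exact h2.add (h1.matrix_mul h1.matrix_transpose)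

theorem continuous_valueMatrix {F : X → Matrix q q ℝ} {b : X → Matrix q Unit ℝ}
    {C : X → Matrix (q ⊕ Unit) (q ⊕ Unit) ℝ} (hF : Continuous F) (hb : Continuous b)
    (hC : Continuous C) (h : ∀ x, specRad (F x) < 1) :
    Continuous fun x => valueMatrix (F x) (b x) (C x) := by
  have h' : ∀ x, specRad (F x)ᵀ < 1 := fun x => (specRad_transpose (F x)).symm ▸ h x
  have hC1 : Continuous fun x => (C x).toBlocks₁₁ :=
    hC.matrix_submatrix Sum.inl Sum.inl
  have hC2 : Continuous fun x => (C x).toBlocks₁₂ :=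
    hC.matrix_submatrix Sum.inl Sum.inr
  have h1 := continuous_lyap hF.matrix_transpose hC1 h'
  have h2 := continuous_statMean hF.matrix_transpose
    (hC2.add ((hF.matrix_transpose.matrix_mul h1).matrix_mul hb)) h'
  exact Continuous.matrix_fromBlocks h1 h2 h2.matrix_transpose continuous_const

theorem continuous_momentSolve {F : X → Matrix q q ℝ} {b : X → Matrix q Unit ℝ}
    {Y : X → Matrix (q ⊕ Unit) (q ⊕ Unit) ℝ} (hF : Continuous F) (hb : Continuous b)
    (hY : Continuous Y) (h : ∀ x, specRad (F x) < 1) :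
    Continuous fun x => momentSolve (F x) (b x) (Y x) := by
  have hY1 : Continuous fun x => (Y x).toBlocks₁₁ :=
    hY.matrix_submatrix Sum.inl Sum.inl
  have hY2 : Continuous fun x => (Y x).toBlocks₁₂ :=
    hY.matrix_submatrix Sum.inl Sum.inr
  have h1 := continuous_statMean hF hY2 h
  refine Continuous.matrix_fromBlocks (continuous_lyap hF ?_ h) h1 h1.matrix_transpose
    continuous_const
  exact (((hF.matrix_mul h1).matrix_mul hb.matrix_transpose).add
    ((hb.matrix_mul h1.matrix_transpose).matrix_mul hF.matrix_transpose)).add hY1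

end Affine

/-! ### Frobenius geometry -/

section Frobenius

variable {p q r : Type*} [Fintype p] [Fintype q] [Fintype r]

theorem norm_sq_eq_trace (X : Matrix p q ℝ) : ‖X‖ ^ 2 = (Xᵀ * X).trace := by
  rw [frobenius_norm_def, ← Real.sqrt_eq_rpow, Real.sq_sqrt (by positivity), Finset.sum_comm]
  simp [Matrix.trace, Matrix.mul_apply, sq]

theorem norm_sq_eq_trace' (X : Matrix p q ℝ) : ‖X‖ ^ 2 = (X * Xᵀ).trace := by
  rw [norm_sq_eq_trace, Matrix.trace_mul_comm]

theorem trace_transpose_mul_eq_sum (X Y : Matrix p q ℝ) :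
    (Xᵀ * Y).trace = ∑ i, ∑ j, X i j * Y i j := by
  rw [Finset.sum_comm]
  simp [Matrix.trace, Matrix.mul_apply]

/-- Cauchy–Schwarz, from the discriminant of `s ↦ ‖s X + Y‖²`. -/
theorem abs_trace_transpose_mul_le (X Y : Matrix p q ℝ) : |(Xᵀ * Y).trace| ≤ ‖X‖ * ‖Y‖ := by
  have h : ∀ s : ℝ, 0 ≤ ‖X‖ ^ 2 * (s * s) + 2 * (Xᵀ * Y).trace * s + ‖Y‖ ^ 2 := fun s => by
    have h1 : ‖s • X + Y‖ ^ 2 = ‖X‖ ^ 2 * (s * s) + 2 * (Xᵀ * Y).trace * s + ‖Y‖ ^ 2 := by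
      have h2 : (Yᵀ * X).trace = (Xᵀ * Y).trace := by
        rw [← Matrix.trace_transpose, Matrix.transpose_mul, Matrix.transpose_transpose]
      simp only [norm_sq_eq_trace, Matrix.transpose_add, Matrix.transpose_smul, Matrix.add_mul,
        Matrix.mul_add, Matrix.smul_mul, Matrix.mul_smul, Matrix.trace_add, Matrix.trace_smul,
        smul_eq_mul, h2]
      ring
    rw [← h1]
    positivity
  have hd := discrim_le_zero h
  rw [discrim] at hd
  refine abs_le_of_sq_le_sq ?_ (by positivity)
  nlinarith

theorem PosSemidef.norm_le_trace {X : Matrix q q ℝ} (hX : X.PosSemidef) : ‖X‖ ≤ X.trace := by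
  classical
  obtain ⟨Y, rfl⟩ := PosSemidef.exists_transpose_mul_self hX
  rw [← norm_sq_eq_trace, sq]
  refine (frobenius_norm_mul _ _).trans ?_
  rw [frobenius_norm_transpose]

/-- The Frobenius pairing with `Z`, as a continuous linear form. -/
def pairing (Z : Matrix p q ℝ) : Matrix p q ℝ →L[ℝ] ℝ :=
  LinearMap.mkContinuous
    { toFun := fun H => (Zᵀ * H).trace
      map_add' := fun H H' => by rw [Matrix.mul_add, Matrix.trace_add]
      map_smul' := fun c H => by rw [Matrix.mul_smul, Matrix.trace_smul]; rfl } ‖Z‖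
    fun H => abs_trace_transpose_mul_le Z H

@[simp]
theorem pairing_apply (Z H : Matrix p q ℝ) : pairing Z H = (Zᵀ * H).trace := rfl

variable [DecidableEq p] [DecidableEq q]

theorem trace_matGrad_transpose_mul (f : Matrix p q ℝ → ℝ) (Z H : Matrix p q ℝ) :
    ((matGrad f Z)ᵀ * H).trace = fderiv ℝ f Z H := by
  conv_rhs => rw [Matrix.matrix_eq_sum_single H]
  rw [trace_transpose_mul_eq_sum, map_sum]
  refine Finset.sum_congr rfl fun i _ => ?_
  rw [map_sum]
  refine Finset.sum_congr rfl fun j _ => ?_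
  have : Matrix.single i j (H i j) = H i j • Matrix.single i j (1 : ℝ) := by
    rw [Matrix.smul_single, smul_eq_mul, mul_one]
  rw [this, map_smul, smul_eq_mul, mul_comm]
  rfl

theorem eq_of_trace_transpose_mul_eq {Y Z : Matrix p q ℝ}
    (h : ∀ H : Matrix p q ℝ, (Yᵀ * H).trace = (Zᵀ * H).trace) : Y = Z := by
  have h1 : ‖Y - Z‖ ^ 2 = 0 := by
    rw [norm_sq_eq_trace]
    conv_lhs => rw [Matrix.transpose_sub, Matrix.sub_mul, Matrix.trace_sub, h, sub_self]
  exact sub_eq_zero.1 (norm_eq_zero.1 (pow_eq_zero_iff (two_ne_zero)|>.1 h1))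

theorem matGrad_eq_of_hasFDerivAt {f : Matrix p q ℝ → ℝ} {Z G : Matrix p q ℝ}
    (h : HasFDerivAt f (pairing G) Z) : matGrad f Z = G :=
  eq_of_trace_transpose_mul_eq fun H => by
    rw [trace_matGrad_transpose_mul, h.fderiv, pairing_apply]

end Frobenius

/-! ### Linear-quadratic tracking with affine feedback -/

/-- The model `x⁺ = A x + B u + w` (`w` of covariance `W`), with stage cost
`(x - δ)ᵀ Q (x - δ) + uᵀ R u`. -/
structure AffineLQ (p q : Type*) where
  A : Matrix q q ℝ
  B : Matrix q p ℝ
  Q : Matrix q q ℝ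
  δ : Matrix q Unit ℝ
  R : Matrix p p ℝ
  W : Matrix q q ℝ

namespace AffineLQ

variable {p q : Type*} [Fintype p] [Fintype q] [DecidableEq p] [DecidableEq q]
variable (L : AffineLQ p q)

/-- The closed-loop matrix `A + B K`. -/
def cl (θ : Matrix p (q ⊕ Unit) ℝ) : Matrix q q ℝ := L.A + L.B * θ.toCols₁

/-- The closed-loop drift `B l`. -/
def drift (θ : Matrix p (q ⊕ Unit) ℝ) : Matrix q Unit ℝ := L.B * θ.toCols₂

/-- The closed loop in homogeneous coordinates. -/
def loop (θ : Matrix p (q ⊕ Unit) ℝ) : Matrix (q ⊕ Unit) (q ⊕ Unit) ℝ :=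
  augLoop (L.cl θ) (L.drift θ)

/-- The input matrix in homogeneous coordinates. -/
def augB : Matrix (q ⊕ Unit) p ℝ := fromRows L.B 0

/-- The tracking error as a function of `[x; 1]`. -/
def err : Matrix q (q ⊕ Unit) ℝ := fromCols 1 (-L.δ)

/-- The stage cost matrix of the policy `θ` in homogeneous coordinates. -/
def stage (θ : Matrix p (q ⊕ Unit) ℝ) : Matrix (q ⊕ Unit) (q ⊕ Unit) ℝ :=
  L.errᵀ * L.Q * L.err + θᵀ * L.R * θ

/-- The stationary second moment of `[x; 1]`. -/
def moment (θ : Matrix p (q ⊕ Unit) ℝ) : Matrix (q ⊕ Unit) (q ⊕ Unit) ℝ :=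
  statMoment (L.cl θ) (L.drift θ) L.W

/-- The relative value matrix. -/
def value (θ : Matrix p (q ⊕ Unit) ℝ) : Matrix (q ⊕ Unit) (q ⊕ Unit) ℝ :=
  valueMatrix (L.cl θ) (L.drift θ) (L.stage θ)

/-- The stationary cost. -/
def cost (θ : Matrix p (q ⊕ Unit) ℝ) : ℝ := (L.stage θ * L.moment θ).trace

/-- The linear coefficient of the advantage function. -/
def adv (θ : Matrix p (q ⊕ Unit) ℝ) : Matrix p (q ⊕ Unit) ℝ :=
  L.R * θ + L.augBᵀ * L.value θ * L.loop θ

/-- The quadratic coefficient of the advantage function. -/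
def hess (θ : Matrix p (q ⊕ Unit) ℝ) : Matrix p p ℝ := L.R + L.augBᵀ * L.value θ * L.augB

/-- The stabilizing policies. -/
def stable : Set (Matrix p (q ⊕ Unit) ℝ) := {θ | specRad (L.cl θ) < 1}

variable {L}

omit [Fintype q] [DecidableEq p] in
theorem loop_eq_add (θ θ' : Matrix p (q ⊕ Unit) ℝ) :
    L.loop θ' = L.loop θ + L.augB * (θ' - θ) := by
  ext (i | i) (j | j) <;>
    simp [loop, augLoop, augB, cl, drift, Matrix.mul_apply, Matrix.toCols₁, Matrix.toCols₂,
      mul_sub]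

theorem stage_posSemidef (hQ : L.Q.PosSemidef) (hR : L.R.PosSemidef)
    (θ : Matrix p (q ⊕ Unit) ℝ) : (L.stage θ).PosSemidef :=
  (PosSemidef.transpose_mul_mul hQ _).add (PosSemidef.transpose_mul_mul hR _)

theorem stage_transpose (hQ : L.Qᵀ = L.Q) (hR : L.Rᵀ = L.R) (θ : Matrix p (q ⊕ Unit) ℝ) :
    (L.stage θ)ᵀ = L.stage θ := by
  simp [stage, Matrix.transpose_mul, hQ, hR, Matrix.mul_assoc]

theorem value_transpose (hQ : L.Qᵀ = L.Q) (hR : L.Rᵀ = L.R) {θ : Matrix p (q ⊕ Unit) ℝ}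
    (hθ : θ ∈ L.stable) : (L.value θ)ᵀ = L.value θ :=
  valueMatrix_transpose hθ _ (stage_transpose hQ hR θ)

/-- The loop is affine and the stage cost quadratic in the policy, so the expansion in `θ' - θ`
stops at second order. For `V = L.value θ` the coefficients are `adv` and `hess`. -/
theorem stage_add_loop (hR : L.Rᵀ = L.R) {V : Matrix (q ⊕ Unit) (q ⊕ Unit) ℝ} (hV : Vᵀ = V)
    (θ θ' : Matrix p (q ⊕ Unit) ℝ) :
    L.stage θ' + (L.loop θ')ᵀ * V * L.loop θ' =
      L.stage θ + (L.loop θ)ᵀ * V * L.loop θ +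
        ((θ' - θ)ᵀ * (L.R * θ + L.augBᵀ * V * L.loop θ) +
          (L.R * θ + L.augBᵀ * V * L.loop θ)ᵀ * (θ' - θ) +
          (θ' - θ)ᵀ * (L.R + L.augBᵀ * V * L.augB) * (θ' - θ)) := by
  rw [loop_eq_add θ θ']
  obtain ⟨H, rfl⟩ : ∃ H, θ' = θ + H := ⟨θ' - θ, by abel⟩
  simp only [add_sub_cancel_left, stage, Matrix.transpose_add, Matrix.transpose_mul,
    Matrix.transpose_transpose, Matrix.mul_add, Matrix.add_mul, Matrix.mul_assoc, hR, hV]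
  abel

/-- The point is the order of quantifiers: `j` depends on `θ` alone, while `θ'` and `Ψ` are free. In
particular `Ψ` need not be stationary. -/
theorem exists_trace_bellman (hQ : L.Qᵀ = L.Q) (hR : L.Rᵀ = L.R) {θ : Matrix p (q ⊕ Unit) ℝ}
    (hθ : θ ∈ L.stable) :
    ∃ j : ℝ, ∀ (θ' : Matrix p (q ⊕ Unit) ℝ) (Ψ : Matrix (q ⊕ Unit) (q ⊕ Unit) ℝ), Ψᵀ = Ψ →
      Ψ (Sum.inr ()) (Sum.inr ()) = 1 →
      (L.stage θ' * Ψ).trace + (L.value θ * (L.loop θ' * Ψ * (L.loop θ')ᵀ)).trace -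
        (L.value θ * Ψ).trace =
      j + 2 * ((θ' - θ)ᵀ * (L.adv θ * Ψ)).trace +
        (L.hess θ * ((θ' - θ) * Ψ * (θ' - θ)ᵀ)).trace := by
  obtain ⟨j, hj⟩ := exists_valueMatrix_bellman hθ (L.drift θ) (stage_transpose hQ hR θ)
  refine ⟨j () (), fun θ' Ψ hΨ h1 => ?_⟩
  have hcorner := trace_mul_of_corner hj h1
  have hstep := congrArg (fun Z => (Z * Ψ).trace)
    (stage_add_loop hR (value_transpose hQ hR hθ) θ θ')
  have e1 : ∀ Z V : Matrix (q ⊕ Unit) (q ⊕ Unit) ℝ,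
      (Zᵀ * V * Z * Ψ).trace = (V * (Z * Ψ * Zᵀ)).trace := fun Z V => by
    rw [Matrix.mul_assoc, Matrix.mul_assoc, Matrix.trace_mul_comm]
    simp only [Matrix.mul_assoc]
  have e2 : ∀ H : Matrix p (q ⊕ Unit) ℝ,
      (Hᵀ * L.hess θ * H * Ψ).trace = (L.hess θ * (H * Ψ * Hᵀ)).trace := fun H => by
    rw [Matrix.mul_assoc, Matrix.mul_assoc, Matrix.trace_mul_comm]
    simp only [Matrix.mul_assoc]
  have e3 : ∀ H E : Matrix p (q ⊕ Unit) ℝ, (Eᵀ * H * Ψ).trace = (Hᵀ * (E * Ψ)).trace :=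
    fun H E => by
      rw [← Matrix.trace_transpose]
      simp only [Matrix.transpose_mul, Matrix.transpose_transpose, hΨ]
      rw [Matrix.trace_mul_comm, Matrix.mul_assoc]
  change ((L.stage θ + (L.loop θ)ᵀ * L.value θ * L.loop θ - L.value θ) * Ψ).trace = _ at hcorner
  have hE : L.R * θ + L.augBᵀ * L.value θ * L.loop θ = L.adv θ := rfl
  have hG : L.R + L.augBᵀ * L.value θ * L.augB = L.hess θ := rfl
  simp only [hE, hG, Matrix.add_mul _ _ Ψ, Matrix.trace_add] at hstep
  rw [e1, e1, e2, e3 (θ' - θ) (L.adv θ), Matrix.mul_assoc (θ' - θ)ᵀ (L.adv θ)] at hstep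
  simp only [Matrix.sub_mul, Matrix.add_mul _ _ Ψ, Matrix.trace_add, Matrix.trace_sub, e1]
    at hcorner
  linarith

theorem moment_transpose (hW : L.Wᵀ = L.W) {θ : Matrix p (q ⊕ Unit) ℝ} (hθ : θ ∈ L.stable) :
    (L.moment θ)ᵀ = L.moment θ :=
  statMoment_transpose hθ hW _

theorem moment_corner (θ : Matrix p (q ⊕ Unit) ℝ) :
    L.moment θ (Sum.inr ()) (Sum.inr ()) = 1 := by
  simp [moment, statMoment]

theorem moment_eq {θ : Matrix p (q ⊕ Unit) ℝ} (hθ : θ ∈ L.stable) :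
    L.moment θ = L.loop θ * L.moment θ * (L.loop θ)ᵀ + augNoise L.W :=
  statMoment_eq hθ _ _

/-- Evaluating `exists_trace_bellman` at `θ' = θ` and the stationary moment identifies `j` with the
cost minus the noise term. The result is one time step from an arbitrary `Ψ`, which also serves
policies without a stationary moment. -/
theorem trace_stage_add (hQ : L.Qᵀ = L.Q) (hR : L.Rᵀ = L.R) (hW : L.Wᵀ = L.W)
    {θ : Matrix p (q ⊕ Unit) ℝ} (hθ : θ ∈ L.stable) (θ' : Matrix p (q ⊕ Unit) ℝ)
    {Ψ : Matrix (q ⊕ Unit) (q ⊕ Unit) ℝ} (hΨ : Ψᵀ = Ψ)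
    (h1 : Ψ (Sum.inr ()) (Sum.inr ()) = 1) :
    (L.stage θ' * Ψ).trace +
        (L.value θ * (L.loop θ' * Ψ * (L.loop θ')ᵀ + augNoise L.W)).trace -
        (L.value θ * Ψ).trace =
      L.cost θ + 2 * ((θ' - θ)ᵀ * (L.adv θ * Ψ)).trace +
        (L.hess θ * ((θ' - θ) * Ψ * (θ' - θ)ᵀ)).trace := by
  obtain ⟨j, hj⟩ := exists_trace_bellman hQ hR hθ
  have h := hj θ _ (moment_transpose hW hθ) (moment_corner θ)
  have h2 : L.loop θ * L.moment θ * (L.loop θ)ᵀ = L.moment θ - augNoise L.W :=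
    eq_sub_of_add_eq (moment_eq hθ).symm
  rw [h2, Matrix.mul_sub, Matrix.trace_sub, sub_self] at h
  simp only [Matrix.transpose_zero, Matrix.zero_mul, Matrix.mul_zero, Matrix.trace_zero] at h
  have h3 := hj θ' Ψ hΨ h1
  rw [Matrix.mul_add, Matrix.trace_add]
  rw [cost]
  linarith

/-- At the stationary moment of `θ'` the two value terms cancel. Linear and quadratic terms are both
weighted by the moment of `θ'`, which makes the formula exact. -/
theorem cost_eq_add (hQ : L.Qᵀ = L.Q) (hR : L.Rᵀ = L.R) (hW : L.Wᵀ = L.W)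
    {θ θ' : Matrix p (q ⊕ Unit) ℝ} (hθ : θ ∈ L.stable) (hθ' : θ' ∈ L.stable) :
    L.cost θ' = L.cost θ + 2 * ((θ' - θ)ᵀ * (L.adv θ * L.moment θ')).trace +
      (L.hess θ * ((θ' - θ) * L.moment θ' * (θ' - θ)ᵀ)).trace := by
  have h := trace_stage_add hQ hR hW hθ θ' (moment_transpose hW hθ') (moment_corner θ')
  rw [← moment_eq hθ'] at h
  rw [cost]
  linarith

theorem continuous_cl : Continuous L.cl := by
  have : Continuous fun θ : Matrix p (q ⊕ Unit) ℝ => θ.toCols₁ :=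
    continuous_id.matrix_submatrix id Sum.inl
  exact continuous_const.add (continuous_const.matrix_mul this)

theorem continuous_drift : Continuous L.drift := by
  have : Continuous fun θ : Matrix p (q ⊕ Unit) ℝ => θ.toCols₂ :=
    continuous_id.matrix_submatrix id Sum.inr
  exact continuous_const.matrix_mul this

theorem continuous_loop : Continuous L.loop :=
  Continuous.matrix_fromBlocks continuous_cl continuous_drift continuous_const continuous_const

theorem continuous_stage : Continuous L.stage := by
  unfold stage
  fun_prop

theorem isOpen_stable : IsOpen L.stable := isOpen_specRad_lt_one.preimage continuous_cl

theorem continuousOn_moment : ContinuousOn L.moment L.stable :=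
  continuousOn_iff_continuous_restrict.2 <|
    continuous_statMoment (continuous_cl.comp continuous_subtype_val)
      (continuous_drift.comp continuous_subtype_val) (fun x => x.2) L.W

theorem continuousOn_value : ContinuousOn L.value L.stable :=
  continuousOn_iff_continuous_restrict.2 <|
    continuous_valueMatrix (continuous_cl.comp continuous_subtype_val)
      (continuous_drift.comp continuous_subtype_val)
      (continuous_stage.comp continuous_subtype_val) (fun x => x.2)

theorem continuousOn_adv : ContinuousOn L.adv L.stable := by
  have hc : Continuous fun z : Matrix p (q ⊕ Unit) ℝ × Matrix (q ⊕ Unit) (q ⊕ Unit) ℝ =>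
      L.R * z.1 + L.augBᵀ * z.2 * L.loop z.1 :=
    (continuous_const.matrix_mul continuous_fst).add
      ((continuous_const.matrix_mul continuous_snd).matrix_mul (continuous_loop.comp continuous_fst))
  have h : ContinuousOn (fun θ => (θ, L.value θ)) L.stable :=
    continuousOn_id.prodMk continuousOn_value
  exact hc.comp_continuousOn' h

theorem continuousOn_hess : ContinuousOn L.hess L.stable := by
  have hc : Continuous fun z : Matrix (q ⊕ Unit) (q ⊕ Unit) ℝ => L.R + L.augBᵀ * z * L.augB := by
    fun_prop
  exact hc.comp_continuousOn continuousOn_value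

theorem continuousOn_cost : ContinuousOn L.cost L.stable := by
  have h : Continuous fun θ : L.stable => L.stage θ * L.moment θ :=
    (continuous_stage.comp continuous_subtype_val).matrix_mul
      (continuousOn_iff_continuous_restrict.1 continuousOn_moment)
  exact continuousOn_iff_continuous_restrict.2 h.matrix_trace

theorem abs_trace_hess_le (G : Matrix p p ℝ) (H : Matrix p (q ⊕ Unit) ℝ)
    (Ψ : Matrix (q ⊕ Unit) (q ⊕ Unit) ℝ) :
    |(G * (H * Ψ * Hᵀ)).trace| ≤ ‖G‖ * ‖Ψ‖ * ‖H‖ ^ 2 := by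
  have h := abs_trace_transpose_mul_le Gᵀ (H * Ψ * Hᵀ)
  rw [Matrix.transpose_transpose, frobenius_norm_transpose] at h
  refine h.trans ?_
  have h1 : ‖H * Ψ * Hᵀ‖ ≤ ‖H‖ * ‖Ψ‖ * ‖H‖ := by
    refine (frobenius_norm_mul _ _).trans ?_
    rw [frobenius_norm_transpose]
    gcongr
    exact frobenius_norm_mul _ _
  calc ‖G‖ * ‖H * Ψ * Hᵀ‖ ≤ ‖G‖ * (‖H‖ * ‖Ψ‖ * ‖H‖) := by gcongr
    _ = _ := by ring

/-- Replacing `L.moment θ'` by `L.moment θ` in the linear term of `cost_eq_add` gives the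
first-order expansion; the remainder is that replacement plus the quadratic term. Continuity of the
moment then gives differentiability, and a Lipschitz bound gives smoothness. -/
theorem abs_cost_sub_sub_le (hQ : L.Qᵀ = L.Q) (hR : L.Rᵀ = L.R) (hW : L.Wᵀ = L.W)
    {θ θ' : Matrix p (q ⊕ Unit) ℝ} (hθ : θ ∈ L.stable) (hθ' : θ' ∈ L.stable) :
    |L.cost θ' - L.cost θ - (((2 : ℝ) • (L.adv θ * L.moment θ))ᵀ * (θ' - θ)).trace| ≤
      ‖θ' - θ‖ * (2 * ‖L.adv θ‖ * ‖L.moment θ' - L.moment θ‖ +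
        ‖L.hess θ‖ * ‖L.moment θ'‖ * ‖θ' - θ‖) := by
  have h := cost_eq_add hQ hR hW hθ hθ'
  have e : (((2 : ℝ) • (L.adv θ * L.moment θ))ᵀ * (θ' - θ)).trace =
      2 * ((θ' - θ)ᵀ * (L.adv θ * L.moment θ)).trace := by
    rw [Matrix.transpose_smul, Matrix.smul_mul, Matrix.trace_smul, smul_eq_mul,
      ← Matrix.trace_transpose, Matrix.transpose_mul, Matrix.transpose_transpose]
  have e2 : L.cost θ' - L.cost θ - (((2 : ℝ) • (L.adv θ * L.moment θ))ᵀ * (θ' - θ)).trace =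
      2 * ((θ' - θ)ᵀ * (L.adv θ * (L.moment θ' - L.moment θ))).trace +
        (L.hess θ * ((θ' - θ) * L.moment θ' * (θ' - θ)ᵀ)).trace := by
    rw [e, h, Matrix.mul_sub, Matrix.mul_sub, Matrix.trace_sub]
    ring
  rw [e2]
  refine (abs_add_le _ _).trans ?_
  have h1 := abs_trace_hess_le (L.hess θ) (θ' - θ) (L.moment θ')
  have h2 := abs_trace_transpose_mul_le (θ' - θ) (L.adv θ * (L.moment θ' - L.moment θ))
  have h3 : ‖θ' - θ‖ * ‖L.adv θ * (L.moment θ' - L.moment θ)‖ ≤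
      ‖θ' - θ‖ * (‖L.adv θ‖ * ‖L.moment θ' - L.moment θ‖) := by
    gcongr
    exact frobenius_norm_mul _ _
  rw [abs_mul, abs_two]
  nlinarith

theorem hasFDerivAt_cost (hQ : L.Qᵀ = L.Q) (hR : L.Rᵀ = L.R) (hW : L.Wᵀ = L.W)
    {θ : Matrix p (q ⊕ Unit) ℝ} (hθ : θ ∈ L.stable) :
    HasFDerivAt L.cost (pairing ((2 : ℝ) • (L.adv θ * L.moment θ))) θ := by
  have hn : L.stable ∈ 𝓝 θ := isOpen_stable.mem_nhds hθ
  have hm : ContinuousAt L.moment θ := continuousOn_moment.continuousAt hn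
  have hg : Tendsto (fun θ' => 2 * ‖L.adv θ‖ * ‖L.moment θ' - L.moment θ‖ +
      ‖L.hess θ‖ * ‖L.moment θ'‖ * ‖θ' - θ‖) (𝓝 θ) (𝓝 0) := by
    have h1 : Tendsto (fun θ' => ‖L.moment θ' - L.moment θ‖) (𝓝 θ) (𝓝 0) := by
      have := (hm.sub (continuousAt_const (y := L.moment θ))).norm
      simpa [ContinuousAt] using this
    have h2 : Tendsto (fun θ' => ‖θ' - θ‖) (𝓝 θ) (𝓝 0) := by
      have : Continuous fun θ' : Matrix p (q ⊕ Unit) ℝ => ‖θ' - θ‖ := by fun_prop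
      simpa using this.tendsto θ
    have h3 : Tendsto (fun θ' => ‖L.moment θ'‖) (𝓝 θ) (𝓝 ‖L.moment θ‖) := hm.norm
    simpa using (h1.const_mul (2 * ‖L.adv θ‖)).add ((h3.const_mul ‖L.hess θ‖).mul h2)
  refine hasFDerivAt_iff_isLittleO.2 (Asymptotics.isLittleO_iff.2 fun c hc => ?_)
  filter_upwards [hn, hg.eventually (gt_mem_nhds hc)] with θ' hθ' hlt
  refine (abs_cost_sub_sub_le hQ hR hW hθ hθ').trans ?_
  rw [mul_comm]
  gcongr

theorem matGrad_cost (hQ : L.Qᵀ = L.Q) (hR : L.Rᵀ = L.R) (hW : L.Wᵀ = L.W)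
    {θ : Matrix p (q ⊕ Unit) ℝ} (hθ : θ ∈ L.stable) :
    matGrad L.cost θ = (2 : ℝ) • (L.adv θ * L.moment θ) :=
  matGrad_eq_of_hasFDerivAt (hasFDerivAt_cost hQ hR hW hθ)

end AffineLQ

/-! ### Positivity of moments and Hessians -/

namespace AffineLQ

variable {p q : Type*} [Fintype p] [Fintype q] [DecidableEq p] [DecidableEq q]
variable {L : AffineLQ p q}

/-- The Schur complement of the corner `1` is the stationary covariance `lyap (L.cl θ) L.W`. -/
theorem moment_posSemidef (hW : L.W.PosSemidef) {θ : Matrix p (q ⊕ Unit) ℝ} (hθ : θ ∈ L.stable) :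
    (L.moment θ).PosSemidef := by
  let _ : Invertible (1 : Matrix Unit Unit ℝ) := invertibleOne
  have h := (Matrix.PosDef.fromBlocks₂₂ (lyap (L.cl θ) L.W + statMean (L.cl θ) (L.drift θ) *
    (statMean (L.cl θ) (L.drift θ))ᵀ) (statMean (L.cl θ) (L.drift θ))
    (D := (1 : Matrix Unit Unit ℝ)) Matrix.PosDef.one)
  rw [conjTranspose_eq_transpose_of_trivial] at h
  refine h.2 ?_
  simpa using lyap_posSemidef hθ hW

theorem sub_posSemidef_of_lyap {F S W : Matrix q q ℝ} (hS : S.PosSemidef)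
    (h : S = F * S * Fᵀ + W) : (S - W).PosSemidef := by
  have := PosSemidef.mul_mul_transpose hS F
  rwa [eq_sub_of_add_eq h.symm] at this

/-- The stationary covariance dominates the covariance `W` of a single noise step. -/
theorem lyap_posDef {F W : Matrix q q ℝ} (hF : specRad F < 1) (hW : W.PosDef) :
    (lyap F W).PosDef := by
  have := (sub_posSemidef_of_lyap (lyap_posSemidef hF hW.posSemidef) (lyap_eq hF W))
  have h2 := hW.add_posSemidef this
  rwa [add_sub_cancel] at h2

theorem moment_posDef (hW : L.W.PosDef) {θ : Matrix p (q ⊕ Unit) ℝ} (hθ : θ ∈ L.stable) :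
    (L.moment θ).PosDef := by
  refine (moment_posSemidef hW.posSemidef hθ).posDef_iff_det_ne_zero.2 ?_
  rw [moment, statMoment, det_fromBlocks_one₂₂, add_sub_cancel_right]
  exact (lyap_posDef hθ hW).det_pos.ne'

theorem hess_eq (θ : Matrix p (q ⊕ Unit) ℝ) :
    L.hess θ = L.Bᵀ * (L.value θ).toBlocks₁₁ * L.B + L.R := by
  rw [hess, add_comm]
  congr 1
  conv_lhs => rw [← fromBlocks_toBlocks (L.value θ)]
  rw [augB, transpose_fromRows, Matrix.transpose_zero, fromCols_mul_fromBlocks,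
    fromCols_mul_fromRows]
  simp

theorem stage_toBlocks₁₁ (θ : Matrix p (q ⊕ Unit) ℝ) :
    (L.stage θ).toBlocks₁₁ = L.Q + θ.toCols₁ᵀ * L.R * θ.toCols₁ := by
  have h : ∀ Z : Matrix (q ⊕ Unit) (q ⊕ Unit) ℝ, Z.toBlocks₁₁ =
      (fromRows 1 0 : Matrix (q ⊕ Unit) q ℝ)ᵀ * Z * (fromRows 1 0 : Matrix (q ⊕ Unit) q ℝ) :=
    fun Z => by
      ext i j
      simp [Matrix.mul_apply, Matrix.one_apply]
      rfl
  have h1 : L.err * (fromRows 1 0 : Matrix (q ⊕ Unit) q ℝ) = 1 := by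
    rw [err, fromCols_mul_fromRows]; simp
  have h2 : θ * (fromRows 1 0 : Matrix (q ⊕ Unit) q ℝ) = θ.toCols₁ := by
    conv_lhs => rw [← fromCols_toCols θ]
    rw [fromCols_mul_fromRows]; simp
  rw [h, stage]
  generalize (fromRows 1 0 : Matrix (q ⊕ Unit) q ℝ) = i at h1 h2
  have e : iᵀ * (L.errᵀ * L.Q * L.err + θᵀ * L.R * θ) * i =
      (L.err * i)ᵀ * L.Q * (L.err * i) + (θ * i)ᵀ * L.R * (θ * i) := by
    simp only [Matrix.transpose_mul, Matrix.mul_add, Matrix.add_mul, Matrix.mul_assoc]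
  rw [e, h1, h2]
  simp

theorem value_toBlocks₁₁ (θ : Matrix p (q ⊕ Unit) ℝ) :
    (L.value θ).toBlocks₁₁ = lyap (L.cl θ)ᵀ (L.Q + θ.toCols₁ᵀ * L.R * θ.toCols₁) := by
  rw [← stage_toBlocks₁₁]
  rfl

theorem specRad_cl_transpose {θ : Matrix p (q ⊕ Unit) ℝ} (hθ : θ ∈ L.stable) :
    specRad (L.cl θ)ᵀ < 1 := (specRad_transpose (L.cl θ)).symm ▸ hθ

theorem hess_posDef (hQ : L.Q.PosSemidef) (hR : L.R.PosDef) {θ : Matrix p (q ⊕ Unit) ℝ}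
    (hθ : θ ∈ L.stable) : (L.hess θ).PosDef := by
  rw [hess_eq, value_toBlocks₁₁]
  refine Matrix.PosDef.posSemidef_add (PosSemidef.transpose_mul_mul ?_ _) hR
  exact lyap_posSemidef (specRad_cl_transpose hθ)
    (hQ.add (PosSemidef.transpose_mul_mul hR.posSemidef _))

/-! ### Compactness of the sublevel sets -/

/-- The stationary cost in terms of the covariance `S` and the mean `x` of the state. -/
def splitCost (L : AffineLQ p q) (θ : Matrix p (q ⊕ Unit) ℝ) (S : Matrix q q ℝ)
    (x : Matrix q Unit ℝ) : ℝ :=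
  (L.Q * S).trace + (L.R * (θ.toCols₁ * S * θ.toCols₁ᵀ)).trace +
    (L.Q * ((x - L.δ) * (x - L.δ)ᵀ)).trace +
    (L.R * ((θ.toCols₁ * x + θ.toCols₂) * (θ.toCols₁ * x + θ.toCols₂)ᵀ)).trace

omit [DecidableEq p] [DecidableEq q] in
theorem trace_sandwich {r s : Type*} [Fintype r] [Fintype s] (E : Matrix r q ℝ)
    (Z : Matrix r r ℝ) (N : Matrix q s ℝ) (Y : Matrix s s ℝ) :
    (Eᵀ * Z * E * (N * Y * Nᵀ)).trace = (Z * (E * N * Y * (E * N)ᵀ)).trace := by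
  rw [Matrix.mul_assoc, Matrix.mul_assoc, Matrix.trace_mul_comm]
  simp only [Matrix.transpose_mul, Matrix.mul_assoc]

/-- The moment is `i S iᵀ + y yᵀ` with `i = [1; 0]` and `y = [x; 1]`. The split writes the cost as
four nonnegative terms, each of which controls one part of the policy or of the stationary state. -/
theorem cost_eq_splitCost (θ : Matrix p (q ⊕ Unit) ℝ) :
    L.cost θ = L.splitCost θ (lyap (L.cl θ) L.W) (statMean (L.cl θ) (L.drift θ)) := by
  rw [cost, moment, statMoment, splitCost]
  set S := lyap (L.cl θ) L.W
  set x := statMean (L.cl θ) (L.drift θ)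
  have h1 : L.err * (fromRows 1 0 : Matrix (q ⊕ Unit) q ℝ) = 1 := by
    rw [err, fromCols_mul_fromRows]; simp
  have h2 : θ * (fromRows 1 0 : Matrix (q ⊕ Unit) q ℝ) = θ.toCols₁ := by
    conv_lhs => rw [← fromCols_toCols θ]
    rw [fromCols_mul_fromRows]; simp
  have h3 : L.err * (fromRows x 1 : Matrix (q ⊕ Unit) Unit ℝ) = x - L.δ := by
    rw [err, fromCols_mul_fromRows]; simp [sub_eq_add_neg]
  have h4 : θ * (fromRows x 1 : Matrix (q ⊕ Unit) Unit ℝ) = θ.toCols₁ * x + θ.toCols₂ := by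
    conv_lhs => rw [← fromCols_toCols θ]
    rw [fromCols_mul_fromRows]; simp
  have hm : (fromBlocks (S + x * xᵀ) x xᵀ 1 : Matrix (q ⊕ Unit) (q ⊕ Unit) ℝ) =
      (fromRows 1 0 : Matrix (q ⊕ Unit) q ℝ) * S * (fromRows 1 0 : Matrix (q ⊕ Unit) q ℝ)ᵀ +
      (fromRows x 1 : Matrix (q ⊕ Unit) Unit ℝ) *
        (fromRows x 1 : Matrix (q ⊕ Unit) Unit ℝ)ᵀ := by
    have h0 : fromCols (fromRows S 0) 0 = fromBlocks S 0 0 (0 : Matrix Unit Unit ℝ) := by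
      ext (i | i) (j | j) <;> rfl
    simp [transpose_fromRows, fromRows_mul, fromRows_mul_fromCols, fromBlocks_add, h0]
  rw [hm, stage]
  generalize (fromRows 1 0 : Matrix (q ⊕ Unit) q ℝ) = i at h1 h2
  generalize (fromRows x 1 : Matrix (q ⊕ Unit) Unit ℝ) = y at h3 h4
  rw [← h3, ← h4, ← h2]
  have e1 := trace_sandwich L.err L.Q i S
  have e2 := trace_sandwich θ L.R i S
  have e3 := trace_sandwich L.err L.Q y 1
  have e4 := trace_sandwich θ L.R y 1
  rw [h1, Matrix.one_mul, Matrix.transpose_one, Matrix.mul_one] at e1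
  simp only [Matrix.mul_one] at e3 e4
  rw [Matrix.mul_add, Matrix.add_mul, Matrix.add_mul, Matrix.trace_add, Matrix.trace_add,
    Matrix.trace_add, e1, e2, e3, e4]
  ring

variable (L) in
/-- The stabilizing policies of cost at most `a`. -/
def costSublevel (a : ℝ) : Set (Matrix p (q ⊕ Unit) ℝ) := {θ | θ ∈ L.stable ∧ L.cost θ ≤ a}

variable (L) in
/-- Policies of cost at most `a` together with their stationary covariance and mean. -/
def liftedSublevel (a : ℝ) :
    Set (Matrix p (q ⊕ Unit) ℝ × Matrix q q ℝ × Matrix q Unit ℝ) :=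
  {z | z.2.1.PosSemidef ∧ z.2.1 = L.cl z.1 * z.2.1 * (L.cl z.1)ᵀ + L.W ∧
    z.2.2 = L.cl z.1 * z.2.2 + L.drift z.1 ∧ L.splitCost z.1 z.2.1 z.2.2 ≤ a}

/-- Stability is an open condition, but for `W ≻ 0` it follows from closed ones: a positive
semidefinite `S` with `S = F S Fᵀ + W` certifies it. The sublevel set is thus a projection of a
closed set. -/
theorem image_liftedSublevel (hW : L.W.PosDef) (a : ℝ) :
    Prod.fst '' L.liftedSublevel a = L.costSublevel a := by
  ext θ
  constructor
  · rintro ⟨⟨θ, S, x⟩, ⟨hS, hSe, hx, hc⟩, rfl⟩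
    have hst : specRad (L.cl θ) < 1 := by
      refine specRad_lt_one_of_posDef hS ?_
      have := sub_eq_iff_eq_add'.2 hSe
      rwa [this]
    refine ⟨hst, ?_⟩
    rw [cost_eq_splitCost, ← (eq_lyap_iff hst).2 hSe, ← (eq_statMean_iff hst).2 hx]
    exact hc
  · rintro ⟨hst, hc⟩
    refine ⟨(θ, lyap (L.cl θ) L.W, statMean (L.cl θ) (L.drift θ)),
      ⟨lyap_posSemidef hst hW.posSemidef, lyap_eq hst _, statMean_eq hst _, ?_⟩, rfl⟩
    rwa [cost_eq_splitCost] at hc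

theorem isClosed_liftedSublevel (a : ℝ) : IsClosed (L.liftedSublevel a) := by
  have hcl : Continuous fun z : Matrix p (q ⊕ Unit) ℝ × Matrix q q ℝ × Matrix q Unit ℝ =>
    L.cl z.1 := continuous_cl.comp continuous_fst
  have hdr : Continuous fun z : Matrix p (q ⊕ Unit) ℝ × Matrix q q ℝ × Matrix q Unit ℝ =>
    L.drift z.1 := continuous_drift.comp continuous_fst
  have hK : Continuous fun z : Matrix p (q ⊕ Unit) ℝ × Matrix q q ℝ × Matrix q Unit ℝ =>
    z.1.toCols₁ := continuous_fst.matrix_submatrix id Sum.inl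
  have hl : Continuous fun z : Matrix p (q ⊕ Unit) ℝ × Matrix q q ℝ × Matrix q Unit ℝ =>
    z.1.toCols₂ := continuous_fst.matrix_submatrix id Sum.inr
  have hS : Continuous fun z : Matrix p (q ⊕ Unit) ℝ × Matrix q q ℝ × Matrix q Unit ℝ =>
    z.2.1 := continuous_fst.comp continuous_snd
  have hx : Continuous fun z : Matrix p (q ⊕ Unit) ℝ × Matrix q q ℝ × Matrix q Unit ℝ =>
    z.2.2 := continuous_snd.comp continuous_snd
  refine IsClosed.inter (isClosed_posSemidef.preimage hS) (IsClosed.inter ?_ (IsClosed.inter ?_ ?_))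
  · exact isClosed_eq hS (((hcl.matrix_mul hS).matrix_mul hcl.matrix_transpose).add
      continuous_const)
  · exact isClosed_eq hx ((hcl.matrix_mul hx).add hdr)
  · suffices h : Continuous fun z : Matrix p (q ⊕ Unit) ℝ × Matrix q q ℝ × Matrix q Unit ℝ =>
        L.splitCost z.1 z.2.1 z.2.2 from isClosed_le h continuous_const
    have hxd : Continuous fun z : Matrix p (q ⊕ Unit) ℝ × Matrix q q ℝ × Matrix q Unit ℝ =>
      z.2.2 - L.δ := hx.sub continuous_const
    have hu : Continuous fun z : Matrix p (q ⊕ Unit) ℝ × Matrix q q ℝ × Matrix q Unit ℝ =>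
      z.1.toCols₁ * z.2.2 + z.1.toCols₂ := (hK.matrix_mul hx).add hl
    unfold splitCost
    refine Continuous.add (Continuous.add (Continuous.add ?_ ?_) ?_) ?_
    · exact (continuous_const.matrix_mul hS).matrix_trace
    · exact (continuous_const.matrix_mul ((hK.matrix_mul hS).matrix_mul
        hK.matrix_transpose)).matrix_trace
    · exact (continuous_const.matrix_mul (hxd.matrix_mul hxd.matrix_transpose)).matrix_trace
    · exact (continuous_const.matrix_mul (hu.matrix_mul hu.matrix_transpose)).matrix_trace

theorem posSemidef_mul_transpose {r s : Type*} [Fintype r] [Fintype s] (X : Matrix r s ℝ) :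
    (X * Xᵀ).PosSemidef := by
  simpa using Matrix.posSemidef_self_mul_conjTranspose X

/-- `Q ≻ 0` bounds `tr S` and `x - δ`; since `S ⪰ W ⪰ cW I`, the term `tr (R K S Kᵀ)` bounds `K`;
finally `R ≻ 0` bounds the mean input `K x + l`, hence `l`. -/
theorem isBounded_liftedSublevel (hQ : L.Q.PosDef) (hR : L.R.PosDef) (hW : L.W.PosDef) (a : ℝ) :
    Bornology.IsBounded (L.liftedSublevel a) := by
  obtain ⟨cQ, hcQ, hQb⟩ := PosDef.exists_mul_trace_le hQ
  obtain ⟨cR, hcR, hRb⟩ := PosDef.exists_mul_trace_le hR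
  obtain ⟨cW, hcW, hWb⟩ := PosDef.exists_sub_smul_one_posSemidef hW
  have key : ∀ z ∈ L.liftedSublevel a, ‖z.2.1‖ ≤ a / cQ ∧ ‖z.2.2 - L.δ‖ ≤ √(a / cQ) ∧
      ‖z.1.toCols₁‖ ≤ √(a / cR / cW) ∧ ‖z.1.toCols₁ * z.2.2 + z.1.toCols₂‖ ≤ √(a / cR) := by
    rintro ⟨θ, S, x⟩ ⟨hS, hSe, -, hc⟩
    simp only at hS hSe hc ⊢
    rw [splitCost] at hc
    set K := θ.toCols₁
    have t1 := hQb S hS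
    have t2 := hRb _ (PosSemidef.mul_mul_transpose hS K)
    have t3 := hQb _ (posSemidef_mul_transpose (x - L.δ))
    have t4 := hRb _ (posSemidef_mul_transpose (K * x + θ.toCols₂))
    have hSW : (S - cW • 1).PosSemidef := by
      have := (sub_posSemidef_of_lyap hS hSe).add hWb
      rwa [sub_add_sub_cancel] at this
    have t5 := PosSemidef.mul_norm_sq_le_trace hSW K
    rw [← norm_sq_eq_trace'] at t3 t4 t5
    have p1 := hS.trace_nonneg
    have p5 : 0 ≤ cW * ‖K‖ ^ 2 := by positivity
    have p2 := p5.trans t5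
    have q1 := mul_nonneg hcQ.le p1
    have q2 := mul_nonneg hcR.le p2
    have q3 : 0 ≤ cQ * ‖x - L.δ‖ ^ 2 := by positivity
    have q4 : 0 ≤ cR * ‖K * x + θ.toCols₂‖ ^ 2 := by positivity
    refine ⟨(PosSemidef.norm_le_trace hS).trans ?_, Real.le_sqrt_of_sq_le ?_,
      Real.le_sqrt_of_sq_le ?_, Real.le_sqrt_of_sq_le ?_⟩
    · rw [le_div_iff₀ hcQ]; linarith
    · rw [le_div_iff₀ hcQ]; linarith
    · rw [le_div_iff₀ hcW, le_div_iff₀ hcR]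
      have := mul_le_mul_of_nonneg_left t5 hcR.le
      linarith
    · rw [le_div_iff₀ hcR]; linarith
  have hδ := norm_nonneg L.δ
  refine isBounded_iff_forall_norm_le.2 ⟨a / cQ + (√(a / cQ) + ‖L.δ‖) + (√(a / cR / cW) +
    (√(a / cR) + √(a / cR / cW) * (√(a / cQ) + ‖L.δ‖))), fun z hz => ?_⟩
  obtain ⟨k1, k2, k3, k4⟩ := key z hz
  have n1 : ‖z.2.2‖ ≤ √(a / cQ) + ‖L.δ‖ := by
    calc ‖z.2.2‖ = ‖(z.2.2 - L.δ) + L.δ‖ := by rw [sub_add_cancel]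
      _ ≤ ‖z.2.2 - L.δ‖ + ‖L.δ‖ := norm_add_le _ _
      _ ≤ _ := by gcongr
  have n2 : ‖z.1.toCols₂‖ ≤ √(a / cR) + √(a / cR / cW) * (√(a / cQ) + ‖L.δ‖) := by
    calc ‖z.1.toCols₂‖ = ‖(z.1.toCols₁ * z.2.2 + z.1.toCols₂) - z.1.toCols₁ * z.2.2‖ := by
          rw [add_sub_cancel_left]
      _ ≤ ‖z.1.toCols₁ * z.2.2 + z.1.toCols₂‖ + ‖z.1.toCols₁ * z.2.2‖ := norm_sub_le _ _
      _ ≤ _ := by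
        gcongr
        refine (frobenius_norm_mul _ _).trans ?_
        gcongr
  have n3 : ‖z.1‖ ≤ ‖z.1.toCols₁‖ + ‖z.1.toCols₂‖ := by
    refine abs_le_of_sq_le_sq' ?_ (by positivity) |>.2
    have : ‖z.1‖ ^ 2 = ‖z.1.toCols₁‖ ^ 2 + ‖z.1.toCols₂‖ ^ 2 := by
      rw [norm_sq_eq_trace', norm_sq_eq_trace', norm_sq_eq_trace', ← Matrix.trace_add]
      conv_lhs => rw [← fromCols_toCols z.1]
      rw [transpose_fromCols, fromCols_mul_fromRows]
    nlinarith [norm_nonneg z.1.toCols₁, norm_nonneg z.1.toCols₂]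
  have g1 := norm_nonneg z.2.1
  have g2 := norm_nonneg z.2.2
  have g3 := norm_nonneg z.1
  rw [Prod.norm_def, Prod.norm_def]
  refine max_le (by linarith) (max_le (by linarith) (by linarith))

theorem isCompact_costSublevel (hQ : L.Q.PosDef) (hR : L.R.PosDef) (hW : L.W.PosDef) (a : ℝ) :
    IsCompact (L.costSublevel a) := by
  have : ProperSpace (Matrix p (q ⊕ Unit) ℝ × Matrix q q ℝ × Matrix q Unit ℝ) :=
    FiniteDimensional.proper ℝ _
  rw [← image_liftedSublevel hW]
  exact (Metric.isCompact_of_isClosed_isBounded (isClosed_liftedSublevel a)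
    (isBounded_liftedSublevel hQ hR hW a)).image continuous_fst

end AffineLQ

namespace AffineLQ

variable {p q : Type*} [Fintype p] [Fintype q] [DecidableEq p] [DecidableEq q]
variable {L : AffineLQ p q}

/-! ### Uniform constants on the sublevel sets -/

theorem costSublevel_subset_stable (a : ℝ) : L.costSublevel a ⊆ L.stable := fun _ h => h.1

theorem exists_norm_bound {E : Type*} [NormedAddCommGroup E] {s : Set (Matrix p (q ⊕ Unit) ℝ)}
    (hs : IsCompact s) {f : Matrix p (q ⊕ Unit) ℝ → E} (hf : ContinuousOn f s) :
    ∃ c : ℝ, 0 ≤ c ∧ ∀ θ ∈ s, ‖f θ‖ ≤ c := by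
  obtain ⟨c, hc⟩ := hs.exists_bound_of_continuousOn hf
  exact ⟨max c 0, le_max_right _ _, fun θ hθ => (hc θ hθ).trans (le_max_left _ _)⟩

/-- Continuity bounds the solution on the compact product of `s` with the unit ball; homogeneity in
`Y` extends the bound to all `Y`. -/
theorem exists_momentSolve_bound {s : Set (Matrix p (q ⊕ Unit) ℝ)} (hs : IsCompact s)
    (hst : s ⊆ L.stable) : ∃ c : ℝ, 0 ≤ c ∧ ∀ θ ∈ s, ∀ Y : Matrix (q ⊕ Unit) (q ⊕ Unit) ℝ,
      ‖momentSolve (L.cl θ) (L.drift θ) Y‖ ≤ c * ‖Y‖ := by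
  have : ProperSpace (Matrix (q ⊕ Unit) (q ⊕ Unit) ℝ) := FiniteDimensional.proper ℝ _
  set k : Set (Matrix p (q ⊕ Unit) ℝ × Matrix (q ⊕ Unit) (q ⊕ Unit) ℝ) :=
    s ×ˢ Metric.closedBall 0 1 with hk
  have hkc : IsCompact k := hs.prod (isCompact_closedBall _ _)
  have hcont : ContinuousOn (fun z : Matrix p (q ⊕ Unit) ℝ × Matrix (q ⊕ Unit) (q ⊕ Unit) ℝ =>
      momentSolve (L.cl z.1) (L.drift z.1) z.2) k := by
    rw [continuousOn_iff_continuous_restrict]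
    refine continuous_momentSolve (X := k) (F := fun z => L.cl z.1.1)
      (b := fun z => L.drift z.1.1) (Y := fun z => z.1.2) ?_ ?_ ?_ (fun z => hst z.2.1)
    · exact continuous_cl.comp (continuous_fst.comp continuous_subtype_val)
    · exact continuous_drift.comp (continuous_fst.comp continuous_subtype_val)
    · exact continuous_snd.comp continuous_subtype_val
  obtain ⟨c, hc⟩ := hkc.exists_bound_of_continuousOn hcont
  refine ⟨max c 0, le_max_right _ _, fun θ hθ Y => ?_⟩
  rcases eq_or_ne Y 0 with rfl | hY
  · have := momentSolve_smul (L.cl θ) (L.drift θ) 0 0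
    rw [zero_smul, zero_smul] at this
    simp [this]
  · have hn : 0 < ‖Y‖ := norm_pos_iff.2 hY
    have h1 := hc (θ, ‖Y‖⁻¹ • Y) ⟨hθ, by
      rw [mem_closedBall_zero_iff, norm_smul, norm_inv, norm_norm, inv_mul_cancel₀ hn.ne']⟩
    simp only [momentSolve_smul, norm_smul, norm_inv, norm_norm] at h1
    rw [inv_mul_le_iff₀ hn] at h1
    calc _ ≤ ‖Y‖ * c := h1
      _ ≤ max c 0 * ‖Y‖ := by rw [mul_comm]; gcongr; exact le_max_left _ _

theorem exists_moment_lipschitz (hW : L.Wᵀ = L.W) {s : Set (Matrix p (q ⊕ Unit) ℝ)}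
    (hs : IsCompact s) (hst : s ⊆ L.stable) :
    ∃ c : ℝ, 0 ≤ c ∧ ∀ θ ∈ s, ∀ θ' ∈ s, ‖L.moment θ' - L.moment θ‖ ≤ c * ‖θ' - θ‖ := by
  obtain ⟨c, hc0, hc⟩ := exists_momentSolve_bound hs hst
  obtain ⟨cm, hcm0, hcm⟩ := exists_norm_bound hs (continuousOn_moment.mono hst)
  obtain ⟨cl, hcl0, hcl⟩ := exists_norm_bound hs (f := L.loop) continuous_loop.continuousOn
  refine ⟨c * (2 * (‖L.augB‖ * cm * cl)), by positivity, fun θ hθ θ' hθ' => ?_⟩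
  have hlt := loop_eq_add (L := L) θ θ'
  set H := θ' - θ
  -- The difference of the two moments solves the moment equation of `θ'` with this forcing, which
  -- is the change of `loop * moment θ * loopᵀ` and is of order `‖H‖`.
  set Y := L.augB * H * L.moment θ * (L.loop θ')ᵀ + L.loop θ * L.moment θ * (L.augB * H)ᵀ with hY
  have hD : L.moment θ' - L.moment θ = momentSolve (L.cl θ') (L.drift θ') Y := by
    refine eq_momentSolve (hst hθ') ?_ ?_ ?_
    · rw [Matrix.transpose_sub, moment_transpose hW (hst hθ), moment_transpose hW (hst hθ')]
    · rw [Matrix.sub_apply, moment_corner, moment_corner, sub_self]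
    · have e1 := moment_eq (hst hθ)
      have e2 := moment_eq (hst hθ')
      change L.moment θ' - L.moment θ = L.loop θ' * (L.moment θ' - L.moment θ) * (L.loop θ')ᵀ + Y
      have e3 : Y = L.loop θ' * L.moment θ * (L.loop θ')ᵀ -
          L.loop θ * L.moment θ * (L.loop θ)ᵀ := by
        rw [hY, hlt]
        simp only [Matrix.transpose_add, Matrix.mul_add, Matrix.add_mul]
        abel
      rw [e3, Matrix.mul_sub, Matrix.sub_mul]
      conv_lhs => rw [e1, e2]
      abel
  have hYn : ‖Y‖ ≤ 2 * (‖L.augB‖ * cm * cl) * ‖H‖ := by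
    have b1 : ‖L.augB * H * L.moment θ * (L.loop θ')ᵀ‖ ≤ ‖L.augB‖ * ‖H‖ * cm * cl := by
      refine (frobenius_norm_mul _ _).trans ?_
      rw [frobenius_norm_transpose]
      gcongr
      · refine (frobenius_norm_mul _ _).trans ?_
        gcongr
        · exact frobenius_norm_mul _ _
        · exact hcm θ hθ
      · exact hcl θ' hθ'
    have b2 : ‖L.loop θ * L.moment θ * (L.augB * H)ᵀ‖ ≤ cl * cm * (‖L.augB‖ * ‖H‖) := by
      refine (frobenius_norm_mul _ _).trans ?_
      rw [frobenius_norm_transpose]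
      gcongr
      · refine (frobenius_norm_mul _ _).trans ?_
        gcongr
        · exact hcl θ hθ
        · exact hcm θ hθ
      · exact frobenius_norm_mul _ _
    refine (norm_add_le _ _).trans ?_
    linarith
  rw [hD]
  calc _ ≤ c * ‖Y‖ := hc θ' hθ' Y
    _ ≤ c * (2 * (‖L.augB‖ * cm * cl) * ‖H‖) := by gcongr
    _ = _ := by ring

/-- The expansion is exact between any two stabilizing policies, so the segment joining them plays
no role. -/
theorem exists_smoothness_const (hQ : L.Q.PosDef) (hR : L.R.PosDef) (hW : L.W.PosDef) (a : ℝ) :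
    ∃ ℓ : ℝ, 0 < ℓ ∧ ∀ θ ∈ L.costSublevel a, ∀ θ' ∈ L.costSublevel a,
      L.cost θ' ≤ L.cost θ + ((matGrad L.cost θ)ᵀ * (θ' - θ)).trace +
        ℓ * ‖θ' - θ‖ ^ 2 / 2 := by
  have hQt := PosSemidef.transpose_eq hQ.posSemidef
  have hRt := PosSemidef.transpose_eq hR.posSemidef
  have hWt := PosSemidef.transpose_eq hW.posSemidef
  have hs := isCompact_costSublevel hQ hR hW a
  have hst := costSublevel_subset_stable (L := L) a
  obtain ⟨c, hc0, hc⟩ := exists_moment_lipschitz hWt hs hst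
  obtain ⟨ce, hce0, hce⟩ := exists_norm_bound hs (continuousOn_adv.mono hst)
  obtain ⟨cm, hcm0, hcm⟩ := exists_norm_bound hs (continuousOn_moment.mono hst)
  obtain ⟨ch, hch0, hch⟩ := exists_norm_bound hs (continuousOn_hess.mono hst)
  -- The factor two compensates the one half in the definition of smoothness; the summand one
  -- ensures positivity.
  refine ⟨2 * (2 * ce * c + ch * cm) + 1, by positivity, fun θ hθ θ' hθ' => ?_⟩
  have h := (abs_le.1 (abs_cost_sub_sub_le hQt hRt hWt (hst hθ) (hst hθ'))).2
  rw [← matGrad_cost hQt hRt hWt (hst hθ)] at h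
  have h2 : 2 * ‖L.adv θ‖ * ‖L.moment θ' - L.moment θ‖ + ‖L.hess θ‖ * ‖L.moment θ'‖ * ‖θ' - θ‖ ≤
      2 * ce * (c * ‖θ' - θ‖) + ch * cm * ‖θ' - θ‖ := by
    have := hce θ hθ
    have := hcm θ' hθ'
    have := hch θ hθ
    have := hc θ hθ θ' hθ'
    gcongr
  have h3 := mul_le_mul_of_nonneg_left h2 (norm_nonneg (θ' - θ))
  nlinarith [sq_nonneg ‖θ' - θ‖]

/-- Completing the square: `tr (G (H + G⁻¹ E) Φ (H + G⁻¹ E)ᵀ) ≥ 0` bounds the difference in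
`cost_eq_add` from below by a quantity independent of `H`. -/
theorem cost_sub_le_trace (hQ : L.Q.PosDef) (hR : L.R.PosDef) (hW : L.W.PosDef)
    {θ θs : Matrix p (q ⊕ Unit) ℝ} (hθ : θ ∈ L.stable) (hθs : θs ∈ L.stable) :
    L.cost θ - L.cost θs ≤
      ((L.adv θ)ᵀ * ((L.hess θ)⁻¹ * L.adv θ * L.moment θs)).trace := by
  have hQt := PosSemidef.transpose_eq hQ.posSemidef
  have hRt := PosSemidef.transpose_eq hR.posSemidef
  have hWt := PosSemidef.transpose_eq hW.posSemidef
  have h := cost_eq_add hQt hRt hWt hθ hθs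
  have hG := hess_posDef hQ.posSemidef hR hθ
  have hGt := PosSemidef.transpose_eq hG.posSemidef
  have hGu : IsUnit (L.hess θ).det := isUnit_iff_ne_zero.2 hG.det_pos.ne'
  have hΦ := moment_posSemidef hW.posSemidef hθs
  have hΦt := PosSemidef.transpose_eq hΦ
  have hZ := PosSemidef.trace_mul_nonneg hG.posSemidef
    (PosSemidef.mul_mul_transpose hΦ ((θs - θ) + (L.hess θ)⁻¹ * L.adv θ))
  generalize L.hess θ = G at *
  generalize L.adv θ = E at *
  generalize L.moment θs = Φ at *
  generalize θs - θ = H at *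
  have hGit : (G⁻¹)ᵀ = G⁻¹ := by rw [Matrix.transpose_nonsing_inv, hGt]
  have e : (G * ((H + G⁻¹ * E) * Φ * (H + G⁻¹ * E)ᵀ)).trace =
      (G * (H * Φ * Hᵀ)).trace + 2 * (Hᵀ * (E * Φ)).trace + (Eᵀ * (G⁻¹ * E * Φ)).trace := by
    have e1 : G * ((H + G⁻¹ * E) * Φ * (H + G⁻¹ * E)ᵀ) =
        G * (H * Φ * Hᵀ) + E * Φ * Hᵀ + G * (H * Φ * (G⁻¹ * E)ᵀ) + E * Φ * (G⁻¹ * E)ᵀ := by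
      have : G * (G⁻¹ * E) = E := by
        rw [← Matrix.mul_assoc, Matrix.mul_nonsing_inv _ hGu, Matrix.one_mul]
      simp only [Matrix.add_mul, Matrix.mul_add, Matrix.transpose_add]
      rw [← Matrix.mul_assoc G (G⁻¹ * E * Φ), ← Matrix.mul_assoc G (G⁻¹ * E) Φ, this,
        ← Matrix.mul_assoc G (G⁻¹ * E * Φ), ← Matrix.mul_assoc G (G⁻¹ * E) Φ, this]
      abel
    have e2 : (E * Φ * Hᵀ).trace = (Hᵀ * (E * Φ)).trace := Matrix.trace_mul_comm _ _
    have e3 : (G * (H * Φ * (G⁻¹ * E)ᵀ)).trace = (Hᵀ * (E * Φ)).trace := by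
      rw [Matrix.transpose_mul, hGit, Matrix.trace_mul_comm, ← Matrix.mul_assoc, Matrix.mul_assoc,
        Matrix.nonsing_inv_mul _ hGu, Matrix.mul_one, ← Matrix.trace_transpose]
      simp only [Matrix.transpose_mul, Matrix.transpose_transpose, hΦt]
      rw [← Matrix.mul_assoc, Matrix.trace_mul_comm]
    have e4 : (E * Φ * (G⁻¹ * E)ᵀ).trace = (Eᵀ * (G⁻¹ * E * Φ)).trace := by
      rw [Matrix.trace_mul_comm, Matrix.transpose_mul, hGit]
      simp only [Matrix.mul_assoc]
    rw [e1, Matrix.trace_add, Matrix.trace_add, Matrix.trace_add, e2, e3, e4]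
    ring
  rw [e] at hZ
  linarith

/-- The bound of `cost_sub_le_trace` is quadratic in `E`, and `E = ½ ∇J Φ⁻¹`. The inverses of `hess`
and `moment` are bounded on the compact sublevel set. -/
theorem exists_gradient_domination_const (hQ : L.Q.PosDef) (hR : L.R.PosDef) (hW : L.W.PosDef)
    (a : ℝ) {θs : Matrix p (q ⊕ Unit) ℝ} (hθs : θs ∈ L.stable) :
    ∃ lam : ℝ, 0 < lam ∧ ∀ θ ∈ L.costSublevel a,
      L.cost θ - L.cost θs ≤ lam * ‖matGrad L.cost θ‖ ^ 2 := by
  have hQt := PosSemidef.transpose_eq hQ.posSemidef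
  have hRt := PosSemidef.transpose_eq hR.posSemidef
  have hWt := PosSemidef.transpose_eq hW.posSemidef
  have hs := isCompact_costSublevel hQ hR hW a
  have hst := costSublevel_subset_stable (L := L) a
  have hG : ContinuousOn (fun θ => (L.hess θ)⁻¹) L.stable :=
    continuousOn_iff_continuous_restrict.2 <| continuous_matrix_inv
      (continuousOn_iff_continuous_restrict.1 continuousOn_hess)
      fun θ => isUnit_iff_ne_zero.2 (hess_posDef hQ.posSemidef hR θ.2).det_pos.ne'
  have hM : ContinuousOn (fun θ => (L.moment θ)⁻¹) L.stable :=
    continuousOn_iff_continuous_restrict.2 <| continuous_matrix_inv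
      (continuousOn_iff_continuous_restrict.1 continuousOn_moment)
      fun θ => isUnit_iff_ne_zero.2 (moment_posDef hW θ.2).det_pos.ne'
  obtain ⟨cg, hcg0, hcg⟩ := exists_norm_bound hs (hG.mono hst)
  obtain ⟨cm, hcm0, hcm⟩ := exists_norm_bound hs (hM.mono hst)
  refine ⟨cg * cm ^ 2 * ‖L.moment θs‖ + 1, by positivity, fun θ hθ => ?_⟩
  have h := cost_sub_le_trace hQ hR hW (hst hθ) hθs
  have h1 := (le_abs_self _).trans
    (abs_trace_transpose_mul_le (L.adv θ) ((L.hess θ)⁻¹ * L.adv θ * L.moment θs))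
  have h2 : ‖(L.hess θ)⁻¹ * L.adv θ * L.moment θs‖ ≤ cg * ‖L.adv θ‖ * ‖L.moment θs‖ := by
    refine (frobenius_norm_mul _ _).trans ?_
    gcongr
    refine (frobenius_norm_mul _ _).trans ?_
    gcongr
    exact hcg θ hθ
  have h3 : ‖L.adv θ‖ ≤ ‖matGrad L.cost θ‖ * cm := by
    have hu : IsUnit (L.moment θ).det :=
      isUnit_iff_ne_zero.2 (moment_posDef hW (hst hθ)).det_pos.ne'
    have e : L.adv θ = L.adv θ * L.moment θ * (L.moment θ)⁻¹ := by
      rw [Matrix.mul_assoc, Matrix.mul_nonsing_inv _ hu, Matrix.mul_one]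
    have e2 : ‖L.adv θ * L.moment θ‖ ≤ ‖matGrad L.cost θ‖ := by
      rw [matGrad_cost hQt hRt hWt (hst hθ), norm_smul, Real.norm_ofNat]
      linarith [norm_nonneg (L.adv θ * L.moment θ)]
    rw [e]
    refine (frobenius_norm_mul _ _).trans ?_
    gcongr
    exact hcm θ hθ
  set g := ‖matGrad L.cost θ‖
  calc L.cost θ - L.cost θs ≤ ‖L.adv θ‖ * (cg * ‖L.adv θ‖ * ‖L.moment θs‖) :=
        h.trans (h1.trans (by gcongr))
    _ ≤ (g * cm) * (cg * (g * cm) * ‖L.moment θs‖) := by gcongr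
    _ = cg * cm ^ 2 * ‖L.moment θs‖ * g ^ 2 := by ring
    _ ≤ _ := by gcongr; linarith

/-! ### The optimal policy -/

theorem exists_adv_eq_zero (hQ : L.Q.PosDef) (hR : L.R.PosDef) (hW : L.W.PosDef)
    (hne : L.stable.Nonempty) : ∃ θ ∈ L.stable, L.adv θ = 0 := by
  have hQt := PosSemidef.transpose_eq hQ.posSemidef
  have hRt := PosSemidef.transpose_eq hR.posSemidef
  have hWt := PosSemidef.transpose_eq hW.posSemidef
  obtain ⟨θ₀, hθ₀⟩ := hne
  obtain ⟨θ, hθ, hmin⟩ := (isCompact_costSublevel hQ hR hW (L.cost θ₀)).exists_isMinOn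
    ⟨θ₀, hθ₀, le_rfl⟩ (continuousOn_cost.mono (costSublevel_subset_stable _))
  refine ⟨θ, hθ.1, ?_⟩
  -- Nearby stabilizing policies outside the sublevel set already cost more than `θ₀`.
  have hloc : IsLocalMin L.cost θ := by
    filter_upwards [isOpen_stable.mem_nhds hθ.1] with θ' hθ'
    by_cases h : L.cost θ' ≤ L.cost θ₀
    · exact hmin ⟨hθ', h⟩
    · exact hθ.2.trans (not_le.1 h).le
  have hz := hloc.hasFDerivAt_eq_zero (hasFDerivAt_cost hQt hRt hWt hθ.1)
  have hz2 : (((2 : ℝ) • (L.adv θ * L.moment θ))ᵀ * (L.adv θ * L.moment θ)).trace = 0 :=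
    congrArg (fun f : Matrix p (q ⊕ Unit) ℝ →L[ℝ] ℝ => f (L.adv θ * L.moment θ)) hz
  simp only [Matrix.transpose_smul, Matrix.smul_mul, Matrix.trace_smul, ← norm_sq_eq_trace, smul_eq_mul] at hz2
  have hz3 : L.adv θ * L.moment θ = 0 := by
    have : ‖L.adv θ * L.moment θ‖ ^ 2 = 0 := by linarith
    exact norm_eq_zero.1 (pow_eq_zero_iff two_ne_zero |>.1 this)
  have hu : IsUnit (L.moment θ).det := isUnit_iff_ne_zero.2 (moment_posDef hW hθ.1).det_pos.ne'
  rw [← Matrix.mul_one (L.adv θ), ← Matrix.mul_nonsing_inv _ hu, ← Matrix.mul_assoc, hz3,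
    Matrix.zero_mul]

omit [DecidableEq p] in
theorem trace_mul_conj_pos {r : Type*} [Fintype r] [DecidableEq r] {G : Matrix p p ℝ}
    {Φ : Matrix r r ℝ} (hG : G.PosDef) (hΦ : Φ.PosDef) {H : Matrix p r ℝ} (hH : H ≠ 0) :
    0 < (G * (H * Φ * Hᵀ)).trace := by
  obtain ⟨c, hc, h⟩ := PosDef.exists_mul_trace_le hG
  obtain ⟨d, hd, h'⟩ := PosDef.exists_sub_smul_one_posSemidef hΦ
  have h1 := h _ (PosSemidef.mul_mul_transpose hΦ.posSemidef H)
  have h2 := PosSemidef.mul_norm_sq_le_trace h' H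
  rw [← norm_sq_eq_trace'] at h2
  have h3 : 0 < ‖H‖ := norm_pos_iff.2 hH
  have h4 : 0 < c * (d * ‖H‖ ^ 2) := by positivity
  exact h4.trans_le ((mul_le_mul_of_nonneg_left h2 hc.le).trans h1)

/-- Only the quadratic term of `cost_eq_add` survives, and it is positive: a stationary policy is a
strict global minimizer although the problem need not be convex in `θ`. -/
theorem cost_lt_of_adv_eq_zero (hQ : L.Q.PosDef) (hR : L.R.PosDef) (hW : L.W.PosDef)
    {θ θ' : Matrix p (q ⊕ Unit) ℝ} (hθ : θ ∈ L.stable) (h0 : L.adv θ = 0)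
    (hθ' : θ' ∈ L.stable) (hne : θ' ≠ θ) : L.cost θ < L.cost θ' := by
  rw [cost_eq_add (PosSemidef.transpose_eq hQ.posSemidef) (PosSemidef.transpose_eq hR.posSemidef)
    (PosSemidef.transpose_eq hW.posSemidef) hθ hθ', h0, Matrix.zero_mul, Matrix.mul_zero,
    Matrix.trace_zero, mul_zero, add_zero]
  linarith [trace_mul_conj_pos (hess_posDef hQ.posSemidef hR hθ) (moment_posDef hW hθ')
    (sub_ne_zero.2 hne)]

/-! ### The Riccati equation -/

variable (L) in
/-- Positive semidefinite solutions of the discrete-time algebraic Riccati equation. -/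
def IsRiccati (P : Matrix q q ℝ) : Prop :=
  P.PosSemidef ∧ P = L.Aᵀ * P * L.A + L.Q -
    L.Aᵀ * P * L.B * (L.Bᵀ * P * L.B + L.R)⁻¹ * L.Bᵀ * P * L.A

variable (L) in
/-- The gain associated with a solution of the Riccati equation. -/
def riccatiGain (P : Matrix q q ℝ) : Matrix p q ℝ :=
  -((L.Bᵀ * P * L.B + L.R)⁻¹ * L.Bᵀ * P * L.A)

variable (L) in
/-- The policy associated with a solution of the Riccati equation. -/
def riccatiPolicy (P : Matrix q q ℝ) : Matrix p (q ⊕ Unit) ℝ :=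
  fromCols (L.riccatiGain P) ((L.Bᵀ * P * L.B + L.R)⁻¹ * L.Bᵀ *
    ((1 - L.A - L.B * L.riccatiGain P)⁻¹)ᵀ * L.Q * L.δ)

/-- At the gain that minimizes the quadratic form, the closed-loop Lyapunov expression collapses to
the Riccati expression. It is used in both directions below. -/
theorem quad_eq_of_gain_eq {P : Matrix q q ℝ} (hPt : Pᵀ = P) (hGt : L.Rᵀ = L.R) {K : Matrix p q ℝ}
    (hK : (L.Bᵀ * P * L.B + L.R) * K = -(L.Bᵀ * P * L.A)) :
    (L.A + L.B * K)ᵀ * P * (L.A + L.B * K) + (L.Q + Kᵀ * L.R * K) =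
      L.Aᵀ * P * L.A + L.Q + L.Aᵀ * P * L.B * K := by
  have h1 : (L.A + L.B * K)ᵀ * P * (L.A + L.B * K) + (L.Q + Kᵀ * L.R * K) =
      L.Aᵀ * P * L.A + L.Q + L.Aᵀ * P * L.B * K +
        Kᵀ * (L.Bᵀ * P * L.A + (L.Bᵀ * P * L.B + L.R) * K) := by
    simp only [Matrix.transpose_add, Matrix.transpose_mul, Matrix.mul_add, Matrix.add_mul,
      Matrix.mul_assoc]
    abel
  rw [h1, hK, add_neg_cancel, Matrix.mul_zero, add_zero]

theorem riccatiMatrix_posDef (hR : L.R.PosDef) {P : Matrix q q ℝ} (hP : P.PosSemidef) :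
    (L.Bᵀ * P * L.B + L.R).PosDef :=
  Matrix.PosDef.posSemidef_add (PosSemidef.transpose_mul_mul hP _) hR

theorem riccatiGain_eq (hR : L.R.PosDef) {P : Matrix q q ℝ} (hP : P.PosSemidef) :
    (L.Bᵀ * P * L.B + L.R) * L.riccatiGain P = -(L.Bᵀ * P * L.A) := by
  have hu := isUnit_iff_ne_zero.2 (riccatiMatrix_posDef hR hP).det_pos.ne'
  rw [riccatiGain, Matrix.mul_neg, Matrix.mul_assoc _ _ P, Matrix.mul_assoc _ _ L.A,
    ← Matrix.mul_assoc _ (_)⁻¹, Matrix.mul_nonsing_inv _ hu, Matrix.one_mul]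

theorem adv_eq_fromCols (θ : Matrix p (q ⊕ Unit) ℝ) :
    L.adv θ = fromCols
      (L.R * θ.toCols₁ + L.Bᵀ * (L.value θ).toBlocks₁₁ * L.cl θ)
      (L.R * θ.toCols₂ + (L.Bᵀ * (L.value θ).toBlocks₁₁ * L.drift θ +
        L.Bᵀ * (L.value θ).toBlocks₁₂)) := by
  rw [adv]
  conv_lhs => rw [← fromBlocks_toBlocks (L.value θ)]
  conv_lhs => enter [1]; rw [← fromCols_toCols θ]
  rw [augB, transpose_fromRows, Matrix.transpose_zero, fromCols_mul_fromBlocks, loop, augLoop,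
    fromCols_mul_fromBlocks, Matrix.mul_fromCols]
  ext i (j | j) <;> simp

/-- This supplies existence. The gain block of `adv θ = 0` says that `K` is the Riccati gain of the
value block `P`, and the Lyapunov equation of `P` then becomes the Riccati equation. -/
theorem isRiccati_of_adv_eq_zero (hQ : L.Q.PosDef) (hR : L.R.PosDef)
    {θ : Matrix p (q ⊕ Unit) ℝ} (hθ : θ ∈ L.stable) (h0 : L.adv θ = 0) :
    L.IsRiccati (L.value θ).toBlocks₁₁ := by
  have hF := specRad_cl_transpose hθ
  have hRt := PosSemidef.transpose_eq hR.posSemidef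
  have hPe := lyap_eq hF (L.Q + θ.toCols₁ᵀ * L.R * θ.toCols₁)
  have hP : (L.value θ).toBlocks₁₁.PosSemidef := by
    rw [value_toBlocks₁₁]
    exact lyap_posSemidef hF (hQ.posSemidef.add (PosSemidef.transpose_mul_mul hR.posSemidef _))
  rw [← value_toBlocks₁₁, Matrix.transpose_transpose] at hPe
  have h1 : L.R * θ.toCols₁ + L.Bᵀ * (L.value θ).toBlocks₁₁ * L.cl θ = 0 := by
    have := congrArg Matrix.toCols₁ h0
    rw [adv_eq_fromCols, toCols₁_fromCols] at this
    rw [this]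
    rfl
  set P := (L.value θ).toBlocks₁₁
  have hu := isUnit_iff_ne_zero.2 (riccatiMatrix_posDef hR hP).det_pos.ne'
  have hK : (L.Bᵀ * P * L.B + L.R) * θ.toCols₁ = -(L.Bᵀ * P * L.A) := by
    rw [eq_neg_iff_add_eq_zero, ← h1, cl]
    simp only [Matrix.mul_add, Matrix.add_mul, Matrix.mul_assoc]
    abel
  refine ⟨hP, ?_⟩
  have hKe : θ.toCols₁ = -((L.Bᵀ * P * L.B + L.R)⁻¹ * (L.Bᵀ * P * L.A)) := by
    rw [← Matrix.mul_neg, ← hK, ← Matrix.mul_assoc, Matrix.nonsing_inv_mul _ hu, Matrix.one_mul]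
  have hq := quad_eq_of_gain_eq (PosSemidef.transpose_eq hP) hRt hK
  have : P = L.Aᵀ * P * L.A + L.Q + L.Aᵀ * P * L.B * θ.toCols₁ := by
    rw [← hq]
    exact hPe
  rw [hKe] at this
  conv_lhs => rw [this]
  rw [Matrix.mul_neg, ← sub_eq_add_neg]
  simp only [Matrix.mul_assoc]

/-- Read as a Lyapunov equation with positive definite forcing, the Riccati equation makes `P` a
stability certificate, and uniqueness identifies `P` with the value block. The gain and the offset
are exactly the solutions of the two blocks of `adv = 0`. -/
theorem riccatiPolicy_spec (hQ : L.Q.PosDef) (hR : L.R.PosDef) {P : Matrix q q ℝ}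
    (hP : L.IsRiccati P) : L.riccatiPolicy P ∈ L.stable ∧
      (L.value (L.riccatiPolicy P)).toBlocks₁₁ = P ∧ L.adv (L.riccatiPolicy P) = 0 := by
  obtain ⟨hPs, hPe⟩ := hP
  have hRt := PosSemidef.transpose_eq hR.posSemidef
  have hPt := PosSemidef.transpose_eq hPs
  have hGK := riccatiGain_eq hR hPs
  have hu := isUnit_iff_ne_zero.2 (riccatiMatrix_posDef hR hPs).det_pos.ne'
  have hθ1 : (L.riccatiPolicy P).toCols₁ = L.riccatiGain P := toCols₁_fromCols _ _
  have hθ2 := toCols₂_fromCols (L.riccatiGain P) ((L.Bᵀ * P * L.B + L.R)⁻¹ * L.Bᵀ *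
    ((1 - L.A - L.B * L.riccatiGain P)⁻¹)ᵀ * L.Q * L.δ)
  change (L.riccatiPolicy P).toCols₂ = _ at hθ2
  have hcl : L.cl (L.riccatiPolicy P) = L.A + L.B * L.riccatiGain P := by rw [cl, hθ1]
  have hquad := quad_eq_of_gain_eq hPt hRt hGK
  have hlyap : P = (L.cl (L.riccatiPolicy P))ᵀ * P * L.cl (L.riccatiPolicy P) +
      (L.Q + (L.riccatiGain P)ᵀ * L.R * L.riccatiGain P) := by
    rw [hcl, hquad]
    conv_lhs => rw [hPe]
    rw [riccatiGain, Matrix.mul_neg, ← sub_eq_add_neg]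
    simp only [Matrix.mul_assoc]
  have hC : (L.Q + (L.riccatiGain P)ᵀ * L.R * L.riccatiGain P).PosDef :=
    hQ.add_posSemidef (PosSemidef.transpose_mul_mul hR.posSemidef _)
  have hstT : specRad (L.cl (L.riccatiPolicy P))ᵀ < 1 := by
    refine specRad_lt_one_of_posDef hPs ?_
    rw [Matrix.transpose_transpose]
    have := sub_eq_iff_eq_add'.2 hlyap
    rwa [this]
  have hst : L.riccatiPolicy P ∈ L.stable := by
    rw [specRad_transpose] at hstT
    exact hstT
  have hval : (L.value (L.riccatiPolicy P)).toBlocks₁₁ = P := by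
    rw [value_toBlocks₁₁, hθ1]
    symm
    refine (eq_lyap_iff hstT).2 ?_
    rw [Matrix.transpose_transpose]
    exact hlyap
  refine ⟨hst, hval, ?_⟩
  have hfirst : L.R * L.riccatiGain P + L.Bᵀ * P * L.cl (L.riccatiPolicy P) = 0 := by
    rw [hcl, ← add_neg_cancel (L.Bᵀ * P * L.A), ← hGK]
    simp only [Matrix.mul_add, Matrix.add_mul, Matrix.mul_assoc]
    abel
  have hstage : (L.stage (L.riccatiPolicy P)).toBlocks₁₂ =
      -(L.Q * L.δ) + (L.riccatiGain P)ᵀ * L.R * (L.riccatiPolicy P).toCols₂ := by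
    rw [stage, ← hθ1]
    conv_lhs => rw [← fromCols_toCols (L.riccatiPolicy P)]
    rw [err, transpose_fromCols, transpose_fromCols, fromRows_mul,
      fromRows_mul_fromCols, fromRows_mul, fromRows_mul_fromCols, fromBlocks_add, toBlocks_fromBlocks₁₂]
    simp
  have hr : (L.value (L.riccatiPolicy P)).toBlocks₁₂ =
      -((1 - (L.cl (L.riccatiPolicy P))ᵀ)⁻¹ * (L.Q * L.δ)) := by
    have e : (L.value (L.riccatiPolicy P)).toBlocks₁₂ = (1 - (L.cl (L.riccatiPolicy P))ᵀ)⁻¹ *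
      ((L.stage (L.riccatiPolicy P)).toBlocks₁₂ + (L.cl (L.riccatiPolicy P))ᵀ *
        (L.value (L.riccatiPolicy P)).toBlocks₁₁ * L.drift (L.riccatiPolicy P)) := rfl
    rw [e, hval, hstage, ← Matrix.mul_neg (1 - (L.cl (L.riccatiPolicy P))ᵀ)⁻¹]
    congr 1
    -- The transposed first-order condition for the gain cancels every term containing the offset,
    -- so the mixed value block depends only on `Q δ`.
    have hz : (L.riccatiGain P)ᵀ * L.R + (L.cl (L.riccatiPolicy P))ᵀ * P * L.B = 0 := by
      have := congrArg Matrix.transpose hfirst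
      simpa [Matrix.transpose_mul, hRt, hPt, Matrix.mul_assoc] using this
    have hz2 := congrArg (fun Z => Z * (L.riccatiPolicy P).toCols₂) hz
    simp only [Matrix.add_mul, Matrix.zero_mul] at hz2
    rw [drift, ← Matrix.mul_assoc, add_assoc, hz2, add_zero]
  rw [adv_eq_fromCols, hval, hr, hθ1, hfirst]
  have hsecond : (L.Bᵀ * P * L.B + L.R) * (L.riccatiPolicy P).toCols₂ =
      L.Bᵀ * ((1 - (L.cl (L.riccatiPolicy P))ᵀ)⁻¹ * (L.Q * L.δ)) := by
    rw [hθ2, hcl, Matrix.transpose_nonsing_inv, sub_sub, Matrix.transpose_sub,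
      Matrix.transpose_one]
    simp only [← Matrix.mul_assoc]
    rw [Matrix.mul_nonsing_inv _ hu, Matrix.one_mul]
  have hz : L.R * (L.riccatiPolicy P).toCols₂ + (L.Bᵀ * P * L.drift (L.riccatiPolicy P) +
      L.Bᵀ * -((1 - (L.cl (L.riccatiPolicy P))ᵀ)⁻¹ * (L.Q * L.δ))) = 0 := by
    rw [Matrix.mul_neg, ← hsecond, drift, Matrix.add_mul]
    simp only [Matrix.mul_assoc]
    abel
  rw [hz]
  ext i (j | j) <;> rfl

/-- Two distinct Riccati policies would each be strictly cheaper than the other, and the policy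
determines `P` as its value block. -/
theorem isRiccati_unique (hQ : L.Q.PosDef) (hR : L.R.PosDef) (hW : L.W.PosDef)
    {P P' : Matrix q q ℝ} (hP : L.IsRiccati P) (hP' : L.IsRiccati P') : P' = P := by
  obtain ⟨h1, h2, h3⟩ := riccatiPolicy_spec hQ hR hP
  obtain ⟨h1', h2', h3'⟩ := riccatiPolicy_spec hQ hR hP'
  have : L.riccatiPolicy P' = L.riccatiPolicy P := by
    by_contra hne
    have ha := cost_lt_of_adv_eq_zero hQ hR hW h1 h3 h1' hne
    have hb := cost_lt_of_adv_eq_zero hQ hR hW h1' h3' h1 (Ne.symm hne)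
    exact lt_asymm ha hb
  rw [← h2, ← h2', this]

end AffineLQ

/-! ### Long-run averages of the second moments -/

/-- If the partial sums stayed below `N (J + c/2)`, then `v N`, and with it `g N`, would grow at
least linearly; summing `g` over `[N, 2N)` would give quadratic growth, contradicting the linear
bound at `2N`. -/
theorem not_eventually_sum_le_of_growth {g v : ℕ → ℝ} {J c e K : ℝ} (hc : 0 < c) (hK : 0 < K)
    (hg : ∀ t, 0 ≤ g t)
    (hs : ∀ N : ℕ, (N : ℝ) * (J + c) + e ≤ ∑ t ∈ Finset.range N, g t + v N)
    (hv : ∀ N, v N ≤ K * (g N + 1)) :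
    ¬ ∀ᶠ N : ℕ in atTop, ∑ t ∈ Finset.range N, g t ≤ (N : ℝ) * (J + c / 2) := by
  intro hev
  obtain ⟨N₀, hN₀⟩ := eventually_atTop.1 hev
  have hlow : ∀ N ≥ N₀, (N : ℝ) * (c / 2) + e ≤ K * (g N + 1) := fun N hN => by
    linarith [hs N, hv N, hN₀ N hN]
  have hdouble : ∀ N ≥ N₀, (N : ℝ) * ((N : ℝ) * (c / 2) + e - K) ≤
      K * ((2 * N : ℕ) * (J + c / 2)) := fun N hN => by
    have h1 : ∑ t ∈ Finset.Ico N (2 * N), g t ≤ ∑ t ∈ Finset.range (2 * N), g t :=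
      Finset.sum_le_sum_of_subset_of_nonneg
        (fun t ht => Finset.mem_range.2 (Finset.mem_Ico.1 ht).2) fun t _ _ => hg t
    have h2 : ∑ t ∈ Finset.Ico N (2 * N), (((N : ℝ) * (c / 2) + e - K) / K) ≤
        ∑ t ∈ Finset.Ico N (2 * N), g t := by
      refine Finset.sum_le_sum fun t ht => ?_
      have htN := (Finset.mem_Ico.1 ht).1
      have := hlow t (hN.trans htN)
      have h3 : (N : ℝ) ≤ t := by exact_mod_cast htN
      rw [div_le_iff₀ hK]
      nlinarith
    rw [Finset.sum_const, Nat.card_Ico, nsmul_eq_mul, show 2 * N - N = N by omega] at h2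
    have h4 := hN₀ (2 * N) (by omega)
    have h5 := mul_le_mul_of_nonneg_left (h2.trans (h1.trans h4)) hK.le
    calc _ = K * (N * (((N : ℝ) * (c / 2) + e - K) / K)) := by field_simp
      _ ≤ _ := h5
  have hlim : Tendsto (fun N : ℕ => (N : ℝ) * (c / 2) + e - K) atTop atTop := by
    have := (tendsto_natCast_atTop_atTop (R := ℝ)).atTop_mul_const (half_pos hc)
    simpa [add_sub_assoc] using tendsto_atTop_add_const_right _ (e - K) this
  obtain ⟨N, hN1, hN2, hN3⟩ := ((hlim.eventually_gt_atTop (K * (2 * (J + c / 2)))).and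
    ((eventually_ge_atTop N₀).and (eventually_gt_atTop 0))).exists
  have hN : (0 : ℝ) < N := by exact_mod_cast hN3
  have h := hdouble N hN2
  push_cast at h
  have h6 := mul_lt_mul_of_pos_left hN1 hN
  nlinarith

namespace AffineLQ

variable {p q : Type*} [Fintype p] [Fintype q] [DecidableEq p] [DecidableEq q]

/-- The long-run average cost of `θ`, started at the second moment `Φ` of `[x; 1]`. -/
def average (L : AffineLQ p q) (θ : Matrix p (q ⊕ Unit) ℝ)
    (Φ : Matrix (q ⊕ Unit) (q ⊕ Unit) ℝ) : ℝ≥0∞ :=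
  limsup (fun N : ℕ => ENNReal.ofReal (∑ t ∈ Finset.range N,
    (L.stage θ * momentSeq (L.cl θ) (L.drift θ) L.W Φ t).trace) / (N : ℝ≥0∞)) atTop

variable {L : AffineLQ p q}

theorem cost_nonneg (hQ : L.Q.PosSemidef) (hR : L.R.PosSemidef) (hW : L.W.PosSemidef)
    {θ : Matrix p (q ⊕ Unit) ℝ} (hθ : θ ∈ L.stable) : 0 ≤ L.cost θ :=
  PosSemidef.trace_mul_nonneg (stage_posSemidef hQ hR θ) (moment_posSemidef hW hθ)

theorem average_of_stable {θ : Matrix p (q ⊕ Unit) ℝ} (hθ : θ ∈ L.stable)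
    {Φ : Matrix (q ⊕ Unit) (q ⊕ Unit) ℝ} (hΦ : Φ (Sum.inr ()) (Sum.inr ()) = 1) :
    L.average θ Φ = ENNReal.ofReal (L.cost θ) := by
  have hc : Continuous fun Z : Matrix (q ⊕ Unit) (q ⊕ Unit) ℝ => (L.stage θ * Z).trace := by
    fun_prop
  have h := ((hc.tendsto _).comp (tendsto_momentSeq hθ (L.drift θ) L.W hΦ)).cesaro
  refine Tendsto.limsup_eq ?_
  refine (ENNReal.tendsto_ofReal h).congr' ?_
  filter_upwards [eventually_gt_atTop 0] with N hN
  rw [← ENNReal.ofReal_natCast, ← ENNReal.ofReal_div_of_pos (by exact_mod_cast hN), div_eq_inv_mul]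
  rfl

/-- If the gain part of `H` is nonzero, the noise injected in the last step excites it; if only the
offset part is nonzero, the corner `1` does. The initial moment may be degenerate, hence the shift
to `t + 1`. -/
theorem trace_hess_mul_moment_lower {G : Matrix p p ℝ} (hG : G.PosDef) {W : Matrix q q ℝ}
    (hW : W.PosDef) {H : Matrix p (q ⊕ Unit) ℝ} (hH : H ≠ 0) (F : Matrix q q ℝ)
    (b : Matrix q Unit ℝ) {Φ : Matrix (q ⊕ Unit) (q ⊕ Unit) ℝ} (hΦ : Φ.PosSemidef)
    (h1 : Φ (Sum.inr ()) (Sum.inr ()) = 1) :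
    ∃ c : ℝ, 0 < c ∧
      ∀ t, c ≤ (G * (H * momentSeq F b W Φ (t + 1) * Hᵀ)).trace := by
  by_cases h0 : H.toCols₁ = 0
  · have h2 : H.toCols₂ ≠ 0 := fun h2 => hH (by
      rw [← fromCols_toCols H, h0, h2]
      ext i (j | j) <;> rfl)
    refine ⟨_, trace_mul_conj_pos hG (Matrix.PosDef.one (n := Unit)) h2, fun t => le_of_eq ?_⟩
    congr 2
    have hcorner := momentSeq_corner (F := F) (b := b) (W := W) h1 (t + 1)
    generalize momentSeq F b W Φ (t + 1) = Ψ at hcorner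
    have hH0 : ∀ i j, H i (Sum.inl j) = 0 := fun i j => congrFun (congrFun h0 i) j
    ext i j
    simp [Matrix.mul_apply, hcorner, hH0, Matrix.toCols₂]
  · refine ⟨_, trace_mul_conj_pos hG hW h0, fun t => ?_⟩
    have e : H * augNoise W * Hᵀ = H.toCols₁ * W * H.toCols₁ᵀ := by
      conv_lhs => rw [← fromCols_toCols H]
      rw [augNoise, fromCols_mul_fromBlocks, transpose_fromCols, fromCols_mul_fromRows]
      simp
    have hp := PosSemidef.trace_mul_nonneg hG.posSemidef (PosSemidef.mul_mul_transpose
      (PosSemidef.mul_mul_transpose (momentSeq_posSemidef (F := F) (b := b) hW.posSemidef hΦ t)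
        (augLoop F b)) H)
    rw [momentSeq, Matrix.mul_add, Matrix.add_mul, Matrix.mul_add, Matrix.trace_add, e]
    linarith

/-- The tracking error fails to see exactly the direction `[δ; 1]`. Adding the corner projector
makes the weight positive definite and costs the constant `1`. -/
theorem exists_trace_le_stage (hQ : L.Q.PosDef) (hR : L.R.PosSemidef) (θ : Matrix p (q ⊕ Unit) ℝ) :
    ∃ κ : ℝ, 0 < κ ∧ ∀ Ψ : Matrix (q ⊕ Unit) (q ⊕ Unit) ℝ, Ψ.PosSemidef →
      Ψ (Sum.inr ()) (Sum.inr ()) = 1 → κ * Ψ.trace ≤ (L.stage θ * Ψ).trace + 1 := by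
  have hE : (fromBlocks 0 0 0 1 : Matrix (q ⊕ Unit) (q ⊕ Unit) ℝ).PosSemidef := by
    have := posSemidef_mul_transpose (fromRows 0 1 : Matrix (q ⊕ Unit) Unit ℝ)
    rw [transpose_fromRows, fromRows_mul_fromCols] at this
    simpa using this
  have hpd : (L.errᵀ * L.Q * L.err + fromBlocks 0 0 0 1).PosDef := by
    have hs := PosSemidef.transpose_mul_mul hQ.posSemidef L.err
    refine posDef_of_quad (PosSemidef.transpose_eq (hs.add hE)) fun z hz => ?_
    have e1 : z ⬝ᵥ ((L.errᵀ * L.Q * L.err) *ᵥ z) = (L.err *ᵥ z) ⬝ᵥ (L.Q *ᵥ (L.err *ᵥ z)) := by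
      rw [← Matrix.mulVec_mulVec, ← Matrix.mulVec_mulVec, Matrix.dotProduct_mulVec,
        Matrix.vecMul_transpose]
    have e2 : z ⬝ᵥ ((fromBlocks 0 0 0 1 : Matrix (q ⊕ Unit) (q ⊕ Unit) ℝ) *ᵥ z) =
        z (Sum.inr ()) ^ 2 := by
      simp [Matrix.mulVec, dotProduct, sq]
    rw [Matrix.add_mulVec, dotProduct_add, e1, e2]
    by_cases h0 : z (Sum.inr ()) = 0
    · have : L.err *ᵥ z ≠ 0 := fun h => hz (by
        funext i
        rcases i with i | i
        · have := congrFun h i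
          simpa [err, Matrix.mulVec, dotProduct, h0, Matrix.one_apply] using this
        · exact h0)
      rw [h0]
      linarith [PosDef.quad_pos hQ this]
    · have := PosSemidef.quad_nonneg hQ.posSemidef (L.err *ᵥ z)
      positivity
  obtain ⟨κ, hκ, h⟩ := PosDef.exists_mul_trace_le hpd
  refine ⟨κ, hκ, fun Ψ hΨ h1 => (h Ψ hΨ).trans ?_⟩
  have h2 := PosSemidef.trace_mul_nonneg (PosSemidef.transpose_mul_mul hR θ) hΨ
  have h3 := trace_mul_of_corner (D := fromBlocks 0 0 0 1) rfl h1
  rw [Matrix.one_apply_eq] at h3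
  rw [stage, Matrix.add_mul, Matrix.trace_add, h3, Matrix.add_mul, Matrix.trace_add]
  linarith

/-- Optimality among all policies. Along the actual moments of `θ'`, `trace_stage_add` says that
stage cost plus increment of the value equals `cost θ + d t`, with `d` bounded below by `c` after
time zero. The value term may be unbounded, but it is at most a multiple of the current stage cost
plus one, as `not_eventually_sum_le_of_growth` requires. -/
theorem lt_average_of_adv_eq_zero (hQ : L.Q.PosDef) (hR : L.R.PosDef) (hW : L.W.PosDef)
    {θ θ' : Matrix p (q ⊕ Unit) ℝ} (hθ : θ ∈ L.stable) (h0 : L.adv θ = 0) (hne : θ' ≠ θ)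
    {Φ : Matrix (q ⊕ Unit) (q ⊕ Unit) ℝ} (hΦ : Φ.PosSemidef)
    (h1 : Φ (Sum.inr ()) (Sum.inr ()) = 1) :
    ENNReal.ofReal (L.cost θ) < L.average θ' Φ := by
  set Ψ := momentSeq (L.cl θ') (L.drift θ') L.W Φ with hΨdef
  have hΨ : ∀ t, (Ψ t).PosSemidef := momentSeq_posSemidef hW.posSemidef hΦ
  have hΨ1 : ∀ t, Ψ t (Sum.inr ()) (Sum.inr ()) = 1 := momentSeq_corner h1
  have hG := hess_posDef hQ.posSemidef hR hθ
  obtain ⟨c, hc, hlow⟩ := trace_hess_mul_moment_lower hG hW (sub_ne_zero.2 hne) (L.cl θ')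
    (L.drift θ') hΦ h1
  obtain ⟨κ, hκ, htr⟩ := exists_trace_le_stage hQ hR.posSemidef θ'
  set g : ℕ → ℝ := fun t => (L.stage θ' * Ψ t).trace with hg
  set v : ℕ → ℝ := fun t => (L.value θ * Ψ t).trace with hv
  set d : ℕ → ℝ := fun t => (L.hess θ * ((θ' - θ) * Ψ t * (θ' - θ)ᵀ)).trace with hd
  have hd0 : ∀ t, 0 ≤ d t := fun t =>
    PosSemidef.trace_mul_nonneg hG.posSemidef (PosSemidef.mul_mul_transpose (hΨ t) _)
  have hstep : ∀ t, g t + v (t + 1) - v t = L.cost θ + d t := fun t => by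
    have := trace_stage_add (PosSemidef.transpose_eq hQ.posSemidef)
      (PosSemidef.transpose_eq hR.posSemidef) (PosSemidef.transpose_eq hW.posSemidef) hθ θ'
      (PosSemidef.transpose_eq (hΨ t)) (hΨ1 t)
    rw [h0, Matrix.zero_mul, Matrix.mul_zero, Matrix.trace_zero, mul_zero, add_zero] at this
    exact this
  -- At time zero only `d 0 ≥ 0` is known, so one `c` is lost.
  have hsum : ∀ N : ℕ, (N : ℝ) * (L.cost θ + c) + (v 0 - c) ≤
      ∑ t ∈ Finset.range N, g t + v N := fun N => by
    have : ∀ N : ℕ, (N : ℝ) * (L.cost θ + c) + v 0 + d 0 ≤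
        ∑ t ∈ Finset.range (N + 1), g t + v (N + 1) - L.cost θ := fun N => by
      induction N with
      | zero =>
        have := hstep 0
        simp
        linarith
      | succ N ih =>
        have h2 := hstep (N + 1)
        have h3 : c ≤ d (N + 1) := hlow N
        rw [Finset.sum_range_succ]
        push_cast
        linarith
    rcases N with _ | N
    · simp [hc.le]
    · have h4 := this N
      have h5 := hd0 0
      push_cast
      linarith
  have hvK : ∀ N, v N ≤ (‖L.value θ‖ + 1) / κ * (g N + 1) := fun N => by
    have b1 := (le_abs_self _).trans (abs_trace_transpose_mul_le (L.value θ)ᵀ (Ψ N))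
    rw [Matrix.transpose_transpose, frobenius_norm_transpose] at b1
    have b2 := PosSemidef.norm_le_trace (hΨ N)
    have b3 := htr _ (hΨ N) (hΨ1 N)
    have b4 : (Ψ N).trace ≤ (g N + 1) / κ := by rw [le_div_iff₀ hκ]; linarith
    have b5 := (hΨ N).trace_nonneg
    calc v N ≤ ‖L.value θ‖ * ‖Ψ N‖ := b1
      _ ≤ (‖L.value θ‖ + 1) * ((g N + 1) / κ) := by
        gcongr
        · linarith
        · exact b2.trans b4
      _ = _ := by ring
  have hg0 : ∀ t, 0 ≤ g t := fun t =>
    PosSemidef.trace_mul_nonneg (stage_posSemidef hQ.posSemidef hR.posSemidef θ') (hΨ t)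
  have hJ0 := cost_nonneg hQ.posSemidef hR.posSemidef hW.posSemidef hθ
  by_contra hcon
  refine not_eventually_sum_le_of_growth hc (by positivity) hg0 hsum hvK ?_
  have hlt : L.average θ' Φ < ENNReal.ofReal (L.cost θ + c / 2) :=
    (not_lt.1 hcon).trans_lt ((ENNReal.ofReal_lt_ofReal_iff (by linarith)).2 (by linarith))
  filter_upwards [eventually_lt_of_limsup_lt hlt, eventually_gt_atTop 0] with N hN hN0
  have hNr : (0 : ℝ) < N := by exact_mod_cast hN0
  rw [← ENNReal.ofReal_natCast, ← ENNReal.ofReal_div_of_pos hNr,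
    ENNReal.ofReal_lt_ofReal_iff (by linarith), div_lt_iff₀ hNr] at hN
  rw [mul_comm]
  exact hN.le

end AffineLQ

/-! ### Second moments of linear recursions driven by white noise -/

section WhiteNoise

variable {Ω : Type*} [MeasurableSpace Ω] {μ : Measure Ω} {d : Type*} [Fintype d]

/-- The matrix of the moments `E[X i * Y j]`. -/
def crossMoment (μ : Measure Ω) (X Y : Ω → d → ℝ) : Matrix d d ℝ :=
  Matrix.of fun i j => ∫ ω, X ω i * Y ω j ∂μ

theorem crossMoment_transpose (X Y : Ω → d → ℝ) :
    (crossMoment μ X Y)ᵀ = crossMoment μ Y X := by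
  ext i j
  simp [crossMoment, mul_comm]

theorem crossMoment_mulVec_add (L : Matrix d d ℝ) {X Y E Z : Ω → d → ℝ}
    (hZ : ∀ ω, Z ω = L *ᵥ X ω + E ω)
    (hX : ∀ i, MemLp (fun ω => X ω i) 2 μ) (hE : ∀ i, MemLp (fun ω => E ω i) 2 μ)
    (hY : ∀ i, MemLp (fun ω => Y ω i) 2 μ) :
    crossMoment μ Z Y = L * crossMoment μ X Y + crossMoment μ E Y := by
  ext i j
  have hi : ∀ k, Integrable (fun ω => L i k * (X ω k * Y ω j)) μ := fun k =>
    ((hX k).integrable_mul (hY j)).const_mul (L i k)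
  have hEY : Integrable (fun ω => E ω i * Y ω j) μ := (hE i).integrable_mul (hY j)
  have e1 : ∀ ω, Z ω i * Y ω j = ∑ k, L i k * (X ω k * Y ω j) + E ω i * Y ω j := fun ω => by
    rw [hZ, Pi.add_apply, Matrix.mulVec, dotProduct, add_mul, Finset.sum_mul]
    simp only [mul_assoc]
  calc ∫ ω, Z ω i * Y ω j ∂μ
      = ∫ ω, (∑ k, L i k * (X ω k * Y ω j) + E ω i * Y ω j) ∂μ := by simp_rw [e1]
    _ = ∑ k, L i k * ∫ ω, X ω k * Y ω j ∂μ + ∫ ω, E ω i * Y ω j ∂μ := by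
        rw [integral_add (integrable_finsetSum _ fun k _ => hi k) hEY,
          integral_finsetSum _ fun k _ => hi k]
        simp only [integral_const_mul]
    _ = _ := by simp [crossMoment, Matrix.mul_apply]

/-- `e` is a centred, temporally uncorrelated square-integrable process of covariance `N`. -/
structure IsWhiteNoise (μ : Measure Ω) (N : Matrix d d ℝ) (e : ℕ → Ω → d → ℝ) : Prop where
  memLp : ∀ t i, MemLp (fun ω => e t ω i) 2 μ
  mean : ∀ t i, ∫ ω, e t ω i ∂μ = 0
  cov : ∀ t, crossMoment μ (e t) (e t) = N
  cross : ∀ s t, s ≠ t → crossMoment μ (e s) (e t) = 0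

variable [IsProbabilityMeasure μ] {N L : Matrix d d ℝ} {e z : ℕ → Ω → d → ℝ}

theorem IsWhiteNoise.memLp_state (he : IsWhiteNoise μ N e) {z₀ : d → ℝ} (h0 : ∀ ω, z 0 ω = z₀)
    (hz : ∀ t ω, z (t + 1) ω = L *ᵥ z t ω + e t ω) (t : ℕ) (i : d) :
    MemLp (fun ω => z t ω i) 2 μ := by
  induction t generalizing i with
  | zero => simpa [h0] using memLp_const (z₀ i)
  | succ t ih =>
    simp only [hz, Pi.add_apply, Matrix.mulVec, dotProduct]
    exact (memLp_finsetSum _ fun j _ => (ih j).const_mul (L i j)).add (he.memLp t i)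

/-- The state at `t` is built from the deterministic initial state and from noise before `t`; the
former needs centred noise, the latter uncorrelatedness. -/
theorem IsWhiteNoise.crossMoment_state_noise (he : IsWhiteNoise μ N e) {z₀ : d → ℝ}
    (h0 : ∀ ω, z 0 ω = z₀) (hz : ∀ t ω, z (t + 1) ω = L *ᵥ z t ω + e t ω) (t s : ℕ)
    (hs : t ≤ s) : crossMoment μ (z t) (e s) = 0 := by
  induction t with
  | zero =>
    ext i j
    simp [crossMoment, h0, integral_const_mul, he.mean]
  | succ t ih =>
    rw [crossMoment_mulVec_add L (hz t) (he.memLp_state h0 hz t) (he.memLp t) (he.memLp s),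
      ih (by omega), he.cross t s (by omega), Matrix.mul_zero, add_zero]

theorem IsWhiteNoise.crossMoment_state_succ (he : IsWhiteNoise μ N e) {z₀ : d → ℝ}
    (h0 : ∀ ω, z 0 ω = z₀) (hz : ∀ t ω, z (t + 1) ω = L *ᵥ z t ω + e t ω) (t : ℕ) :
    crossMoment μ (z (t + 1)) (z (t + 1)) = L * crossMoment μ (z t) (z t) * Lᵀ + N := by
  have hzm := he.memLp_state h0 hz
  have hze := he.crossMoment_state_noise h0 hz t t le_rfl
  have hez : crossMoment μ (e t) (z t) = 0 := by
    rw [← crossMoment_transpose, hze, Matrix.transpose_zero]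
  rw [crossMoment_mulVec_add L (hz t) (hzm t) (he.memLp t) (hzm (t + 1)),
    ← crossMoment_transpose (z (t + 1)) (z t), ← crossMoment_transpose (z (t + 1)) (e t),
    crossMoment_mulVec_add L (hz t) (hzm t) (he.memLp t) (hzm t),
    crossMoment_mulVec_add L (hz t) (hzm t) (he.memLp t) (he.memLp t), hze, hez, he.cov,
    Matrix.mul_zero, zero_add, add_zero, Matrix.transpose_mul, crossMoment_transpose,
    ← he.cov t, crossMoment_transpose, Matrix.mul_assoc]

theorem integral_dotProduct_mulVec {X : Ω → d → ℝ} (hX : ∀ i, MemLp (fun ω => X ω i) 2 μ)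
    (C : Matrix d d ℝ) : Integrable (fun ω => X ω ⬝ᵥ (C *ᵥ X ω)) μ ∧
      ∫ ω, X ω ⬝ᵥ (C *ᵥ X ω) ∂μ = (C * crossMoment μ X X).trace := by
  have hi : ∀ i j, Integrable (fun ω => C i j * (X ω j * X ω i)) μ := fun i j =>
    ((hX j).integrable_mul (hX i)).const_mul (C i j)
  have e1 : ∀ ω, X ω ⬝ᵥ (C *ᵥ X ω) = ∑ i, ∑ j, C i j * (X ω j * X ω i) := fun ω => by
    simp only [dotProduct, Matrix.mulVec, Finset.mul_sum]
    exact Finset.sum_congr rfl fun i _ => Finset.sum_congr rfl fun j _ => by ring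
  simp_rw [e1]
  have hi2 : ∀ i, Integrable (fun ω => ∑ j, C i j * (X ω j * X ω i)) μ := fun i =>
    integrable_finsetSum _ fun j _ => hi i j
  refine ⟨integrable_finsetSum _ fun i _ => hi2 i, ?_⟩
  rw [integral_finsetSum _ fun i _ => hi2 i]
  simp only [Matrix.trace, Matrix.diag_apply, Matrix.mul_apply]
  refine Finset.sum_congr rfl fun i _ => ?_
  rw [integral_finsetSum _ fun j _ => hi i j]
  simp only [integral_const_mul, crossMoment, Matrix.of_apply]

end WhiteNoise

/-! ### The average cost of an affine closed loop -/

/-- Homogeneous coordinates. -/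
def homog {q : Type*} (x : q → ℝ) : q ⊕ Unit → ℝ := Sum.elim x fun _ => 1

namespace Setting

variable {n m T : ℕ} {Ω : Type*} [MeasurableSpace Ω] {S : Setting n m T Ω}
  [IsProbabilityMeasure S.P]

/-- Gaussianity and independence are needed only for these first and second moments. The noise is
padded by zero in the homogeneous coordinate. -/
theorem isWhiteNoise {W : Matrix (Fin n) (Fin n) ℝ} (hW : W.PosDef)
    (hw_law : ∀ t, HasLaw (S.w t) (multivariateGaussian 0 W) S.P) (hw_indep : iIndepFun S.w S.P) :
    IsWhiteNoise S.P (augNoise W)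
      fun t ω => (Sum.elim (S.w t ω).ofLp fun _ => 0 : Fin n ⊕ Unit → ℝ) := by
  have hcoord : ∀ i, Measurable fun x : EuclideanSpace ℝ (Fin n) => x i := fun i => by fun_prop
  have hm0 : ∀ i, MemLp (fun x : EuclideanSpace ℝ (Fin n) => x i) 2
      (multivariateGaussian 0 W) := fun i =>
    (IsGaussian.memLp_two_id (μ := multivariateGaussian (0 : EuclideanSpace ℝ (Fin n)) W)).continuousLinearMap_comp
      (EuclideanSpace.proj i : EuclideanSpace ℝ (Fin n) →L[ℝ] ℝ)
  have hmem : ∀ t i, MemLp (fun ω => S.w t ω i) 2 S.P := fun t i => by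
    have := hm0 i
    rw [← (hw_law t).map_eq] at this
    exact this.comp_of_map (hw_law t).aemeasurable
  have hmean : ∀ t i, ∫ ω, S.w t ω i ∂S.P = 0 := fun t i => by
    have h1 := (hw_law t).integral_comp (f := fun x => x i) (hcoord i).aestronglyMeasurable
    have h2 := ContinuousLinearMap.integral_comp_id_comm
      (μ := multivariateGaussian (0 : EuclideanSpace ℝ (Fin n)) W) IsGaussian.integrable_id
      (EuclideanSpace.proj i : EuclideanSpace ℝ (Fin n) →L[ℝ] ℝ)
    rw [integral_id_multivariateGaussian, map_zero] at h2
    exact h1.trans h2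
  have hcov : ∀ t i j, ∫ ω, S.w t ω i * S.w t ω j ∂S.P = W i j := fun t i j => by
    have h1 := (hw_law t).covariance_fun_comp (f := fun x => x i) (g := fun x => x j)
      (hcoord i).aemeasurable (hcoord j).aemeasurable
    rw [covariance_eval_multivariateGaussian hW.posSemidef,
      covariance_eq_sub (hmem t i) (hmem t j), hmean] at h1
    simpa using h1
  have hcross : ∀ s t, s ≠ t → ∀ i j, ∫ ω, S.w s ω i * S.w t ω j ∂S.P = 0 :=
    fun s t hst i j => by
      have hind := (hw_indep.indepFun hst).comp (hcoord i) (hcoord j)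
      have := hind.integral_mul_eq_mul_integral (hmem s i).aestronglyMeasurable
        (hmem t j).aestronglyMeasurable
      refine this.trans ?_
      rw [show ∫ ω, ((fun x : EuclideanSpace ℝ (Fin n) => x i) ∘ S.w s) ω ∂S.P = 0 from hmean s i,
        zero_mul]
  refine ⟨?_, ?_, ?_, ?_⟩
  · rintro t (i | i)
    · exact hmem t i
    · exact MemLp.zero'
  · rintro t (i | i)
    · exact hmean t i
    · simp
  · intro t
    ext (i | i) (j | j) <;> simp [crossMoment, augNoise, hcov]
  · intro s t hst
    ext (i | i) (j | j) <;> simp [crossMoment, hcross s t hst]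

/-- The common bridge from probability to matrices, stated for a general input space so that it
covers both the model loop and the loop parametrized by `ξ`. -/
theorem avgCost_eq_average {W : Matrix (Fin n) (Fin n) ℝ} (hW : W.PosDef)
    (hw_law : ∀ t, HasLaw (S.w t) (multivariateGaussian 0 W) S.P) (hw_indep : iIndepFun S.w S.P)
    {p : Type*} [Fintype p] [DecidableEq p] (L : AffineLQ p (Fin n)) (hLW : L.W = W)
    (hQ : L.Q.PosSemidef) (hR : L.R.PosSemidef)
    (θ : Matrix p (Fin n ⊕ Unit) ℝ) {step : (Fin n → ℝ) → (Fin n → ℝ)}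
    {input : (Fin n → ℝ) → (Fin m → ℝ)} (hstep : ∀ x, homog (step x) = L.loop θ *ᵥ homog x)
    (hcost : ∀ x, S.stageCost x (input x) = homog x ⬝ᵥ (L.stage θ *ᵥ homog x)) :
    S.avgCost step input = L.average θ (vecMulVec (homog S.xInit) (homog S.xInit)) := by
  have hwn := isWhiteNoise hW hw_law hw_indep
  set z : ℕ → Ω → Fin n ⊕ Unit → ℝ := fun t ω => homog (S.state step t ω) with hz
  have h0 : ∀ ω, z 0 ω = homog S.xInit := fun ω => rfl
  have hzs : ∀ t ω, z (t + 1) ω = L.loop θ *ᵥ z t ω +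
      (Sum.elim (S.w t ω).ofLp fun _ => 0 : Fin n ⊕ Unit → ℝ) := fun t ω => by
    change homog (step (S.state step t ω) + (S.w t ω).ofLp) = _
    rw [← hstep]
    funext i
    rcases i with i | i <;> simp [homog]
  have hmom : ∀ t, crossMoment S.P (z t) (z t) = momentSeq (L.cl θ) (L.drift θ) L.W
      (vecMulVec (homog S.xInit) (homog S.xInit)) t := fun t => by
    induction t with
    | zero =>
      ext i j
      simp [crossMoment, h0, momentSeq, vecMulVec]
    | succ t ih => rw [hwn.crossMoment_state_succ h0 hzs, ih, ← hLW]; rfl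
  have hquad := fun t => integral_dotProduct_mulVec (hwn.memLp_state h0 hzs t) (L.stage θ)
  rw [avgCost, AffineLQ.average]
  congr 1
  funext N
  congr 1
  have hsc : ∀ t ω, S.stageCost (S.state step t ω) (input (S.state step t ω)) =
      z t ω ⬝ᵥ (L.stage θ *ᵥ z t ω) := fun t ω => hcost _
  simp_rw [hsc]
  rw [← ofReal_integral_eq_lintegral_ofReal (integrable_finsetSum _ fun t _ => (hquad t).1)
    (Eventually.of_forall fun ω => Finset.sum_nonneg fun t _ =>
      PosSemidef.quad_nonneg (AffineLQ.stage_posSemidef hQ hR θ) _),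
    integral_finsetSum _ fun t _ => (hquad t).1]
  congr 1
  refine Finset.sum_congr rfl fun t _ => ?_
  rw [(hquad t).2, hmom]

end Setting

/-! ### Spectral norm and smallest singular value of positive matrices -/

section Spectral
variable {p q : Type*} [Fintype p] [Fintype q] [DecidableEq q]

theorem dotProduct_mulVec_le_opNorm (M : Matrix q q ℝ) (v : q → ℝ) :
    v ⬝ᵥ (M *ᵥ v) ≤ opNorm M * (v ⬝ᵥ v) := by
  have h1 : v ⬝ᵥ (M *ᵥ v) =
      inner ℝ (WithLp.toLp 2 v) (Matrix.toEuclideanCLM (𝕜 := ℝ) M (WithLp.toLp 2 v)) := by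
    rw [Matrix.inner_toEuclideanCLM]
  have h2 : v ⬝ᵥ v = ‖(WithLp.toLp 2 v : EuclideanSpace ℝ q)‖ ^ 2 := by
    rw [EuclideanSpace.norm_sq_eq]
    simp [dotProduct, pow_two]
  rw [h1, h2]
  have h3 := real_inner_le_norm (WithLp.toLp 2 v : EuclideanSpace ℝ q)
    (Matrix.toEuclideanCLM (𝕜 := ℝ) M (WithLp.toLp 2 v))
  have h4 := (Matrix.toEuclideanCLM (𝕜 := ℝ) M).le_opNorm (WithLp.toLp 2 v)
  have h5 := norm_nonneg (WithLp.toLp 2 v : EuclideanSpace ℝ q)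
  unfold opNorm
  nlinarith

theorem opNorm_smul_one_sub_posSemidef {M : Matrix q q ℝ} (hM : M.PosSemidef) :
    (opNorm M • (1 : Matrix q q ℝ) - M).PosSemidef := by
  refine posSemidef_of_quad (by simp [PosSemidef.transpose_eq hM]) fun x => ?_
  have h := dotProduct_mulVec_le_opNorm M x
  simp only [sub_mulVec, smul_mulVec, one_mulVec, dotProduct_sub, dotProduct_smul, smul_eq_mul]
  linarith

theorem trace_mul_le_opNorm_mul_norm_sq {M : Matrix q q ℝ} (hM : M.PosSemidef)
    (Z : Matrix q p ℝ) : (Zᵀ * M * Z).trace ≤ opNorm M * ‖Z‖ ^ 2 := by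
  have h := PosSemidef.trace_mul_nonneg (opNorm_smul_one_sub_posSemidef hM)
    (AffineLQ.posSemidef_mul_transpose Z)
  rw [norm_sq_eq_trace', Matrix.trace_mul_comm (Zᵀ * M), ← Matrix.mul_assoc,
    Matrix.trace_mul_comm (Z * Zᵀ)]
  rw [Matrix.sub_mul, trace_sub, smul_mul, Matrix.one_mul, trace_smul, smul_eq_mul] at h
  linarith

/-- This is `M² ⪯ ‖M‖ M`. With `M = Yᵀ Y`, Cauchy–Schwarz is applied to `‖M Z‖² = ⟨Y Z, Y M Z⟩`, and
`‖Y M Z‖² ≤ ‖M‖ ‖M Z‖²`. It lets the descent estimate be stated in the `M`-weighted norm of the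
gradient. -/
theorem norm_mul_sq_le_opNorm_mul_trace {M : Matrix q q ℝ} (hM : M.PosSemidef)
    (Z : Matrix q p ℝ) : ‖M * Z‖ ^ 2 ≤ opNorm M * (Zᵀ * M * Z).trace := by
  have hMt := PosSemidef.transpose_eq hM
  obtain ⟨Y, hY⟩ := PosSemidef.exists_transpose_mul_self hM
  have h0 : 0 ≤ opNorm M := norm_nonneg _
  have e : (Zᵀ * M * Z).trace = ‖Y * Z‖ ^ 2 := by
    rw [norm_sq_eq_trace, transpose_mul, hY]
    simp only [Matrix.mul_assoc]
  have h1 := abs_trace_transpose_mul_le (Y * Z) (Y * (M * Z))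
  have e1 : ((Y * Z)ᵀ * (Y * (M * Z))).trace = ‖M * Z‖ ^ 2 := by
    rw [norm_sq_eq_trace, transpose_mul, transpose_mul, hMt]
    conv_rhs => rw [Matrix.mul_assoc, ← Matrix.mul_assoc M, hY]
    rw [hY]
    simp only [Matrix.mul_assoc]
  have h2 := trace_mul_le_opNorm_mul_norm_sq hM (M * Z)
  have e2 : ((M * Z)ᵀ * M * (M * Z)).trace = ‖Y * (M * Z)‖ ^ 2 := by
    have e3 : (M * Z)ᵀ * M * (M * Z) = (M * Z)ᵀ * (Yᵀ * Y) * (M * Z) := by rw [← hY]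
    rw [e3, norm_sq_eq_trace, transpose_mul Y]
    simp only [Matrix.mul_assoc]
  rw [e1] at h1
  rw [e2] at h2
  rw [e]
  have h3 : ‖M * Z‖ ^ 2 ≤ ‖Y * Z‖ * ‖Y * (M * Z)‖ := (le_abs_self _).trans h1
  have h4 : (‖M * Z‖ ^ 2) ^ 2 ≤ ‖Y * Z‖ ^ 2 * (opNorm M * ‖M * Z‖ ^ 2) := by
    calc (‖M * Z‖ ^ 2) ^ 2 ≤ (‖Y * Z‖ * ‖Y * (M * Z)‖) ^ 2 := by gcongr
      _ = ‖Y * Z‖ ^ 2 * ‖Y * (M * Z)‖ ^ 2 := by ring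
      _ ≤ _ := by gcongr
  rcases (sq_nonneg ‖M * Z‖).eq_or_lt with h5 | h5
  · rw [← h5]; positivity
  · nlinarith

theorem opNorm_pos {M : Matrix q q ℝ} [Nonempty q] (hM : M.PosDef) : 0 < opNorm M := by
  obtain ⟨i⟩ := ‹Nonempty q›
  have hv : (Pi.single i 1 : q → ℝ) ≠ 0 := by simp
  have h1 := PosDef.quad_pos hM hv
  have h2 := dotProduct_mulVec_le_opNorm M (Pi.single i 1)
  rw [show (Pi.single i 1 : q → ℝ) ⬝ᵥ Pi.single i 1 = 1 by simp] at h2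
  linarith

/-- An eigenvalue of a positive semidefinite `M` is nonnegative and its square is an eigenvalue of
`MᵀM`; hence it is a singular value, at least the smallest one. -/
theorem sub_minSingularValue_smul_one_posSemidef {m : ℕ} {M : Matrix (Fin m) (Fin m) ℝ}
    (hM : M.PosSemidef) : (M - minSingularValue M • (1 : Matrix (Fin m) (Fin m) ℝ)).PosSemidef := by
  have hMt := PosSemidef.transpose_eq hM
  set σ := minSingularValue M with hσ
  have hH : (M - σ • (1 : Matrix (Fin m) (Fin m) ℝ)).IsHermitian := by
    rw [IsHermitian, conjTranspose_eq_transpose_of_trivial]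
    simp [hMt]
  refine hH.posSemidef_iff_eigenvalues_nonneg.2 fun i => ?_
  set μ := hH.eigenvalues i
  set v := hH.eigenvectorBasis i with hv
  have hvec : M *ᵥ v.ofLp = (μ + σ) • v.ofLp := by
    have h := hH.mulVec_eigenvectorBasis i
    rw [sub_mulVec, smul_mulVec, one_mulVec, sub_eq_iff_eq_add] at h
    rw [add_smul]
    exact h
  have hv0 : v ≠ 0 := hH.eigenvectorBasis.orthonormal.ne_zero i
  have hv0' : v.ofLp ≠ 0 := fun h => hv0 (WithLp.ofLp_injective 2 h)
  have hvv : 0 < v.ofLp ⬝ᵥ v.ofLp := by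
    have := PosDef.quad_pos (PosDef.one (n := Fin m) (R := ℝ)) hv0'
    simpa using this
  have hnn : 0 ≤ μ + σ := by
    have h := PosSemidef.quad_nonneg hM v.ofLp
    rw [hvec, dotProduct_smul, smul_eq_mul] at h
    exact nonneg_of_mul_nonneg_left h hvv
  let T := Matrix.toEuclideanLin M
  have hTv : T v = (μ + σ) • v := by
    apply WithLp.ofLp_injective 2
    exact hvec
  have hadj : T.adjoint = T := by
    have h := Matrix.toEuclideanLin_conjTranspose_eq_adjoint M
    rw [conjTranspose_eq_transpose_of_trivial, hMt] at h
    exact h.symm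
  have hev : Module.End.HasEigenvalue (T.adjoint ∘ₗ T) ((μ + σ) ^ 2) := by
    refine Module.End.hasEigenvalue_of_hasEigenvector (x := v) ⟨?_, hv0⟩
    rw [Module.End.mem_eigenspace_iff, hadj, LinearMap.comp_apply, hTv, map_smul, hTv, smul_smul,
      pow_two]
  have hfr : Module.finrank ℝ (EuclideanSpace ℝ (Fin m)) = m := by simp
  obtain ⟨j, hj⟩ := T.isSymmetric_adjoint_comp_self.exists_eigenvalues_eq hfr hev
  have hj' : T.singularValues j ^ 2 = (μ + σ) ^ 2 := by
    rw [T.sq_singularValues_fin hfr]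
    exact hj
  -- Singular values are listed in descending order and `j ≤ m - 1`.
  have hle : σ ≤ T.singularValues j := T.singularValues_antitone (by omega)
  have hσ0 : 0 ≤ σ := T.singularValues_nonneg _
  have h6 : T.singularValues j = μ + σ :=
    (pow_left_inj₀ (T.singularValues_nonneg _) hnn two_ne_zero).1 hj'
  show 0 ≤ μ
  linarith

theorem minSingularValue_mul_norm_sq_le {m : ℕ} {M : Matrix (Fin m) (Fin m) ℝ}
    (hM : M.PosSemidef) (Z : Matrix (Fin m) p ℝ) :
    minSingularValue M * ‖Z‖ ^ 2 ≤ (Zᵀ * M * Z).trace := by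
  have h := PosSemidef.mul_norm_sq_le_trace (sub_minSingularValue_smul_one_posSemidef hM) Zᵀ
  rw [transpose_transpose] at h
  rw [norm_sq_eq_trace]
  exact h

theorem minSingularValue_pos {m : ℕ} (hm : 0 < m) {M : Matrix (Fin m) (Fin m) ℝ}
    (hM : M.PosDef) : 0 < minSingularValue M := by
  refine (LinearMap.injective_iff_forall_lt_finrank_singularValues_pos _).1 ?_ (m - 1)
    (by simp; omega)
  refine (injective_iff_map_eq_zero _).2 fun x hx => ?_
  by_contra h
  have h1 : x.ofLp ≠ 0 := fun h' => h (WithLp.ofLp_injective 2 h')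
  have h2 := PosDef.quad_pos hM h1
  have h3 : M *ᵥ x.ofLp = 0 := congrArg WithLp.ofLp hx
  rw [h3, dotProduct_zero] at h2
  exact h2.false

end Spectral

/-! ### Descent of preconditioned gradient steps -/

namespace AffineLQ
variable {p q : Type*} [Fintype p] [Fintype q] [DecidableEq p] [DecidableEq q]
variable {L : AffineLQ p q}

theorem hasDerivAt_cost_line (hQ : L.Qᵀ = L.Q) (hR : L.Rᵀ = L.R) (hW : L.Wᵀ = L.W)
    {θ : Matrix p (q ⊕ Unit) ℝ} (hθ : θ ∈ L.stable) (D : Matrix p (q ⊕ Unit) ℝ) :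
    HasDerivAt (fun s : ℝ => L.cost (θ - s • D)) (-((matGrad L.cost θ)ᵀ * D).trace) 0 := by
  have h1 := hasFDerivAt_cost hQ hR hW hθ
  rw [← matGrad_cost hQ hR hW hθ] at h1
  have h2 : HasDerivAt (fun s : ℝ => θ - s • D) (-D) 0 := by
    have h3 := ((hasDerivAt_id (0 : ℝ)).smul_const D).const_sub θ
    rw [one_smul] at h3
    exact h3
  have h4 : HasFDerivAt L.cost (pairing (matGrad L.cost θ)) (θ - (0 : ℝ) • D) := by
    rw [zero_smul, sub_zero]
    exact h1
  have h5 := h4.comp_hasDerivAt (0 : ℝ) h2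
  have e : pairing (matGrad L.cost θ) (-D) = -((matGrad L.cost θ)ᵀ * D).trace := by
    rw [pairing_apply, Matrix.mul_neg, trace_neg]
  exact e ▸ h5

/-- A gradient step preconditioned by `M` of length at most `1 / (ℓ ‖M‖)` stays in the sublevel
set and decreases the cost. -/
theorem cost_descent (hQ : L.Q.PosDef) (hR : L.R.PosDef) (hW : L.W.PosDef) {a ℓ η : ℝ}
    {M : Matrix p p ℝ} (hM : M.PosSemidef) (hMn : 0 < opNorm M) (hℓ : 0 < ℓ)
    (hs : ∀ θ ∈ L.costSublevel a, ∀ θ' ∈ L.costSublevel a,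
      (∀ φ ∈ Set.Ioo (0 : ℝ) 1, θ + φ • (θ' - θ) ∈ L.costSublevel a) →
      L.cost θ' ≤ L.cost θ + ((matGrad L.cost θ)ᵀ * (θ' - θ)).trace + ℓ * ‖θ' - θ‖ ^ 2 / 2)
    {θ : Matrix p (q ⊕ Unit) ℝ} (hθ : θ ∈ L.costSublevel a)
    (hη : η ∈ Set.Ioc (0 : ℝ) (1 / (ℓ * opNorm M))) :
    θ - η • (M * matGrad L.cost θ) ∈ L.costSublevel a ∧
      L.cost (θ - η • (M * matGrad L.cost θ)) ≤ L.cost θ -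
        η * (1 - ℓ * opNorm M * η / 2) *
          ((matGrad L.cost θ)ᵀ * M * matGrad L.cost θ).trace := by
  set g := matGrad L.cost θ with hg
  set D := M * g with hD
  set κ := (gᵀ * M * g).trace with hκ
  have hκ' : (gᵀ * D).trace = κ := by rw [hD, hκ, Matrix.mul_assoc]
  have hDn : ‖D‖ ^ 2 ≤ opNorm M * κ := norm_mul_sq_le_opNorm_mul_trace hM g
  have hκ0 : 0 ≤ κ := by
    by_contra h
    push Not at h
    nlinarith [sq_nonneg ‖D‖]
  -- Smoothness may be used only once the whole segment up to `x` is known to lie in the sublevel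
  -- set.
  have decrease : ∀ x : ℝ, 0 ≤ x → (∀ y ∈ Set.Icc 0 x, θ - y • D ∈ L.costSublevel a) →
      L.cost (θ - x • D) ≤ L.cost θ - x * (1 - ℓ * opNorm M * x / 2) * κ := by
    intro x hx hy
    have h := hs θ hθ (θ - x • D) (hy x ⟨hx, le_rfl⟩) fun φ hφ => by
      have e : θ + φ • (θ - x • D - θ) = θ - (φ * x) • D := by
        rw [sub_sub_cancel_left, smul_neg, smul_smul, ← sub_eq_add_neg]
      rw [e]
      exact hy _ ⟨mul_nonneg hφ.1.le hx, mul_le_of_le_one_left hx hφ.2.le⟩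
    rw [sub_sub_cancel_left, Matrix.mul_neg, trace_neg, Matrix.mul_smul, trace_smul, hκ', norm_neg,
      norm_smul, smul_eq_mul, mul_pow, Real.norm_eq_abs, sq_abs] at h
    have h2 : ℓ * (x ^ 2 * ‖D‖ ^ 2) ≤ ℓ * (x ^ 2 * (opNorm M * κ)) := by gcongr
    nlinarith
  have hprod : 0 < ℓ * opNorm M := mul_pos hℓ hMn
  -- Continuation in the step length: the admissible lengths form a closed set, and from each `x <
  -- η` reached so far they extend to the right.
  have key : Set.Icc 0 η ⊆ {y : ℝ | θ - y • D ∈ L.costSublevel a} := by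
    have hcont : Continuous fun y : ℝ => θ - y • D :=
      continuous_const.sub (continuous_id.smul continuous_const)
    have hclosed : IsClosed {y : ℝ | θ - y • D ∈ L.costSublevel a} :=
      (isCompact_costSublevel hQ hR hW a).isClosed.preimage hcont
    refine (hclosed.inter isClosed_Icc).Icc_subset_of_forall_mem_nhdsGT_of_Icc_subset
      (by simpa using hθ) fun x hx hsub => ?_
    rcases hκ0.eq_or_lt with h0 | h0
    · have hD0 : D = 0 := by
        have : ‖D‖ ^ 2 ≤ 0 := by rw [← h0, mul_zero] at hDn; exact hDn
        exact norm_eq_zero.1 (pow_eq_zero_iff two_ne_zero |>.1 (le_antisymm this (sq_nonneg _)))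
      refine Filter.mem_of_superset Filter.univ_mem fun y _ => ?_
      show θ - y • D ∈ L.costSublevel a
      rw [hD0, smul_zero, sub_zero]
      exact hθ
    · have hxs : θ - x • D ∈ L.stable := (hsub ⟨hx.1, le_rfl⟩).1
      have hst : ∀ᶠ y in 𝓝[>] x, θ - y • D ∈ L.stable :=
        nhdsWithin_le_nhds ((isOpen_stable.preimage hcont).mem_nhds hxs)
      -- At `x = 0` the cost may equal `a`, so the negative derivative `-κ` is needed; for `x > 0`
      -- the cost is already below `a` and continuity suffices.
      rcases hx.1.eq_or_lt with hx0 | hx0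
      · subst hx0
        have hd := hasDerivAt_cost_line (PosSemidef.transpose_eq hQ.posSemidef)
          (PosSemidef.transpose_eq hR.posSemidef) (PosSemidef.transpose_eq hW.posSemidef) hθ.1 D
        rw [← hg, hκ'] at hd
        have hsl := (hasDerivAt_iff_tendsto_slope.1 hd).eventually_lt_const (neg_lt_zero.2 h0)
        have hsl' := nhdsWithin_mono (0 : ℝ) (fun y (hy : y ∈ Set.Ioi (0 : ℝ)) => ne_of_gt hy) hsl
        filter_upwards [hst, hsl', self_mem_nhdsWithin] with y h1 h2 h3
        refine ⟨h1, ?_⟩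
        have h3' : (0 : ℝ) < y := h3
        rw [slope_def_field, sub_zero, div_neg_iff] at h2
        rcases h2 with h2 | h2
        · exact absurd h3' h2.2.not_gt
        · have h4 := h2.1
          rw [zero_smul, sub_zero] at h4
          linarith [hθ.2]
      · have hlt : L.cost (θ - x • D) < a := by
          have h1 := decrease x hx.1 fun y hy => hsub hy
          have h2 : ℓ * opNorm M * x ≤ 1 := by
            have := hx.2.le.trans hη.2
            rw [le_div_iff₀ hprod] at this
            linarith
          have h3 : 0 < x * (1 - ℓ * opNorm M * x / 2) * κ :=
            mul_pos (mul_pos hx0 (by linarith)) h0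
          linarith [hθ.2]
        have hca : ContinuousAt (fun y : ℝ => L.cost (θ - y • D)) x :=
          ContinuousAt.comp (f := fun y : ℝ => θ - y • D)
            (continuousOn_cost.continuousAt (isOpen_stable.mem_nhds hxs)) hcont.continuousAt
        filter_upwards [hst, nhdsWithin_le_nhds (hca.eventually_lt_const hlt)] with y h1 h2
        exact ⟨h1, h2.le⟩
  exact ⟨key ⟨hη.1.le, le_rfl⟩, decrease η hη.1.le fun y hy => key hy⟩

end AffineLQ

/-! ### Directional derivatives and matrix gradients -/

section Gradient
variable {p q : Type*} [Fintype p] [Fintype q] [DecidableEq p] [DecidableEq q]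

theorem hasDerivAt_line {f : Matrix p q ℝ → ℝ} {Z : Matrix p q ℝ} (hf : DifferentiableAt ℝ f Z)
    (D : Matrix p q ℝ) :
    HasDerivAt (fun s : ℝ => f (Z + s • D)) ((matGrad f Z)ᵀ * D).trace 0 := by
  have h2 : HasDerivAt (fun s : ℝ => Z + s • D) D 0 := by
    have h3 := ((hasDerivAt_id (0 : ℝ)).smul_const D).const_add Z
    rw [one_smul] at h3
    exact h3
  have h4 : HasFDerivAt f (fderiv ℝ f Z) (Z + (0 : ℝ) • D) := by
    rw [zero_smul, add_zero]
    exact hf.hasFDerivAt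
  have h5 := h4.comp_hasDerivAt (0 : ℝ) h2
  rw [trace_matGrad_transpose_mul]
  exact h5

theorem matGrad_congr {f g : Matrix p q ℝ → ℝ} {Z : Matrix p q ℝ} (h : f =ᶠ[𝓝 Z] g) :
    matGrad f Z = matGrad g Z := by
  have e : fderiv ℝ f Z = fderiv ℝ g Z := h.fderiv_eq
  simp only [matGrad, e]

end Gradient

/-! ### Null-space projections of row blocks -/

section RowBlocks
variable {p q : Type*} [Fintype p] [Fintype q] [DecidableEq p] [DecidableEq q]
  {U : Matrix p (p ⊕ q) ℝ} {X : Matrix q (p ⊕ q) ℝ}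

theorem vecMul_fromRows_ne_zero (h : IsUnit (fromRows U X).det) {x : p ⊕ q → ℝ} (hx : x ≠ 0) :
    x ᵥ* fromRows U X ≠ 0 := fun h0 => by
  have h1 := congrArg (fun v => v ᵥ* (fromRows U X)⁻¹) h0
  simp only [vecMul_vecMul, mul_nonsing_inv _ h, vecMul_one, zero_vecMul] at h1
  exact hx h1

theorem dotProduct_self_pos {r : Type*} [Fintype r] {x : r → ℝ} (hx : x ≠ 0) : 0 < x ⬝ᵥ x := by
  classical
  simpa using PosDef.quad_pos (PosDef.one (n := r) (R := ℝ)) hx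

theorem mul_transpose_posDef_of_vecMul {r s : Type*} [Fintype r] [Fintype s] (Y : Matrix r s ℝ)
    (h : ∀ x ≠ 0, x ᵥ* Y ≠ 0) : (Y * Yᵀ).PosDef := by
  refine posDef_of_quad (by simp) fun x hx => ?_
  rw [← mulVec_mulVec, dotProduct_mulVec, mulVec_transpose]
  exact dotProduct_self_pos (h x hx)

theorem mul_transpose_posDef_of_fromRows (h : IsUnit (fromRows U X).det) : (X * Xᵀ).PosDef := by
  refine mul_transpose_posDef_of_vecMul X fun x hx => ?_
  have h1 := vecMul_fromRows_ne_zero h (x := Sum.elim 0 x) fun h0 =>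
    hx (funext fun i => congrFun h0 (Sum.inr i))
  rwa [sumElim_vecMul_fromRows, zero_vecMul, zero_add] at h1

theorem mul_nullProjection (h : IsUnit (fromRows U X).det) :
    X * (1 - rightInv X * X) = 0 := by
  have hu := (isUnit_iff_isUnit_det _).1 (mul_transpose_posDef_of_fromRows h).isUnit
  rw [Matrix.mul_sub, Matrix.mul_one, rightInv, ← Matrix.mul_assoc, ← Matrix.mul_assoc,
    mul_nonsing_inv _ hu, Matrix.one_mul, sub_self]

theorem nullProjection_transpose :
    (1 - rightInv X * X)ᵀ = 1 - rightInv X * X := by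
  simp [rightInv, transpose_nonsing_inv, Matrix.mul_assoc]

/-- The projection `Π` is symmetric and idempotent, so the matrix is `(U Π)(U Π)ᵀ`. If `x U Π = 0`,
then `[x, -x U X†]` is annihilated by the invertible matrix `[U; X]`, whence `x = 0`. -/
theorem mul_nullProjection_mul_transpose_posDef (h : IsUnit (fromRows U X).det) :
    (U * (1 - rightInv X * X) * Uᵀ).PosDef := by
  have hidem : (1 - rightInv X * X) * (1 - rightInv X * X) = 1 - rightInv X * X := by
    conv_lhs => rw [Matrix.sub_mul, Matrix.mul_assoc, mul_nullProjection h]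
    simp
  have e : U * (1 - rightInv X * X) * Uᵀ =
      (U * (1 - rightInv X * X)) * (U * (1 - rightInv X * X))ᵀ := by
    rw [transpose_mul, nullProjection_transpose, ← Matrix.mul_assoc, Matrix.mul_assoc U _ (1 - _), hidem]
  rw [e]
  refine mul_transpose_posDef_of_vecMul _ fun x hx => ?_
  have h1 := vecMul_fromRows_ne_zero h (x := Sum.elim x (-(x ᵥ* (U * rightInv X)))) fun h0 =>
    hx (funext fun i => congrFun h0 (Sum.inl i))
  rw [sumElim_vecMul_fromRows, neg_vecMul, vecMul_vecMul, ← sub_eq_add_neg, ← vecMul_sub] at h1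
  rwa [Matrix.mul_sub, Matrix.mul_one, ← Matrix.mul_assoc]

end RowBlocks

/-! ### Closed loops and costs in homogeneous coordinates -/

section Homogeneous
variable {p q : Type*} [Fintype p] [Fintype q] [DecidableEq p] [DecidableEq q]

omit [Fintype p] [DecidableEq p] [DecidableEq q] in
theorem mulVec_homog (Z : Matrix p (q ⊕ Unit) ℝ) (x : q → ℝ) :
    Z *ᵥ homog x = gain Z *ᵥ x + offset Z := by
  funext i
  simp [mulVec, dotProduct, homog, gain, offset]

theorem AffineLQ.loop_mulVec_homog (L : AffineLQ p q) (θ : Matrix p (q ⊕ Unit) ℝ) (x : q → ℝ) :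
    L.loop θ *ᵥ homog x = homog (L.A *ᵥ x + L.B *ᵥ (θ *ᵥ homog x)) := by
  have e : L.loop θ *ᵥ homog x =
      Sum.elim (L.cl θ *ᵥ x + L.drift θ *ᵥ fun _ => 1)
        ((0 : Matrix Unit q ℝ) *ᵥ x + (1 : Matrix Unit Unit ℝ) *ᵥ fun _ => 1) :=
    fromBlocks_mulVec _ _ _ _ _
  rw [e, mulVec_homog, AffineLQ.cl, AffineLQ.drift, homog, add_mulVec, ← mulVec_mulVec,
    ← mulVec_mulVec, zero_mulVec, one_mulVec, zero_add, mulVec_add, add_assoc]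
  congr 4
  funext i
  simp [mulVec, dotProduct, offset]

theorem AffineLQ.stage_quad_homog (L : AffineLQ p q) (θ : Matrix p (q ⊕ Unit) ℝ) {δ : q → ℝ}
    (hδ : L.δ = replicateCol Unit δ) (x : q → ℝ) :
    homog x ⬝ᵥ (L.stage θ *ᵥ homog x) =
      (x - δ) ⬝ᵥ (L.Q *ᵥ (x - δ)) + (θ *ᵥ homog x) ⬝ᵥ (L.R *ᵥ (θ *ᵥ homog x)) := by
  have e : L.err *ᵥ homog x = x - δ := by
    rw [mulVec_homog]
    funext i
    simp [gain, offset, AffineLQ.err, hδ, sub_eq_add_neg]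
  rw [AffineLQ.stage, add_mulVec, dotProduct_add]
  simp only [← mulVec_mulVec, dotProduct_mulVec _ _ᵀ, vecMul_transpose, e]

end Homogeneous

/-! ### The model and the data-driven problem as affine problems -/

namespace Setting
variable {n m T : ℕ} {Ω : Type*} [MeasurableSpace Ω] (S : Setting n m T Ω)

/-- The tracking problem of the model `(A, B)`. -/
def model (A : Matrix (Fin n) (Fin n) ℝ) (B : Matrix (Fin n) (Fin m) ℝ)
    (W : Matrix (Fin n) (Fin n) ℝ) : AffineLQ (Fin m) (Fin n) :=
  ⟨A, B, S.Q, replicateCol Unit S.δ, S.R, W⟩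

/-- The data-driven tracking problem, with the parameter `ξ` in place of the policy. -/
def dataModel (W : Matrix (Fin n) (Fin n) ℝ) : AffineLQ (Fin m ⊕ Fin n) (Fin n) :=
  ⟨0, S.barX₁, S.Q, replicateCol Unit S.δ, S.barU₀ᵀ * S.R * S.barU₀, W⟩

/-- The second moment of the initial state in homogeneous coordinates. -/
def initMoment : Matrix (Fin n ⊕ Unit) (Fin n ⊕ Unit) ℝ :=
  vecMulVec (homog S.xInit) (homog S.xInit)

theorem initMoment_posSemidef : S.initMoment.PosSemidef := by
  have h := posSemidef_vecMulVec_self_star (homog S.xInit)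
  simpa [initMoment] using h

theorem initMoment_corner : S.initMoment (Sum.inr ()) (Sum.inr ()) = 1 := by
  simp [initMoment, vecMulVec, homog]

variable {S}

section Noise
variable [IsProbabilityMeasure S.P] {W : Matrix (Fin n) (Fin n) ℝ}

theorem modelCostE_eq_average (hW : W.PosDef)
    (hw_law : ∀ t, HasLaw (S.w t) (multivariateGaussian 0 W) S.P) (hw_indep : iIndepFun S.w S.P)
    (hQ : S.Q.PosSemidef) (hR : S.R.PosSemidef) (A : Matrix (Fin n) (Fin n) ℝ)
    (B : Matrix (Fin n) (Fin m) ℝ) (θ : Matrix (Fin m) (Fin n ⊕ Unit) ℝ) :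
    S.modelCostE A B θ = (S.model A B W).average θ S.initMoment := by
  refine avgCost_eq_average hW hw_law hw_indep (S.model A B W) rfl hQ hR θ (fun x => ?_) fun x => ?_
  · rw [AffineLQ.loop_mulVec_homog, mulVec_homog]
    rfl
  · rw [AffineLQ.stage_quad_homog _ _ (δ := S.δ) rfl, mulVec_homog]
    rfl

/-- The input weight `Ū₀ᵀ R Ū₀` is in general only semidefinite. This representation is used for the
differentiability of `J` in all directions; optimality is transferred from the model instead. -/
theorem JE_eq_average (hW : W.PosDef)
    (hw_law : ∀ t, HasLaw (S.w t) (multivariateGaussian 0 W) S.P) (hw_indep : iIndepFun S.w S.P)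
    (hQ : S.Q.PosSemidef) (hR : S.R.PosSemidef) (ξ : Matrix (Fin m ⊕ Fin n) (Fin n ⊕ Unit) ℝ) :
    S.JE ξ = (S.dataModel W).average ξ S.initMoment := by
  refine avgCost_eq_average hW hw_law hw_indep (S.dataModel W) rfl hQ
    (PosSemidef.transpose_mul_mul hR _) ξ (fun x => ?_) fun x => ?_
  · rw [AffineLQ.loop_mulVec_homog, mulVec_homog]
    simp [dataModel, mulVec_add, mulVec_mulVec]
  · rw [AffineLQ.stage_quad_homog _ _ (δ := S.δ) rfl, mulVec_homog, stageCost]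
    simp only [dataModel, ← mulVec_mulVec, dotProduct_mulVec _ _ᵀ, vecMul_transpose]
    simp only [mulVec_add]

end Noise

/-! ### Least squares and the sample covariance -/

section Data
variable {A : Matrix (Fin n) (Fin n) ℝ} {B : Matrix (Fin n) (Fin m) ℝ}

theorem Λ_eq_fromRows : S.Λ = fromRows S.barU₀ S.barX₀ := by
  ext (i | i) j <;> simp [Λ, barU₀, barX₀, D₀, Matrix.mul_apply]

theorem Λ_isUnit_det (hm : 0 < m) (hD : S.D₀.rank = m + n) : IsUnit S.Λ.det := by
  have hT : (T : ℝ) ≠ 0 := by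
    have h := S.D₀.rank_le_card_width
    rw [hD, Fintype.card_fin] at h
    have : T ≠ 0 := by omega
    exact_mod_cast this
  have h1 : (S.D₀ * S.D₀ᵀ).rank = Fintype.card (Fin m ⊕ Fin n) := by
    rw [rank_self_mul_transpose, hD]
    simp
  have h2 : IsUnit (S.D₀ * S.D₀ᵀ) := by
    rw [← mulVec_surjective_iff_isUnit]
    have h3 : (S.D₀ * S.D₀ᵀ).mulVecLin.range = ⊤ :=
      Submodule.eq_top_of_finrank_eq (by rw [Module.finrank_fintype_fun_eq_card]; exact h1)
    exact LinearMap.range_eq_top.1 h3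
  rw [Λ, det_smul]
  exact ((isUnit_iff_ne_zero.2 (one_div_ne_zero hT)).pow _).mul ((isUnit_iff_isUnit_det _).1 h2)

theorem residual_eq (A : Matrix (Fin n) (Fin n) ℝ) (B : Matrix (Fin n) (Fin m) ℝ) :
    S.residual A B = ‖S.X₁ - A * S.X₀ - B * S.U₀‖ ^ 2 := by
  rw [norm_sq_eq_trace, trace_transpose_mul_eq_sum]
  simp only [residual, pow_two]

theorem norm_sub_smul_sq {p q : Type*} [Fintype p] [Fintype q] (N E : Matrix p q ℝ) (s : ℝ) :
    ‖N - s • E‖ ^ 2 = ‖N‖ ^ 2 - 2 * s * (Eᵀ * N).trace + s ^ 2 * ‖E‖ ^ 2 := by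
  have h : (Nᵀ * E).trace = (Eᵀ * N).trace := by
    rw [← trace_transpose, transpose_mul, transpose_transpose]
  simp only [norm_sq_eq_trace, transpose_sub, transpose_smul, Matrix.sub_mul, Matrix.mul_sub,
    smul_mul, Matrix.mul_smul, trace_sub, trace_smul, smul_eq_mul, h]
  ring

/-- The normal equations of the least-squares problem. -/
theorem IsLeastSquares.residual_mul_transpose (h : S.IsLeastSquares A B) :
    (S.X₁ - A * S.X₀ - B * S.U₀) * S.D₀ᵀ = 0 := by
  set N := S.X₁ - A * S.X₀ - B * S.U₀ with hN
  set E := N * S.D₀ᵀ with hE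
  set z := ‖E * S.D₀‖ ^ 2 with hz
  have hz0 : 0 ≤ z := sq_nonneg _
  -- Minimality is tested in the direction `E = N D₀ᵀ`, the steepest descent direction of the
  -- residual up to a factor.
  have key : ∀ s : ℝ, 2 * s * ‖E‖ ^ 2 ≤ s ^ 2 * z := fun s => by
    have h1 := h (A + s • E.toCols₂) (B + s • E.toCols₁)
    have e1 : E * S.D₀ = E.toCols₁ * S.U₀ + E.toCols₂ * S.X₀ := by
      conv_lhs => rw [← fromCols_toCols E]
      exact fromCols_mul_fromRows _ _ _ _
    have e2 : S.X₁ - (A + s • E.toCols₂) * S.X₀ - (B + s • E.toCols₁) * S.U₀ =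
        N - s • (E * S.D₀) := by
      rw [e1, hN, Matrix.add_mul, Matrix.add_mul, smul_mul, smul_mul, smul_add]
      abel
    have e3 : ((E * S.D₀)ᵀ * N).trace = ‖E‖ ^ 2 := by
      rw [transpose_mul, Matrix.mul_assoc, Matrix.trace_mul_comm, Matrix.mul_assoc, ← hE,
        norm_sq_eq_trace]
    rw [residual_eq, residual_eq, e2, ← hN, norm_sub_smul_sq, e3] at h1
    linarith
  -- Any small enough step contradicts minimality unless `E = 0`; adding one to `z` keeps the
  -- denominator positive.
  have h2 := key (‖E‖ ^ 2 / (z + 1))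
  have hz1 : 0 < z + 1 := by linarith
  have h3 : ‖E‖ ^ 2 * ‖E‖ ^ 2 * (z + 2) ≤ 0 := by
    have h4 : 2 * (‖E‖ ^ 2 / (z + 1)) * ‖E‖ ^ 2 * (z + 1) ^ 2 ≤
        (‖E‖ ^ 2 / (z + 1)) ^ 2 * z * (z + 1) ^ 2 := by gcongr
    field_simp at h4
    nlinarith
  have h5 : ‖E‖ ^ 2 = 0 := by
    by_contra hne
    have : 0 < ‖E‖ ^ 2 * ‖E‖ ^ 2 * (z + 2) := by positivity
    linarith
  exact norm_eq_zero.1 ((pow_eq_zero_iff two_ne_zero).1 h5)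

/-- Certainty equivalence: the residual is orthogonal to the data, so after multiplication by `D₀ᵀ /
T` the estimated model fits exactly. -/
theorem IsLeastSquares.barX₁_eq (h : S.IsLeastSquares A B) :
    S.barX₁ = A * S.barX₀ + B * S.barU₀ := by
  have h1 := h.residual_mul_transpose
  rw [Matrix.sub_mul, Matrix.sub_mul, sub_sub, sub_eq_zero] at h1
  rw [barX₁, h1, barX₀, barU₀, Matrix.mul_smul, Matrix.mul_smul, smul_add, Matrix.mul_assoc,
    Matrix.mul_assoc]

end Data

end Setting

namespace AffineLQ
variable {p q : Type*} [Fintype p] [Fintype q] [DecidableEq p] [DecidableEq q]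
variable {L : AffineLQ p q}

/-- A function into `ℝ≥0∞` that agrees with the average cost has the smooth real-valued cost as
its real part on the stabilizing policies. -/
theorem toReal_average_eventuallyEq (hQ : L.Q.PosSemidef) (hR : L.R.PosSemidef)
    (hW : L.W.PosSemidef) {Φ : Matrix (q ⊕ Unit) (q ⊕ Unit) ℝ}
    (h1 : Φ (Sum.inr ()) (Sum.inr ()) = 1) {θ : Matrix p (q ⊕ Unit) ℝ} (hθ : θ ∈ L.stable) :
    (fun θ' => (L.average θ' Φ).toReal) =ᶠ[𝓝 θ] L.cost := by
  filter_upwards [isOpen_stable.mem_nhds hθ] with θ' hθ'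
  rw [average_of_stable hθ' h1, ENNReal.toReal_ofReal (cost_nonneg hQ hR hW hθ')]

theorem differentiableAt_toReal_average (hQ : L.Q.PosSemidef) (hR : L.R.PosSemidef)
    (hW : L.W.PosSemidef) {Φ : Matrix (q ⊕ Unit) (q ⊕ Unit) ℝ}
    (h1 : Φ (Sum.inr ()) (Sum.inr ()) = 1) {θ : Matrix p (q ⊕ Unit) ℝ} (hθ : θ ∈ L.stable) :
    DifferentiableAt ℝ (fun θ' => (L.average θ' Φ).toReal) θ :=
  ((hasFDerivAt_cost (PosSemidef.transpose_eq hQ) (PosSemidef.transpose_eq hR)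
    (PosSemidef.transpose_eq hW) hθ).congr_of_eventuallyEq
      (toReal_average_eventuallyEq hQ hR hW h1 hθ)).differentiableAt

end AffineLQ

/-! ### The change of variables between `ξ` and `θ` -/

namespace Setting
variable {n m T : ℕ} {Ω : Type*} [MeasurableSpace Ω] {S : Setting n m T Ω}
variable {A : Matrix (Fin n) (Fin n) ℝ} {B : Matrix (Fin n) (Fin m) ℝ}
  {W : Matrix (Fin n) (Fin n) ℝ}

section Reparametrization

theorem Λ_mul (ξ : Matrix (Fin m ⊕ Fin n) (Fin n ⊕ Unit) ℝ) :
    S.Λ * ξ = fromRows (S.barU₀ * ξ) (S.barX₀ * ξ) := by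
  rw [Λ_eq_fromRows, fromRows_mul]

theorem stack_eq_Λ_mul_iff {θ : Matrix (Fin m) (Fin n ⊕ Unit) ℝ}
    {ξ : Matrix (Fin m ⊕ Fin n) (Fin n ⊕ Unit) ℝ} :
    stack θ = S.Λ * ξ ↔ S.barU₀ * ξ = θ ∧ S.barX₀ * ξ = mkPolicy 1 0 := by
  rw [Λ_mul, stack, fromRows_inj.eq_iff, eq_comm, @eq_comm _ (mkPolicy 1 0)]

theorem eq_inv_mul_stack_iff (hΛ : IsUnit S.Λ.det) {θ : Matrix (Fin m) (Fin n ⊕ Unit) ℝ}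
    {ξ : Matrix (Fin m ⊕ Fin n) (Fin n ⊕ Unit) ℝ} :
    ξ = S.Λ⁻¹ * stack θ ↔ S.barU₀ * ξ = θ ∧ S.barX₀ * ξ = mkPolicy 1 0 := by
  rw [← stack_eq_Λ_mul_iff]
  constructor
  · intro h
    rw [h, mul_nonsing_inv_cancel_left _ _ hΛ]
  · intro h
    rw [h, nonsing_inv_mul_cancel_left _ _ hΛ]

theorem mul_eq_mkPolicy_iff {X : Matrix (Fin n) (Fin m ⊕ Fin n) ℝ}
    {ξ : Matrix (Fin m ⊕ Fin n) (Fin n ⊕ Unit) ℝ} :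
    X * ξ = mkPolicy 1 0 ↔ X * gain ξ = 1 ∧ X *ᵥ offset ξ = 0 := by
  constructor
  · intro h
    exact ⟨congrArg gain h, congrArg offset h⟩
  · rintro ⟨h1, h2⟩
    ext i (j | j)
    · exact congrFun (congrFun h1 i) j
    · exact congrFun h2 i

variable (hX : S.barX₁ = A * S.barX₀ + B * S.barU₀)
include hX

theorem barX₁_mulVec {ξ : Matrix (Fin m ⊕ Fin n) (Fin n ⊕ Unit) ℝ}
    (hξ : S.barX₀ * ξ = mkPolicy 1 0) (x : Fin n → ℝ) :
    (S.barX₁ * gain ξ) *ᵥ x + S.barX₁ *ᵥ offset ξ =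
      A *ᵥ x + B *ᵥ feedback (S.barU₀ * ξ) x := by
  obtain ⟨h1, h2⟩ := mul_eq_mkPolicy_iff.1 hξ
  have e : feedback (S.barU₀ * ξ) x = S.barU₀ *ᵥ (gain ξ *ᵥ x + offset ξ) := by
    rw [mulVec_add, mulVec_mulVec]
    rfl
  rw [e, hX, Matrix.add_mul, add_mulVec, add_mulVec, Matrix.mul_assoc, h1, Matrix.mul_one,
    ← mulVec_mulVec _ A, h2, mulVec_zero, zero_add, Matrix.mul_assoc, ← mulVec_mulVec,
    ← mulVec_mulVec, ← mulVec_mulVec, mulVec_add, mulVec_add, add_assoc]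

/-- The two closed loops coincide as maps, so the costs agree in `[0, ∞]` whether or not the loop is
stable. -/
theorem JE_eq_modelCostE {ξ : Matrix (Fin m ⊕ Fin n) (Fin n ⊕ Unit) ℝ}
    (hξ : S.barX₀ * ξ = mkPolicy 1 0) : S.JE ξ = S.modelCostE A B (S.barU₀ * ξ) := by
  rw [JE, modelCostE, funext (barX₁_mulVec hX hξ)]
  rfl

theorem mem_feasible_iff {ξ : Matrix (Fin m ⊕ Fin n) (Fin n ⊕ Unit) ℝ} :
    ξ ∈ S.feasible ↔
      S.barX₀ * ξ = mkPolicy 1 0 ∧ S.barU₀ * ξ ∈ (S.model A B W).stable := by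
  rw [feasible, Set.mem_ofPred_eq, ← and_assoc, ← mul_eq_mkPolicy_iff]
  refine and_congr_right fun h => ?_
  have e : S.barX₁ * gain ξ = (S.model A B W).cl (S.barU₀ * ξ) := by
    rw [hX, Matrix.add_mul, Matrix.mul_assoc, (mul_eq_mkPolicy_iff.1 h).1, Matrix.mul_one,
      Matrix.mul_assoc]
    rfl
  rw [e]
  rfl

end Reparametrization

/-- The cost of the model `(A, B)` and the data-driven cost are average costs of affine
linear-quadratic problems, related by the identity `X̄₁ = A X̄₀ + B Ū₀`. -/
structure IsRealizedBy (S : Setting n m T Ω) (A : Matrix (Fin n) (Fin n) ℝ)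
    (B : Matrix (Fin n) (Fin m) ℝ) (W : Matrix (Fin n) (Fin n) ℝ) : Prop where
  hQ : S.Q.PosDef
  hR : S.R.PosDef
  hW : W.PosDef
  isUnit_det : IsUnit S.Λ.det
  barX₁_eq : S.barX₁ = A * S.barX₀ + B * S.barU₀
  modelCostE_eq : ∀ θ, S.modelCostE A B θ = (S.model A B W).average θ S.initMoment
  JE_eq : ∀ ξ, S.JE ξ = (S.dataModel W).average ξ S.initMoment

namespace IsRealizedBy

variable (h : S.IsRealizedBy A B W)
include h

theorem modelCostE_of_stable {θ : Matrix (Fin m) (Fin n ⊕ Unit) ℝ}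
    (hθ : θ ∈ (S.model A B W).stable) :
    S.modelCostE A B θ = ENNReal.ofReal ((S.model A B W).cost θ) := by
  rw [h.modelCostE_eq, AffineLQ.average_of_stable hθ S.initMoment_corner]

theorem modelCost_of_stable {θ : Matrix (Fin m) (Fin n ⊕ Unit) ℝ}
    (hθ : θ ∈ (S.model A B W).stable) : S.modelCost A B θ = (S.model A B W).cost θ := by
  rw [modelCost, h.modelCostE_of_stable hθ, ENNReal.toReal_ofReal
    (AffineLQ.cost_nonneg h.hQ.posSemidef h.hR.posSemidef h.hW.posSemidef hθ)]

theorem differentiableAt_modelCost {θ : Matrix (Fin m) (Fin n ⊕ Unit) ℝ}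
    (hθ : θ ∈ (S.model A B W).stable) : DifferentiableAt ℝ (S.modelCost A B) θ := by
  have e : S.modelCost A B = fun θ' => ((S.model A B W).average θ' S.initMoment).toReal :=
    funext fun θ' => congrArg ENNReal.toReal (h.modelCostE_eq θ')
  rw [e]
  exact AffineLQ.differentiableAt_toReal_average h.hQ.posSemidef h.hR.posSemidef h.hW.posSemidef
    S.initMoment_corner hθ

theorem matGrad_modelCost {θ : Matrix (Fin m) (Fin n ⊕ Unit) ℝ}
    (hθ : θ ∈ (S.model A B W).stable) :
    matGrad (S.modelCost A B) θ = matGrad (S.model A B W).cost θ := by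
  refine matGrad_congr ?_
  filter_upwards [AffineLQ.isOpen_stable.mem_nhds hθ] with θ' hθ'
  exact h.modelCost_of_stable hθ'

theorem differentiableAt_J {ξ : Matrix (Fin m ⊕ Fin n) (Fin n ⊕ Unit) ℝ} (hξ : ξ ∈ S.feasible) :
    DifferentiableAt ℝ S.J ξ := by
  have e : S.J = fun ξ' => ((S.dataModel W).average ξ' S.initMoment).toReal :=
    funext fun ξ' => congrArg ENNReal.toReal (h.JE_eq ξ')
  have hs : ξ ∈ (S.dataModel W).stable := by
    have e' : (S.dataModel W).cl ξ = S.barX₁ * gain ξ := zero_add _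
    show specRad ((S.dataModel W).cl ξ) < 1
    rw [e']
    exact hξ.2.2
  rw [e]
  exact AffineLQ.differentiableAt_toReal_average h.hQ.posSemidef
    (PosSemidef.transpose_mul_mul h.hR.posSemidef _) h.hW.posSemidef S.initMoment_corner hs

theorem mem_feasible_iff {ξ : Matrix (Fin m ⊕ Fin n) (Fin n ⊕ Unit) ℝ} :
    ξ ∈ S.feasible ↔ S.barX₀ * ξ = mkPolicy 1 0 ∧ S.barU₀ * ξ ∈ (S.model A B W).stable :=
  Setting.mem_feasible_iff h.barX₁_eq

theorem JE_of_feasible {ξ : Matrix (Fin m ⊕ Fin n) (Fin n ⊕ Unit) ℝ} (hξ : ξ ∈ S.feasible) :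
    S.JE ξ = ENNReal.ofReal ((S.model A B W).cost (S.barU₀ * ξ)) := by
  obtain ⟨h1, h2⟩ := h.mem_feasible_iff.1 hξ
  rw [JE_eq_modelCostE h.barX₁_eq h1, h.modelCostE_of_stable h2]

theorem J_of_feasible {ξ : Matrix (Fin m ⊕ Fin n) (Fin n ⊕ Unit) ℝ} (hξ : ξ ∈ S.feasible) :
    S.J ξ = (S.model A B W).cost (S.barU₀ * ξ) := by
  obtain ⟨h1, h2⟩ := h.mem_feasible_iff.1 hξ
  rw [← h.modelCost_of_stable h2, J, JE_eq_modelCostE h.barX₁_eq h1, modelCost]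

/-- Each stabilizing `θ` has the feasible preimage `Λ⁻¹ [K l; I 0]` of equal cost, so the constants
of the data-driven statement are those of the affine problem. -/
theorem sublevel_eq (a : ℝ) : S.sublevel a = (S.model A B W).costSublevel a := by
  ext θ
  constructor
  · rintro ⟨ξ, hξ, hJ, hθ⟩
    obtain ⟨rfl, h2⟩ := stack_eq_Λ_mul_iff.1 hθ
    exact ⟨(h.mem_feasible_iff.1 hξ).2, h.J_of_feasible hξ ▸ hJ⟩
  · rintro ⟨h1, h2⟩
    obtain ⟨h3, h4⟩ := (eq_inv_mul_stack_iff h.isUnit_det (θ := θ)).1 rfl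
    have hξ : S.Λ⁻¹ * stack θ ∈ S.feasible := h.mem_feasible_iff.2 ⟨h4, h3.symm ▸ h1⟩
    refine ⟨_, hξ, ?_, (stack_eq_Λ_mul_iff).2 ⟨h3, h4⟩⟩
    rw [h.J_of_feasible hξ, h3]
    exact h2

theorem M_posDef : S.M.PosDef :=
  mul_nullProjection_mul_transpose_posDef (Λ_eq_fromRows (S := S) ▸ h.isUnit_det)

theorem barX₀_mul_proj : S.barX₀ * S.proj = 0 :=
  mul_nullProjection (Λ_eq_fromRows (S := S) ▸ h.isUnit_det)

/-- `J` agrees with the model cost only on the affine subspace `X̄₀ ξ = [I 0]`. The directions `Π H`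
stay in it, so comparing derivatives along these lines is enough. -/
theorem proj_mul_matGrad_J {ξ : Matrix (Fin m ⊕ Fin n) (Fin n ⊕ Unit) ℝ} (hξ : ξ ∈ S.feasible) :
    S.proj * matGrad S.J ξ =
      S.proj * (S.barU₀ᵀ * matGrad (S.modelCost A B) (S.barU₀ * ξ)) := by
  obtain ⟨h1, h2⟩ := h.mem_feasible_iff.1 hξ
  have hpt : S.projᵀ = S.proj := nullProjection_transpose
  refine eq_of_trace_transpose_mul_eq fun H => ?_
  have d1 := hasDerivAt_line (h.differentiableAt_J hξ) (S.proj * H)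
  have d2 := hasDerivAt_line (h.differentiableAt_modelCost h2) (S.barU₀ * (S.proj * H))
  have e : (fun s : ℝ => S.J (ξ + s • (S.proj * H))) =
      fun s : ℝ => S.modelCost A B (S.barU₀ * ξ + s • (S.barU₀ * (S.proj * H))) := by
    funext s
    have h3 : S.barX₀ * (ξ + s • (S.proj * H)) = mkPolicy 1 0 := by
      rw [Matrix.mul_add, h1, Matrix.mul_smul, ← Matrix.mul_assoc, h.barX₀_mul_proj,
        Matrix.zero_mul, smul_zero, add_zero]
    rw [J, JE_eq_modelCostE h.barX₁_eq h3, Matrix.mul_add, Matrix.mul_smul]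
    rfl
  rw [e] at d1
  have d3 := d1.unique d2
  rw [transpose_mul, transpose_mul, transpose_mul, hpt, transpose_transpose, Matrix.mul_assoc,
    Matrix.mul_assoc, Matrix.mul_assoc, d3]

/-- In the policy coordinate the projected step is a gradient step preconditioned by `M = Ū₀ Π Ū₀ᵀ`.
-/
theorem barU₀_mul_step {ξ : Matrix (Fin m ⊕ Fin n) (Fin n ⊕ Unit) ℝ} (hξ : ξ ∈ S.feasible)
    (η : ℝ) : S.barU₀ * (ξ - η • (S.proj * matGrad S.J ξ)) = S.barU₀ * ξ -
      η • (S.M * matGrad (S.model A B W).cost (S.barU₀ * ξ)) := by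
  rw [h.proj_mul_matGrad_J hξ, Matrix.mul_sub, Matrix.mul_smul,
    h.matGrad_modelCost (h.mem_feasible_iff.1 hξ).2, M]
  simp only [Matrix.mul_assoc]

theorem barX₀_mul_step {ξ : Matrix (Fin m ⊕ Fin n) (Fin n ⊕ Unit) ℝ} (hξ : ξ ∈ S.feasible)
    (η : ℝ) : S.barX₀ * (ξ - η • (S.proj * matGrad S.J ξ)) = mkPolicy 1 0 := by
  rw [Matrix.mul_sub, (h.mem_feasible_iff.1 hξ).1, Matrix.mul_smul, ← Matrix.mul_assoc,
    h.barX₀_mul_proj, Matrix.zero_mul, smul_zero, sub_zero]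

theorem isSmoothnessConst_iff {a ℓ : ℝ} : S.IsSmoothnessConst A B a ℓ ↔
    ∀ θ ∈ (S.model A B W).costSublevel a, ∀ θ' ∈ (S.model A B W).costSublevel a,
      (∀ φ ∈ Set.Ioo (0 : ℝ) 1, θ + φ • (θ' - θ) ∈ (S.model A B W).costSublevel a) →
      (S.model A B W).cost θ' ≤ (S.model A B W).cost θ +
        ((matGrad (S.model A B W).cost θ)ᵀ * (θ' - θ)).trace + ℓ * ‖θ' - θ‖ ^ 2 / 2 := by
  rw [IsSmoothnessConst, h.sublevel_eq]
  refine forall₂_congr fun θ hθ => forall₂_congr fun θ' hθ' => ?_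
  rw [h.modelCost_of_stable hθ.1, h.modelCost_of_stable hθ'.1, h.matGrad_modelCost hθ.1]

theorem isGradDomConst_iff {a lam : ℝ} : S.IsGradDomConst A B a lam ↔
    ∀ θ ∈ (S.model A B W).costSublevel a, (S.model A B W).cost θ - S.optCost A B ≤
      lam * ‖matGrad (S.model A B W).cost θ‖ ^ 2 := by
  rw [IsGradDomConst, h.sublevel_eq]
  refine forall₂_congr fun θ hθ => ?_
  rw [h.modelCost_of_stable hθ.1, h.matGrad_modelCost hθ.1]

theorem modelCostE_lt {θ θ' : Matrix (Fin m) (Fin n ⊕ Unit) ℝ} (hθ : θ ∈ (S.model A B W).stable)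
    (h0 : (S.model A B W).adv θ = 0) (hne : θ' ≠ θ) :
    S.modelCostE A B θ < S.modelCostE A B θ' := by
  rw [h.modelCostE_of_stable hθ, h.modelCostE_eq θ']
  exact AffineLQ.lt_average_of_adv_eq_zero h.hQ h.hR h.hW hθ h0 hne S.initMoment_posSemidef
    S.initMoment_corner

theorem optCost_eq {θ : Matrix (Fin m) (Fin n ⊕ Unit) ℝ} (hθ : θ ∈ (S.model A B W).stable)
    (h0 : (S.model A B W).adv θ = 0) : S.optCost A B = (S.model A B W).cost θ := by
  have e : ⨅ θ', S.modelCostE A B θ' = S.modelCostE A B θ := by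
    refine le_antisymm (iInf_le _ θ) (le_iInf fun θ' => ?_)
    rcases eq_or_ne θ' θ with rfl | hne
    · exact le_rfl
    · exact (h.modelCostE_lt hθ h0 hne).le
  rw [optCost, e, ← h.modelCost_of_stable hθ, modelCost]

omit h in
theorem lqtPolicy_eq (P : Matrix (Fin n) (Fin n) ℝ) :
    S.lqtPolicy A B P = (S.model A B W).riccatiPolicy P := by
  rw [lqtPolicy, mkPolicy, lqtOffset, replicateCol_mulVec]
  rfl

/-- One step of the projected gradient iteration. -/
theorem step_contraction (hm : 0 < m) {a ℓ lam η : ℝ}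
    (hℓ : 0 < ℓ) (hs : S.IsSmoothnessConst A B a ℓ) (hlam : 0 < lam)
    (hg : S.IsGradDomConst A B a lam) (hη : η ∈ Set.Ioc (0 : ℝ) (1 / (ℓ * opNorm S.M)))
    {ξ : Matrix (Fin m ⊕ Fin n) (Fin n ⊕ Unit) ℝ} (hξ : ξ ∈ S.feasible) (hJ : S.J ξ ≤ a) :
    ξ - η • (S.proj * matGrad S.J ξ) ∈ S.feasible ∧
      S.J (ξ - η • (S.proj * matGrad S.J ξ)) ≤ a ∧
      S.J (ξ - η • (S.proj * matGrad S.J ξ)) - S.optCost A B ≤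
        (1 - S.rate η ℓ lam) * (S.J ξ - S.optCost A B) := by
  let _ : Nonempty (Fin m) := ⟨⟨0, hm⟩⟩
  have hMn : 0 < opNorm S.M := opNorm_pos h.M_posDef
  have hθ : S.barU₀ * ξ ∈ (S.model A B W).costSublevel a :=
    ⟨(h.mem_feasible_iff.1 hξ).2, h.J_of_feasible hξ ▸ hJ⟩
  obtain ⟨h1, h2⟩ := AffineLQ.cost_descent h.hQ h.hR h.hW h.M_posDef.posSemidef hMn hℓ
    (h.isSmoothnessConst_iff.1 hs) hθ hη
  rw [← h.barU₀_mul_step hξ] at h1 h2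
  have hξ' : ξ - η • (S.proj * matGrad S.J ξ) ∈ S.feasible :=
    h.mem_feasible_iff.2 ⟨h.barX₀_mul_step hξ η, h1.1⟩
  have hσ := minSingularValue_mul_norm_sq_le h.M_posDef.posSemidef
    (matGrad (S.model A B W).cost (S.barU₀ * ξ))
  have hσ0 := minSingularValue_pos hm h.M_posDef
  have hd := h.isGradDomConst_iff.1 hg _ hθ
  have hc : 0 < η * (1 - ℓ * opNorm S.M * η / 2) := by
    have h3 := hη.2
    rw [le_div_iff₀ (mul_pos hℓ hMn)] at h3
    exact mul_pos hη.1 (by nlinarith)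
  rw [← h.J_of_feasible hξ', ← h.J_of_feasible hξ] at h2
  rw [← h.J_of_feasible hξ] at hd
  refine ⟨hξ', h.J_of_feasible hξ' ▸ h1.2, ?_⟩
  -- The `M`-weighted squared gradient is at least `σ_min(M) ‖∇J‖²`, and gradient domination bounds
  -- `‖∇J‖²` below by the optimality gap over `lam`.
  have h4 : S.rate η ℓ lam * (S.J ξ - S.optCost A B) ≤
      η * (1 - ℓ * opNorm S.M * η / 2) * (minSingularValue S.M *
        ‖matGrad (S.model A B W).cost (S.barU₀ * ξ)‖ ^ 2) := by
    have h5 : S.rate η ℓ lam = η * (1 - ℓ * opNorm S.M * η / 2) * minSingularValue S.M / lam := rfl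
    rw [h5, div_mul_eq_mul_div, div_le_iff₀ hlam]
    have h6 := mul_le_mul_of_nonneg_left hd (mul_pos hc hσ0).le
    linarith
  have h7 := mul_le_mul_of_nonneg_left hσ hc.le
  linarith

theorem rate_pos (hm : 0 < m) {ℓ lam η : ℝ} (hℓ : 0 < ℓ) (hlam : 0 < lam)
    (hη : η ∈ Set.Ioc (0 : ℝ) (1 / (ℓ * opNorm S.M))) : 0 < S.rate η ℓ lam := by
  let _ : Nonempty (Fin m) := ⟨⟨0, hm⟩⟩
  have hMn : 0 < opNorm S.M := opNorm_pos h.M_posDef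
  have h3 := hη.2
  rw [le_div_iff₀ (mul_pos hℓ hMn)] at h3
  exact div_pos (mul_pos (mul_pos hη.1 (by nlinarith)) (minSingularValue_pos hm h.M_posDef)) hlam

theorem iterate_mem (hm : 0 < m) {ξ₀ : Matrix (Fin m ⊕ Fin n) (Fin n ⊕ Unit) ℝ}
    (hξ₀ : ξ₀ ∈ S.feasible) {ℓ lam η : ℝ}
    (hℓ : 0 < ℓ) (hs : S.IsSmoothnessConst A B (S.J ξ₀) ℓ) (hlam : 0 < lam)
    (hg : S.IsGradDomConst A B (S.J ξ₀) lam)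
    (hη : η ∈ Set.Ioc (0 : ℝ) (1 / (ℓ * opNorm S.M))) (t : ℕ) :
    S.iterate η ξ₀ t ∈ S.feasible ∧ S.J (S.iterate η ξ₀ t) ≤ S.J ξ₀ := by
  induction t with
  | zero => exact ⟨hξ₀, le_rfl⟩
  | succ t ih =>
    obtain ⟨h1, h2, -⟩ := h.step_contraction hm hℓ hs hlam hg hη ih.1 ih.2
    exact ⟨h1, h2⟩

end IsRealizedBy

end Setting
end DeePO
end
-- The main theorem
theorem theorem1 {n m T : ℕ} (hm : 0 < m) {Ω : Type*} [MeasurableSpace Ω]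
    (S : DeePO.Setting n m T Ω) [IsProbabilityMeasure S.P]
    -- weights, and i.i.d. Gaussian noise
    (hQ : S.Q.PosDef) (hR : S.R.PosDef)
    (W : Matrix (Fin n) (Fin n) ℝ) (hW : W.PosDef)
    (hw_law : ∀ t, HasLaw (S.w t) (multivariateGaussian 0 W) S.P)
    (hw_indep : iIndepFun S.w S.P)
    -- persistently exciting data, and the least-squares model
    (hD : S.D₀.rank = m + n)
    (Ahat : Matrix (Fin n) (Fin n) ℝ) (Bhat : Matrix (Fin n) (Fin m) ℝ)
    (hLS : S.IsLeastSquares Ahat Bhat)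
    -- feasible initial policy
    (ξ₀ : Matrix (Fin m ⊕ Fin n) (Fin n ⊕ Unit) ℝ) (hξ₀ : ξ₀ ∈ S.feasible) :
    -- the cost is finite and differentiable on the feasible set
    (∀ ξ ∈ S.feasible, S.JE ξ ≠ ∞ ∧ DifferentiableAt ℝ S.J ξ) ∧
    (∀ a, ∀ θ ∈ S.sublevel a, DifferentiableAt ℝ (S.modelCost Ahat Bhat) θ) ∧
    -- smoothness and gradient-domination constants exist on every sublevel set
    (∀ a, S.optCost Ahat Bhat ≤ a →
      (∃ ℓ, 0 < ℓ ∧ S.IsSmoothnessConst Ahat Bhat a ℓ) ∧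
      (∃ lam, 0 < lam ∧ S.IsGradDomConst Ahat Bhat a lam)) ∧
    -- linear convergence of the iteration
    (∀ ℓ₀ lam₀ : ℝ, 0 < ℓ₀ → S.IsSmoothnessConst Ahat Bhat (S.J ξ₀) ℓ₀ →
      0 < lam₀ → S.IsGradDomConst Ahat Bhat (S.J ξ₀) lam₀ →
      ∀ η ∈ Set.Ioc (0 : ℝ) (1 / (ℓ₀ * DeePO.opNorm S.M)),
        0 < S.rate η ℓ₀ lam₀ ∧
        (S.optCost Ahat Bhat < S.J ξ₀ → S.rate η ℓ₀ lam₀ ≤ 1) ∧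
        ∀ t : ℕ, S.iterate η ξ₀ t ∈ S.feasible ∧
          S.J (S.iterate η ξ₀ (t + 1)) - S.optCost Ahat Bhat ≤
            (1 - S.rate η ℓ₀ lam₀) * (S.J (S.iterate η ξ₀ t) - S.optCost Ahat Bhat)) ∧
    -- the optimum is the certainty-equivalence policy
    (∃ P : Matrix (Fin n) (Fin n) ℝ, S.IsRiccatiSolution Ahat Bhat P ∧
      (∀ P', S.IsRiccatiSolution Ahat Bhat P' → P' = P) ∧
      (∀ θ, θ ≠ S.lqtPolicy Ahat Bhat P →
        S.modelCostE Ahat Bhat (S.lqtPolicy Ahat Bhat P) < S.modelCostE Ahat Bhat θ) ∧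
      ∃ ξstar ∈ S.feasible,
        ξstar = S.Λ⁻¹ * DeePO.Setting.stack (S.lqtPolicy Ahat Bhat P) ∧
        S.J ξstar = S.optCost Ahat Bhat ∧
        ∀ ξ ∈ S.feasible, ξ ≠ ξstar → S.J ξstar < S.J ξ) := by
  have h : S.IsRealizedBy Ahat Bhat W :=
    ⟨hQ, hR, hW, DeePO.Setting.Λ_isUnit_det hm hD, hLS.barX₁_eq,
      DeePO.Setting.modelCostE_eq_average hW hw_law hw_indep hQ.posSemidef hR.posSemidef Ahat Bhat,
      DeePO.Setting.JE_eq_average hW hw_law hw_indep hQ.posSemidef hR.posSemidef⟩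
  -- The feasible initial `ξ₀` provides a stabilizing policy, so the optimum exists.
  obtain ⟨θs, hθs, h0⟩ := DeePO.AffineLQ.exists_adv_eq_zero (L := S.model Ahat Bhat W) hQ hR hW
    ⟨_, (h.mem_feasible_iff.1 hξ₀).2⟩
  have hP := DeePO.AffineLQ.isRiccati_of_adv_eq_zero (L := S.model Ahat Bhat W) hQ hR hθs h0
  set P := ((S.model Ahat Bhat W).value θs).toBlocks₁₁
  obtain ⟨hst, -, hadv⟩ := DeePO.AffineLQ.riccatiPolicy_spec (L := S.model Ahat Bhat W) hQ hR hP
  rw [← DeePO.Setting.IsRealizedBy.lqtPolicy_eq] at hst hadv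
  have hopt := h.optCost_eq hst hadv
  refine ⟨fun ξ hξ => ⟨?_, h.differentiableAt_J hξ⟩, fun a θ hθ => ?_, fun a _ => ⟨?_, ?_⟩,
    fun ℓ lam hℓ hs hlam hg η hη => ⟨h.rate_pos hm hℓ hlam hη, fun hlt => ?_, fun t => ?_⟩, ?_⟩
  · rw [h.JE_of_feasible hξ]
    exact ENNReal.ofReal_ne_top
  · rw [h.sublevel_eq] at hθ
    exact h.differentiableAt_modelCost hθ.1
  · obtain ⟨ℓ, hℓ, hs⟩ :=
      DeePO.AffineLQ.exists_smoothness_const (L := S.model Ahat Bhat W) hQ hR hW a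
    exact ⟨ℓ, hℓ, h.isSmoothnessConst_iff.2 fun θ hθ θ' hθ' _ => hs θ hθ θ' hθ'⟩
  · obtain ⟨lam, hlam, hg⟩ :=
      DeePO.AffineLQ.exists_gradient_domination_const (L := S.model Ahat Bhat W) hQ hR hW a hst
    exact ⟨lam, hlam, h.isGradDomConst_iff.2 fun θ hθ => hopt ▸ hg θ hθ⟩
  · obtain ⟨h1, -, h2⟩ := h.step_contraction hm hℓ hs hlam hg hη hξ₀ le_rfl
    have h3 : S.optCost Ahat Bhat ≤ S.J (ξ₀ - η • (S.proj * DeePO.matGrad S.J ξ₀)) := by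
      obtain ⟨h4, h5⟩ := h.mem_feasible_iff.1 h1
      rw [hopt, h.J_of_feasible h1]
      rcases eq_or_ne (S.barU₀ * (ξ₀ - η • (S.proj * DeePO.matGrad S.J ξ₀)))
        (S.lqtPolicy Ahat Bhat P) with e | e
      · rw [e]
      · exact (DeePO.AffineLQ.cost_lt_of_adv_eq_zero (L := S.model Ahat Bhat W)
          hQ hR hW hst hadv h5 e).le
    -- With a positive initial gap, a rate above one would make the gap after one step negative,
    -- against optimality.
    by_contra hν
    push Not at hν
    nlinarith
  · obtain ⟨h1, h2⟩ := h.iterate_mem hm hξ₀ hℓ hs hlam hg hη t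
    exact ⟨h1, (h.step_contraction hm hℓ hs hlam hg hη h1 h2).2.2⟩
  · obtain ⟨h1, h2⟩ := (DeePO.Setting.eq_inv_mul_stack_iff h.isUnit_det
      (θ := S.lqtPolicy Ahat Bhat P)).1 rfl
    have hfeas := h.mem_feasible_iff.2 ⟨h2, h1.symm ▸ hst⟩
    refine ⟨P, hP, fun P' hP' => DeePO.AffineLQ.isRiccati_unique (L := S.model Ahat Bhat W)
      hQ hR hW hP hP', fun θ hne => h.modelCostE_lt hst hadv hne, _, hfeas, rfl, ?_,
      fun ξ hξ hne => ?_⟩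
    · rw [h.J_of_feasible hfeas, h1, hopt]
    · obtain ⟨h3, h4⟩ := h.mem_feasible_iff.1 hξ
      rw [h.J_of_feasible hfeas, h1, h.J_of_feasible hξ]
      refine DeePO.AffineLQ.cost_lt_of_adv_eq_zero (L := S.model Ahat Bhat W)
        hQ hR hW hst hadv h4 fun e => hne ?_
      exact (DeePO.Setting.eq_inv_mul_stack_iff h.isUnit_det).2 ⟨e, h3⟩
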